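/- Let $m\ge 1$ be an integer and let $f,g\in\mathbb{Z}[t]$ be polynomials with no common real root, with $4f^3+27g^2\neq 0$ and $$\max\{\tfrac12\deg f,\tfrac13\deg g\}=2m .$$ Put $A(x,y)=y^{4m}f(x/y)$ and $B(x,y)=y^{6m}g(x/y)$, homogeneous polynomials in $\mathbb{Z}[x,y]$. For integers $(u,v)\ne(0,0)$ let $m(u,v)$ be the largest integer $d$ with $d^{12}\mid\gcd(u^3,v^2)$. For real $N$ let $$\mathcal{A}(N)=\left\{(a,b)\in\mathbb{Z}^2:\ \gcd(a,b)=1,\ \max\{4|A(a,b)|^3,27B(a,b)^2\}\le N e^{12},\ e=m(A(a,b),B(a,b))\right\},$$ that is, the coprime pairs $(a,b)$ for which $y^2=x^3+A(a,b)x+B(a,b)$ has naive height at most $N$. For an integer $q\ge 1$ and $\alpha\in\mathbb{P}^1(\mathbb{Z}/q\mathbb{Z})$ let $\mathcal{A}(N,\alpha,q)$ be the set of $(a,b)\in\mathcal{A}(N)$ with $[a:b]\equiv\alpha\bmod q$. For polynomials with integer coefficients, not both zero, their gcd means the integer polynomial of highest possible degree, and then of smallest possible positive leading coefficient, that divides both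 over $\mathbb{Q}$. Let $s=\gcd(f^3,g^2)$. Assume that * $\deg s\le\frac{24m}{2+\kappa}$ for some real $\kappa>m$; * if $\deg s>0$, then $s$ is the $r$-th power of a squarefree polynomial in $\mathbb{Q}[t]$, where $r\in\{2,3,4,6\}$. If $\deg s=0$, put $r=1$. Let $S(x,y)=y^{\deg s}s(x/y)$ and let $R$ be the resultant of the forms $A^3/S$ and $B^2/S$, both of degree $12m-\deg s$. For a prime $p$ and $k\ge 1$ put $\nu_p(k)=\max\{\lceil 12k/r\rceil,v_p(R)\}$, and for $n\ge1$ put $\psi(n)=\prod_{p\mid n}p^{\nu_p(v_p(n))}$ and $$\rho(n)=\frac{\left|\{[a:b]\in\mathbb{P}^1(\mathbb{Z}/\psi(n)\mathbb{Z}):\ n^4\mid A(a,b),\ n^6\mid B(a,b)\}\right|}{|\mathbb{P}^1(\mathbb{Z}/\psi(n)\mathbb{Z})|},\qquad \lambda(p)=\left(1+\left(1-p^{-2/m}\right)\sum_{k\ge1}p^{2k/m}\rho(p^k)\right)^{-1},$$ where $[a:b]$ is represented by integers $a,b$ with $\gcd(a,b,\psi(n))=1$. Then the series defining every $\lambda(p)$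 converges, every $\mathcal{A}(N)$ is finite, and there exist $\epsilon>0$ and $C$, depending only on $f$ and $g$, such that for every integer $q\ge1$, every $\alpha=[a_1:b_1]\in\mathbb{P}^1(\mathbb{Z}/q\mathbb{Z})$ with $\gcd(A(a_1,b_1)^3,B(a_1,b_1)^2,q)=1$, and every real $N$ with $|\mathcal{A}(N)|>0$, $$\left|\frac{|\mathcal{A}(N,\alpha,q)|}{|\mathcal{A}(N)|}-\frac{1}{|\mathbb{P}^1(\mathbb{Z}/q\mathbb{Z})|}\prod_{p\mid q}\lambda(p)\right|\le C N^{-\epsilon}.$$ -/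

import Mathlib

open Polynomial

namespace EllFamily

/-! ### Greatest common divisors of integer polynomials -/

/-- `s` divides both `u` and `v` in `ℚ[X]`, has the highest possible degree among the integer
polynomials with this property, and has the smallest possible positive leading coefficient. -/
structure IsPolyGcd (u v s : ℤ[X]) : Prop where
  dvd_left : s.map (Int.castRingHom ℚ) ∣ u.map (Int.castRingHom ℚ)
  dvd_right : s.map (Int.castRingHom ℚ) ∣ v.map (Int.castRingHom ℚ)
  leadingCoeff_pos : 0 < s.leadingCoeff
  natDegree_le : ∀ d : ℤ[X], d.map (Int.castRingHom ℚ) ∣ u.map (Int.castRingHom ℚ) →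
    d.map (Int.castRingHom ℚ) ∣ v.map (Int.castRingHom ℚ) → d.natDegree ≤ s.natDegree
  leadingCoeff_le : ∀ d : ℤ[X], d.map (Int.castRingHom ℚ) ∣ u.map (Int.castRingHom ℚ) →
    d.map (Int.castRingHom ℚ) ∣ v.map (Int.castRingHom ℚ) → d.natDegree = s.natDegree →
    0 < d.leadingCoeff → s.leadingCoeff ≤ d.leadingCoeff

open Classical in
/-- The polynomial gcd of `u` and `v` (and `0` if `u = v = 0`, when there is no highest degree). -/
noncomputable def polyGcd (u v : ℤ[X]) : ℤ[X] :=
  if h : ∃ s, IsPolyGcd u v s then h.choose else 0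

theorem exists_isPolyGcd {u v : ℤ[X]} (huv : u ≠ 0 ∨ v ≠ 0) : ∃ s, IsPolyGcd u v s := by
  have hinj : Function.Injective (Int.castRingHom ℚ) := Int.cast_injective
  set φ := Int.castRingHom ℚ with hφ
  set h : ℚ[X] := EuclideanDomain.gcd (u.map φ) (v.map φ) with hh
  have hh0 : h ≠ 0 := by
    intro h0
    rw [hh, EuclideanDomain.gcd_eq_zero_iff] at h0
    rw [Polynomial.map_eq_zero_iff hinj, Polynomial.map_eq_zero_iff hinj] at h0
    tauto
  obtain ⟨b, hb0, hb⟩ := IsLocalization.integerNormalization_spec (nonZeroDivisors ℤ) h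
  set w := IsLocalization.integerNormalization (nonZeroDivisors ℤ) h with hw
  have hbz : (b : ℚ) ≠ 0 := by
    exact_mod_cast nonZeroDivisors.ne_zero hb0
  have hwh : w.map φ = Polynomial.C (b : ℚ) * h := by
    have : algebraMap ℤ ℚ = φ := rfl
    rw [← this, hb, zsmul_eq_mul]
    simp
  have hw0 : w ≠ 0 := by
    intro h0
    rw [h0, Polynomial.map_zero] at hwh
    exact mul_ne_zero (by simpa using hbz) hh0 hwh.symm
  have hCb : IsUnit (Polynomial.C (b : ℚ)) := Polynomial.isUnit_C.2 (isUnit_iff_ne_zero.2 hbz)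
  set P := w.primPart with hP
  have hPprim : P.IsPrimitive := w.isPrimitive_primPart
  have hP0 : P ≠ 0 := hPprim.ne_zero
  have hwP : w = Polynomial.C w.content * P := w.eq_C_content_mul_primPart
  have hc0 : (w.content : ℚ) ≠ 0 := by
    exact_mod_cast (mt Polynomial.content_eq_zero_iff.1 hw0)
  have hCc : IsUnit (Polynomial.C (w.content : ℚ)) :=
    Polynomial.isUnit_C.2 (isUnit_iff_ne_zero.2 hc0)
  have hPh : Associated (P.map φ) h := by
    have h1 : Associated (w.map φ) h := by
      rw [hwh]; exact (associated_unit_mul_left _ _ hCb)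
    have h2 : Associated (w.map φ) (P.map φ) := by
      have : w.map φ = Polynomial.C (w.content : ℚ) * P.map φ := by
        conv_lhs => rw [hwP]
        simp [hφ]
      rw [this]; exact (associated_unit_mul_left _ _ hCc)
    exact h2.symm.trans h1
  have key : ∀ s : ℤ[X], Associated s P → 0 < s.leadingCoeff → IsPolyGcd u v s := by
    intro s hs hlc
    have hsh : Associated (s.map φ) h := by
      refine Associated.trans ?_ hPh
      exact hs.map (Polynomial.mapRingHom φ : ℤ[X] →+* ℚ[X])
    have hsprim : s.IsPrimitive := by
      rw [Polynomial.isPrimitive_iff_isUnit_of_C_dvd] at hPprim ⊢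
      exact fun r hr => hPprim r (hr.trans hs.dvd)
    have hdvd : ∀ d : ℤ[X], d.map φ ∣ u.map φ → d.map φ ∣ v.map φ → d.map φ ∣ s.map φ :=
      fun d h1 h2 => (EuclideanDomain.dvd_gcd h1 h2).trans hsh.symm.dvd
    have hs0 : s ≠ 0 := hsprim.ne_zero
    refine ⟨hsh.dvd.trans (EuclideanDomain.gcd_dvd_left _ _),
      hsh.dvd.trans (EuclideanDomain.gcd_dvd_right _ _), hlc, fun d h1 h2 => ?_,
      fun d h1 h2 hdeg hpos => ?_⟩
    · have := Polynomial.natDegree_le_of_dvd (hdvd d h1 h2)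
        (by rwa [Ne, Polynomial.map_eq_zero_iff hinj])
      rwa [Polynomial.natDegree_map_eq_of_injective hinj,
        Polynomial.natDegree_map_eq_of_injective hinj] at this
    · have hd0 : d ≠ 0 := by rintro rfl; simp at hpos
      obtain ⟨c, hc⟩ := hdvd d h1 h2
      have hsm0 : s.map φ ≠ 0 := by rwa [Ne, Polynomial.map_eq_zero_iff hinj]
      have hdm0 : d.map φ ≠ 0 := by rwa [Ne, Polynomial.map_eq_zero_iff hinj]
      have hcz : c ≠ 0 := by rintro rfl; simp [hsm0] at hc
      have hcd : c.natDegree = 0 := by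
        have := congrArg Polynomial.natDegree hc
        rw [Polynomial.natDegree_mul hdm0 hcz, Polynomial.natDegree_map_eq_of_injective hinj,
          Polynomial.natDegree_map_eq_of_injective hinj] at this
        omega
      have hcu : IsUnit c := by
        rw [Polynomial.eq_C_of_natDegree_eq_zero hcd] at hcz ⊢
        exact Polynomial.isUnit_C.2 (isUnit_iff_ne_zero.2 (by simpa using hcz))
      have hsd : s.map φ ∣ d.map φ := by
        rw [hc]; exact hcu.mul_right_dvd.2 dvd_rfl
      have hsdz : s ∣ d := hsprim.dvd_of_fraction_map_dvd_fraction_map (K := ℚ) hsd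
      obtain ⟨e, he⟩ := hsdz
      have hl : d.leadingCoeff = s.leadingCoeff * e.leadingCoeff := by
        rw [he, Polynomial.leadingCoeff_mul]
      have : 0 < e.leadingCoeff := by
        rw [hl] at hpos; exact (pos_iff_pos_of_mul_pos hpos).1 hlc
      rw [hl]; nlinarith
  rcases lt_or_gt_of_ne (Polynomial.leadingCoeff_ne_zero.2 hP0) with hneg | hpos
  · exact ⟨-P, key _ (Associated.neg_left (Associated.refl P))
      (by rw [Polynomial.leadingCoeff_neg]; omega)⟩
  · exact ⟨P, key P (Associated.refl P) hpos⟩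

theorem isPolyGcd_polyGcd {u v : ℤ[X]} (huv : u ≠ 0 ∨ v ≠ 0) : IsPolyGcd u v (polyGcd u v) := by
  have h := exists_isPolyGcd huv
  rw [polyGcd, dif_pos h]
  exact h.choose_spec

/-! ### The projective line over `ℤ/M` -/

/-- Unimodular pairs in `(ℤ/M)²`, up to multiplication by units of `ℤ/M`. -/
def p1Setoid (M : ℕ) : Setoid {v : ZMod M × ZMod M // IsCoprime v.1 v.2} where
  r v w := ∃ c : (ZMod M)ˣ, w.1 = (c * v.1.1, c * v.1.2)
  iseqv :=
    { refl := fun v => ⟨1, by simp⟩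
      symm := by
        rintro v w ⟨c, hc⟩
        exact ⟨c⁻¹, by rw [hc]; simp⟩
      trans := by
        rintro v w x ⟨c, hc⟩ ⟨d, hd⟩
        exact ⟨d * c, by rw [hd, hc]; simp [mul_assoc]⟩ }

/-- The projective line `ℙ¹(ℤ/M)`. -/
def P1 (M : ℕ) : Type := Quotient (p1Setoid M)

/-- The integers `a, b` satisfy `gcd(a, b, M) = 1` and `[a : b] ≡ α mod M`. -/
def P1.Rep {M : ℕ} (α : P1 M) (a b : ℤ) : Prop :=
  ∃ h : IsCoprime (a : ZMod M) (b : ZMod M),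
    (Quotient.mk (p1Setoid M) ⟨((a : ZMod M), (b : ZMod M)), h⟩ : P1 M) = α

/-! ### The counting sets -/

/-- The value at `(a, b)` of the form `A(x, y) = y ^ (4 m) * f (x / y)`. -/
noncomputable def formA (f : ℤ[X]) (m : ℕ) (a b : ℤ) : ℤ :=
  MvPolynomial.eval ![a, b] (f.homogenize (4 * m))

/-- The value at `(a, b)` of the form `B(x, y) = y ^ (6 m) * g (x / y)`. -/
noncomputable def formB (g : ℤ[X]) (m : ℕ) (a b : ℤ) : ℤ :=
  MvPolynomial.eval ![a, b] (g.homogenize (6 * m))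

/-- The largest `d` with `d ^ 12 ∣ gcd (A ^ 3, B ^ 2)`, for integers `(A, B) ≠ (0, 0)`. -/
noncomputable def twistDefect (A B : ℤ) : ℕ :=
  sSup {d : ℕ | d ^ 12 ∣ Int.gcd (A ^ 3) (B ^ 2)}

/-- Coprime pairs `(a, b)` for which `y² = x³ + A(a, b) x + B(a, b)` has naive height `≤ N`. -/
def countSet (f g : ℤ[X]) (m : ℕ) (N : ℝ) : Set (ℤ × ℤ) :=
  {v | Int.gcd v.1 v.2 = 1 ∧
    ((max (4 * |formA f m v.1 v.2| ^ 3) (27 * formB g m v.1 v.2 ^ 2) : ℤ) : ℝ) ≤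
      N * (twistDefect (formA f m v.1 v.2) (formB g m v.1 v.2) : ℝ) ^ 12}

/-- The members of `countSet f g m N` with `[a : b] ≡ α mod q`. -/
def countSetMod (f g : ℤ[X]) (m : ℕ) (N : ℝ) {q : ℕ} (α : P1 q) : Set (ℤ × ℤ) :=
  {v | v ∈ countSet f g m N ∧ α.Rep v.1 v.2}

/-! ### The local factors -/

/-- The resultant of the forms `A³ / S` and `B² / S`, where `S = gcd (A³, B²)`. Both forms have
degree `12 m - deg s` and dehomogenise to `f³ / s` and `g² / s`, where `s = gcd (f³, g²)`; so this
is the resultant of the latter two with respect to that formal degree. -/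
noncomputable def cofactorResultant (f g : ℤ[X]) (m : ℕ) : ℚ :=
  Polynomial.resultant
    ((f ^ 3).map (Int.castRingHom ℚ) / (polyGcd (f ^ 3) (g ^ 2)).map (Int.castRingHom ℚ))
    ((g ^ 2).map (Int.castRingHom ℚ) / (polyGcd (f ^ 3) (g ^ 2)).map (Int.castRingHom ℚ))
    (12 * m - (polyGcd (f ^ 3) (g ^ 2)).natDegree)
    (12 * m - (polyGcd (f ^ 3) (g ^ 2)).natDegree)

/-- `ν(k) = max {⌈12 k / r⌉, v_p(R)}` at the prime `p`, with `R` the resultant above. -/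
noncomputable def nu (f g : ℤ[X]) (m r p k : ℕ) : ℕ :=
  (max ⌈(12 * k : ℚ) / r⌉ (padicValRat p (cofactorResultant f g m))).toNat

/-- `ψ(n) = ∏_{p ∣ n} p ^ ν(v_p(n))`. -/
noncomputable def psi (f g : ℤ[X]) (m r n : ℕ) : ℕ :=
  ∏ p ∈ n.primeFactors, p ^ nu f g m r p (n.factorization p)

/-- The number of `[a : b] ∈ ℙ¹(ℤ/ψ(n))` with `n⁴ ∣ A(a, b)` and `n⁶ ∣ B(a, b)`. -/
noncomputable def eta (f g : ℤ[X]) (m r n : ℕ) : ℕ :=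
  Nat.card {P : P1 (psi f g m r n) // ∃ a b : ℤ, P.Rep a b ∧
    (n : ℤ) ^ 4 ∣ formA f m a b ∧ (n : ℤ) ^ 6 ∣ formB g m a b}

/-- `ρ(n) = η(n) / |ℙ¹(ℤ/ψ(n))|`. -/
noncomputable def rho (f g : ℤ[X]) (m r n : ℕ) : ℝ :=
  (eta f g m r n : ℝ) / (Nat.card (P1 (psi f g m r n)) : ℝ)

/-- The `k`-th term `p ^ (2 k / m) * ρ(p ^ k)` of the series in the local factor. -/
noncomputable def localTerm (f g : ℤ[X]) (m r p k : ℕ) : ℝ :=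
  (p : ℝ) ^ ((2 * k : ℝ) / m) * rho f g m r (p ^ k)

/-- `λ(p) = (1 + (1 - p ^ (-2 / m)) ∑_{k ≥ 1} p ^ (2 k / m) ρ(p ^ k))⁻¹`. -/
noncomputable def localFactor (f g : ℤ[X]) (m r p : ℕ) : ℝ :=
  (1 + (1 - 1 / (p : ℝ) ^ ((2 : ℝ) / m)) * ∑' k : ℕ, localTerm f g m r p (k + 1))⁻¹

/-- The shape of the common factor `s`: if `deg s > 0`, then `s` is an `r`-th power of a squarefree
polynomial in `ℚ[X]`, with `r ∈ {2, 3, 4, 6}`; if `deg s = 0`, then `r = 1` by convention. -/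
def IsPowerExponent (s : ℤ[X]) (r : ℕ) : Prop :=
  (s.natDegree = 0 ∧ r = 1) ∨
    (0 < s.natDegree ∧ (r = 2 ∨ r = 3 ∨ r = 4 ∨ r = 6) ∧
      ∃ k : ℚ[X], Squarefree k ∧ s.map (Int.castRingHom ℚ) = k ^ r)

end EllFamily

/-! Let `H = max(4|A|^3, 27B^2)`. It is homogeneous of degree `12m`, and since `f` and `g` have no
common real root and one of them has full degree, it vanishes only at the origin. So `G =
H^(1/(12m))` is a gauge (`IsGauge`): homogeneous of degree one, coercive and Lipschitz. With `X =
N^(1/(12m))`, a primitive point `v` of defect `e` is counted exactly when `G(v) ≤ X e^(1/m)`.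

The radius thus varies with `e`. Möbius inversion over the divisors of `e` removes this dependence:
the count over `α` equals the sum over `k` and over `dl = k` of `μ(d)` times the number of primitive
`v` over `α` with `G(v) ≤ X l^(1/m)` and `k ∣ e(v)` (`ncard_ballSet_eq`). The condition `k ∣ e(v)`
says `k^4 ∣ A` and `k^6 ∣ B`, and it depends only on the class of `v` modulo `ψ(k)`
(`isPeriodicCond`). Counting lattice points in classes gives each inner count the main term `c ρ(k)
X^2 l^(2/m) / |P^1(Z/q)|`, where `c` is the density of primitive points for `G`. Summing over `dl =
k` turns `l^(2/m)` into the Jordan totient `J(k)` of exponent `2/m`. By the gcd hypothesis on `α`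
only `k` prime to `q` contribute (`condPts_eq_empty`). The Euler factor of `∑ J(k) ρ(k)` at `p` is
`1/λ(p)`, so leaving out the primes of `q` multiplies the series by `∏ λ(p)` (`tsum_densTerm_mul`).
The quotient by the total count is the asserted limit.

For the error terms, write `f^3 = h^r F` and `g^2 = h^r G` with `h` squarefree and `F`, `G` coprime
of resultant `R` (`FamilyData`). The local condition at `k` forces `k^12 ∣ h(v)^r R`, hence `E ∣
h(v)` for some `E` of size at least `k^(12/r)/|R|`. The zeros of `h` modulo `E` are few (`O(k^η)`),
and primitive points over one of them and over `α` have pairwise determinants divisible by `qE`. A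
pigeonhole on slopes leaves `O(T^2/(qE) + 1)` of them in radius `T` (`card_le_of_dvd_det`,
`exists_card_condPts_le`). This bound is uniform in `q` and `k`, and it replaces the asymptotics
when `q` or `k` exceeds a small power of `X`.

The hypotheses on `s` make the two resulting sums small. The terms `T^2/(qE)` form a convergent
series as soon as `12/r - 2/m > 1`; this holds because `h` has no real root, so a nonconstant `h`
has degree at least two. The terms `1` add up to about the number of possible `k`, which is `O(X^β)`
with `β = max(1, m deg s / (12m - deg s)) < 2` (`exists_le_rpow_of_localCond`). -/

namespace EllFamily
-- Lattice points in the balls of a gauge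
open MeasureTheory

/-- The real point underlying an integer vector. -/
def toR (w : ℤ × ℤ) : ℝ × ℝ := ((w.1 : ℝ), (w.2 : ℝ))

/-- `G` is positively homogeneous of degree one, Lipschitz and coercive, with constant `C`. -/
structure IsGauge (G : ℝ × ℝ → ℝ) (C : ℝ) : Prop where
  one_le : 1 ≤ C
  norm_le : ∀ v, ‖v‖ ≤ C * G v
  add_le : ∀ v w, G (v + w) ≤ G v + C * ‖w‖
  smul : ∀ t : ℝ, 0 < t → ∀ v, G (t • v) = t * G v

namespace IsGauge

variable {G : ℝ × ℝ → ℝ} {C : ℝ}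

lemma pos (h : IsGauge G C) : 0 < C := lt_of_lt_of_le one_pos h.one_le

lemma map_zero (h : IsGauge G C) : G 0 = 0 := by
  have := h.smul 2 two_pos 0
  rw [smul_zero] at this
  linarith

lemma le_norm (h : IsGauge G C) (v) : G v ≤ C * ‖v‖ := by
  have := h.add_le 0 v
  rwa [zero_add, h.map_zero, zero_add] at this

/-- The area of the unit ball of the gauge. -/
noncomputable def vol (G : ℝ × ℝ → ℝ) : ℝ := (volume {v | G v ≤ 1}).toReal

open scoped Pointwise in
lemma setOf_le_eq_smul (h : IsGauge G C) {T : ℝ} (hT : 0 < T) :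
    {v | G v ≤ T} = T • {v | G v ≤ 1} := by
  ext v
  rw [Set.mem_smul_set_iff_inv_smul_mem₀ hT.ne', Set.mem_ofPred_eq, Set.mem_ofPred_eq,
    h.smul _ (inv_pos.2 hT), inv_mul_le_iff₀ hT, mul_one]

lemma isBounded_setOf_le (h : IsGauge G C) (T : ℝ) : Bornology.IsBounded {v | G v ≤ T} := by
  refine (Metric.isBounded_closedBall (x := (0 : ℝ × ℝ)) (r := C * T)).subset fun v hv => ?_
  rw [mem_closedBall_zero_iff]
  exact (h.norm_le v).trans (mul_le_mul_of_nonneg_left hv h.pos.le)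

lemma volume_ne_top (h : IsGauge G C) (T : ℝ) : volume {v | G v ≤ T} ≠ ⊤ :=
  (h.isBounded_setOf_le T).measure_lt_top.ne

open scoped Pointwise in
lemma volume_real (h : IsGauge G C) {T : ℝ} (hT : 0 ≤ T) :
    (volume {v | G v ≤ T}).toReal = vol G * T ^ 2 := by
  rcases hT.eq_or_lt with rfl | hT
  · have : {v | G v ≤ 0} ⊆ {0} := fun v hv => by
      have h1 := (h.norm_le v).trans (mul_le_mul_of_nonneg_left hv h.pos.le)
      rw [mul_zero] at h1
      simpa using h1
    rw [measure_mono_null this (by simp)]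
    simp
  · rw [h.setOf_le_eq_smul hT, Measure.addHaar_smul]
    simp [vol, mul_comm, sq_nonneg]

lemma vol_pos (h : IsGauge G C) : 0 < vol G := by
  refine ENNReal.toReal_pos (ne_of_gt ?_) (h.volume_ne_top 1)
  have : Metric.ball (0 : ℝ × ℝ) C⁻¹ ⊆ {v | G v ≤ 1} := fun v hv => by
    rw [mem_ball_zero_iff] at hv
    refine (h.le_norm v).trans ?_
    rw [← mul_inv_cancel₀ h.pos.ne']
    exact mul_le_mul_of_nonneg_left hv.le h.pos.le
  exact (Metric.measure_ball_pos volume _ (inv_pos.2 h.pos)).trans_le (measure_mono this)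

/-- The unit square with lower left corner `v`. -/
def box (v : ℝ × ℝ) : Set (ℝ × ℝ) := Set.Ico v.1 (v.1 + 1) ×ˢ Set.Ico v.2 (v.2 + 1)

lemma volume_box (v : ℝ × ℝ) : volume (box v) = 1 := by
  rw [box, Measure.volume_eq_prod, Measure.prod_prod]
  simp

lemma norm_sub_le_of_mem_box {v x : ℝ × ℝ} (hx : x ∈ box v) : ‖x - v‖ ≤ 1 := by
  obtain ⟨⟨h1, h2⟩, h3, h4⟩ := hx
  rw [Prod.norm_def, max_le_iff, Real.norm_eq_abs, Real.norm_eq_abs, abs_le, abs_le]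
  simp only [Prod.fst_sub, Prod.snd_sub]
  refine ⟨⟨?_, ?_⟩, ?_, ?_⟩ <;> linarith

lemma box_disjoint (u : ℝ × ℝ) : Pairwise (Function.onFun Disjoint fun w : ℤ × ℤ => box (toR w + u)) := by
  intro w w' hne
  refine Set.disjoint_left.2 fun x hx hx' => hne ?_
  obtain ⟨⟨h1, h2⟩, h3, h4⟩ := hx
  obtain ⟨⟨h1', h2'⟩, h3', h4'⟩ := hx'
  simp only [toR, Prod.fst_add, Prod.snd_add] at *
  have e1 : w.1 = w'.1 := by
    apply le_antisymm <;> apply Int.le_of_lt_add_one <;> rify <;> linarith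
  have e2 : w.2 = w'.2 := by
    apply le_antisymm <;> apply Int.le_of_lt_add_one <;> rify <;> linarith
  exact Prod.ext e1 e2

lemma exists_mem_box (u x : ℝ × ℝ) : ∃ w : ℤ × ℤ, x ∈ box (toR w + u) := by
  refine ⟨(⌊x.1 - u.1⌋, ⌊x.2 - u.2⌋), ?_⟩
  have := Int.floor_le (x.1 - u.1)
  have := Int.lt_floor_add_one (x.1 - u.1)
  have := Int.floor_le (x.2 - u.2)
  have := Int.lt_floor_add_one (x.2 - u.2)
  refine ⟨⟨?_, ?_⟩, ?_, ?_⟩ <;> simp only [toR, Prod.fst_add, Prod.snd_add] <;> linarith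

lemma finite_shift (h : IsGauge G C) (u : ℝ × ℝ) (T : ℝ) :
    {w : ℤ × ℤ | G (toR w + u) ≤ T}.Finite := by
  obtain ⟨K, hK⟩ := exists_nat_gt (C * T + ‖u‖)
  refine (Set.finite_Icc ((-K, -K) : ℤ × ℤ) (K, K)).subset fun w hw => ?_
  have h1 : ‖toR w‖ ≤ K := by
    have h2 := (h.norm_le _).trans (mul_le_mul_of_nonneg_left hw h.pos.le)
    have h3 : ‖toR w‖ ≤ ‖toR w + u‖ + ‖u‖ := by
      simpa using norm_sub_le (toR w + u) u
    linarith
  rw [Prod.norm_def, max_le_iff, Real.norm_eq_abs, Real.norm_eq_abs, abs_le, abs_le] at h1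
  obtain ⟨⟨h1, h2⟩, h3, h4⟩ := h1
  simp only [toR] at *
  exact ⟨⟨by exact_mod_cast h1, by exact_mod_cast h3⟩, by exact_mod_cast h2, by exact_mod_cast h4⟩

/-- The unit squares at the points of the shifted lattice tile the plane. By the Lipschitz property,
those whose corner lies in the ball of radius `T` are contained in the ball of radius `T + C` and
cover the ball of radius `T - C`; comparing areas gives both bounds. The constants do not depend on
the shift, which makes the later counts uniform in the residue class. -/
theorem abs_ncard_shift_sub_le (h : IsGauge G C) (u : ℝ × ℝ) {T : ℝ} (hT : 0 ≤ T) :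
    |({w : ℤ × ℤ | G (toR w + u) ≤ T}.ncard : ℝ) - vol G * T ^ 2| ≤
      vol G * (2 * C ^ 2) * (T + 1) := by
  have hV := h.vol_pos
  have hC := h.one_le
  set S := (h.finite_shift u T).toFinset with hS
  have hmem : ∀ w, w ∈ S ↔ G (toR w + u) ≤ T := fun w => by simp [hS]
  have hcard : {w : ℤ × ℤ | G (toR w + u) ≤ T}.ncard = S.card := by
    rw [Set.ncard_eq_toFinset_card _ (h.finite_shift u T)]
  have hvol : volume (⋃ w ∈ S, box (toR w + u)) = S.card := by
    rw [measure_biUnion_finset (fun w _ w' _ hne => box_disjoint u hne)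
      (fun w _ => measurableSet_Ico.prod measurableSet_Ico)]
    simp [volume_box]
  have hup : (S.card : ℝ) ≤ vol G * (T + C) ^ 2 := by
    have : (⋃ w ∈ S, box (toR w + u)) ⊆ {v | G v ≤ T + C} := by
      refine Set.iUnion₂_subset fun w hw x hx => ?_
      have h1 := h.add_le (toR w + u) (x - (toR w + u))
      rw [add_sub_cancel] at h1
      have h2 := mul_le_mul_of_nonneg_left (norm_sub_le_of_mem_box hx) h.pos.le
      have h3 := (hmem w).1 hw
      simp only [Set.mem_ofPred_eq]
      linarith
    have h1 := ENNReal.toReal_mono (h.volume_ne_top _) (measure_mono this (μ := volume))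
    rwa [hvol, h.volume_real (by linarith), ENNReal.toReal_natCast] at h1
  have hlo : C ≤ T → vol G * (T - C) ^ 2 ≤ (S.card : ℝ) := by
    intro hCT
    have : {v | G v ≤ T - C} ⊆ ⋃ w ∈ S, box (toR w + u) := by
      intro x hx
      obtain ⟨w, hw⟩ := exists_mem_box u x
      refine Set.mem_iUnion₂.2 ⟨w, (hmem w).2 ?_, hw⟩
      have h1 := h.add_le x (toR w + u - x)
      rw [add_sub_cancel] at h1
      have h2 := mul_le_mul_of_nonneg_left (norm_sub_le_of_mem_box hw) h.pos.le
      rw [norm_sub_rev] at h2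
      simp only [Set.mem_ofPred_eq] at hx
      linarith
    have h1 := ENNReal.toReal_mono (by rw [hvol]; exact ENNReal.natCast_ne_top _)
      (measure_mono this (μ := volume))
    rwa [hvol, h.volume_real (by linarith), ENNReal.toReal_natCast] at h1
  rw [hcard, abs_le]
  constructor
  · by_cases hCT : C ≤ T
    · have := hlo hCT
      have h2 : vol G * (T ^ 2 - 2 * C ^ 2 * (T + 1)) ≤ vol G * (T - C) ^ 2 := by
        apply mul_le_mul_of_nonneg_left _ hV.le
        nlinarith [mul_nonneg hT (sub_nonneg.2 hC), mul_nonneg (mul_nonneg hT (sub_nonneg.2 hC)) h.pos.le]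
      linarith
    -- For `T < C` there is no inner ball, but the whole main term is already below the error term.
    · push Not at hCT
      have h2 : vol G * T ^ 2 ≤ vol G * (2 * C ^ 2 * (T + 1)) := by
        apply mul_le_mul_of_nonneg_left _ hV.le
        nlinarith [mul_nonneg (sq_nonneg C) hT]
      have : (0 : ℝ) ≤ S.card := by positivity
      linarith
  · have h2 : vol G * (T + C) ^ 2 ≤ vol G * (T ^ 2 + 2 * C ^ 2 * (T + 1)) := by
      apply mul_le_mul_of_nonneg_left _ hV.le
      nlinarith [mul_nonneg hT (sub_nonneg.2 hC), mul_nonneg (mul_nonneg hT (sub_nonneg.2 hC)) h.pos.le]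
    linarith

end IsGauge
end EllFamily

namespace EllFamily

/-! ### Points of the projective line modulo `M` -/

/-- The multiplier is forced: applying the Bezout coefficients of `(x, y)` to `(x', y')` gives `s *
x' + t * y'`, and exchanging the two vectors gives its inverse. -/
lemma exists_unit_smul_iff {R : Type*} [CommRing R] {x y x' y' : R} (h : IsCoprime x y)
    (h' : IsCoprime x' y') :
    (∃ c : Rˣ, (x', y') = (c * x, c * y)) ↔ x' * y = y' * x := by
  constructor
  · rintro ⟨c, hc⟩
    obtain ⟨rfl, rfl⟩ := Prod.ext_iff.1 hc
    ring
  · intro hd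
    obtain ⟨s, t, hst⟩ := h
    obtain ⟨s', t', hst'⟩ := h'
    have hx : (s * x' + t * y') * x = x' := by linear_combination x' * hst - t * hd
    have hy : (s * x' + t * y') * y = y' := by linear_combination y' * hst + s * hd
    refine ⟨Units.mkOfMulEqOne (s * x' + t * y') (s' * x + t' * y) ?_, ?_⟩
    · linear_combination s' * hx + t' * hy + hst'
    · simp [hx, hy]

/-- Over the integers the condition is visibly multiplicative in `M`, which the Chinese remainder
theorem for the projective line needs. -/
lemma isCoprime_zmod_iff (M : ℕ) (a b : ℤ) :
    IsCoprime (a : ZMod M) (b : ZMod M) ↔ IsCoprime (Int.gcd a b : ℤ) (M : ℤ) := by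
  constructor
  · rintro ⟨s, t, hst⟩
    obtain ⟨s, rfl⟩ := ZMod.intCast_surjective s
    obtain ⟨t, rfl⟩ := ZMod.intCast_surjective t
    have : ((s * a + t * b - 1 : ℤ) : ZMod M) = 0 := by push_cast; rw [hst]; ring
    obtain ⟨k, hk⟩ := (ZMod.intCast_zmod_eq_zero_iff_dvd _ _).1 this
    obtain ⟨x, hx⟩ := Int.gcd_dvd_left (a := a) (b := b)
    obtain ⟨y, hy⟩ := Int.gcd_dvd_right (a := a) (b := b)
    refine ⟨s * x + t * y, -k, ?_⟩
    linear_combination hk - s * hx - t * hy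
  · rintro ⟨u, w, huw⟩
    rw [Int.gcd_eq_gcd_ab] at huw
    refine ⟨((u * Int.gcdA a b : ℤ) : ZMod M), ((u * Int.gcdB a b : ℤ) : ZMod M), ?_⟩
    have : ((u * (a * Int.gcdA a b + b * Int.gcdB a b) + w * M : ℤ) : ZMod M) = 1 := by
      rw [huw]; simp
    rw [← this]; push_cast; simp; ring

lemma isCoprime_zmod_of_gcd_eq_one (M : ℕ) {a b : ℤ} (h : Int.gcd a b = 1) :
    IsCoprime (a : ZMod M) (b : ZMod M) := by
  rw [isCoprime_zmod_iff, h]; exact isCoprime_one_left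

lemma isCoprime_zmod_mul_iff (M N : ℕ) (a b : ℤ) :
    IsCoprime (a : ZMod (M * N)) (b : ZMod (M * N)) ↔
      IsCoprime (a : ZMod M) (b : ZMod M) ∧ IsCoprime (a : ZMod N) (b : ZMod N) := by
  simp only [isCoprime_zmod_iff, Nat.cast_mul, IsCoprime.mul_right_iff]

lemma isCoprime_zmod_of_dvd {M N : ℕ} (h : M ∣ N) {a b : ℤ}
    (hab : IsCoprime (a : ZMod N) (b : ZMod N)) : IsCoprime (a : ZMod M) (b : ZMod M) := by
  obtain ⟨k, rfl⟩ := h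
  exact ((isCoprime_zmod_mul_iff _ _ _ _).1 hab).1

namespace P1

lemma exists_rep {M : ℕ} (α : P1 M) : ∃ a b : ℤ, α.Rep a b := by
  induction α using Quotient.inductionOn with
  | h v =>
    obtain ⟨⟨x, y⟩, hxy⟩ := v
    obtain ⟨a, rfl⟩ := ZMod.intCast_surjective x
    obtain ⟨b, rfl⟩ := ZMod.intCast_surjective y
    exact ⟨a, b, hxy, rfl⟩

lemma exists_of_isCoprime {M : ℕ} {a b : ℤ} (h : IsCoprime (a : ZMod M) (b : ZMod M)) :
    ∃ α : P1 M, α.Rep a b := ⟨_, h, rfl⟩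

lemma Rep.isCoprime {M : ℕ} {α : P1 M} {a b : ℤ} (h : α.Rep a b) :
    IsCoprime (a : ZMod M) (b : ZMod M) := h.1

lemma Rep.eq {M : ℕ} {α β : P1 M} {a b : ℤ} (h : α.Rep a b) (h' : β.Rep a b) : α = β := by
  obtain ⟨_, rfl⟩ := h
  obtain ⟨_, rfl⟩ := h'
  rfl

/-- Equality of classes becomes divisibility of a determinant, the form in which congruence
conditions enter `card_le_of_dvd_det`. -/
lemma Rep.iff {M : ℕ} {α : P1 M} {a₀ b₀ : ℤ} (h₀ : α.Rep a₀ b₀) {a b : ℤ} :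
    α.Rep a b ↔ IsCoprime (a : ZMod M) (b : ZMod M) ∧ (M : ℤ) ∣ a * b₀ - b * a₀ := by
  obtain ⟨h, rfl⟩ := h₀
  rw [← ZMod.intCast_zmod_eq_zero_iff_dvd]
  push_cast
  rw [sub_eq_zero]
  constructor
  · rintro ⟨h', heq⟩
    refine ⟨h', ?_⟩
    have := Quotient.exact heq
    have := (exists_unit_smul_iff h' h).1 this
    linear_combination -this
  · rintro ⟨h', heq⟩
    refine ⟨h', Quotient.sound ?_⟩
    exact (exists_unit_smul_iff h' h).2 (by linear_combination -heq)

lemma Rep.dvd {M : ℕ} {α : P1 M} {a₀ b₀ : ℤ} (h₀ : α.Rep a₀ b₀) {a b : ℤ} (h : α.Rep a b) :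
    (M : ℤ) ∣ a * b₀ - b * a₀ := (h₀.iff.1 h).2

/-- Two representatives differ by a factor that is a unit modulo `M`. -/
lemma Rep.exists_mul {M : ℕ} {α : P1 M} {a₀ b₀ : ℤ} (h₀ : α.Rep a₀ b₀) {a b : ℤ}
    (h : α.Rep a b) : ∃ c : ℤ, (a : ZMod M) = (c * a₀ : ℤ) ∧ (b : ZMod M) = (c * b₀ : ℤ) := by
  obtain ⟨h, rfl⟩ := h
  obtain ⟨h₀, he⟩ := h₀
  obtain ⟨c, hc⟩ := Quotient.exact he
  obtain ⟨c', hc'⟩ := ZMod.intCast_surjective (c : ZMod M)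
  refine ⟨c', ?_, ?_⟩
  · push_cast; rw [hc']; exact congrArg Prod.fst hc
  · push_cast; rw [hc']; exact congrArg Prod.snd hc

instance finite (M : ℕ) [NeZero M] : Finite (P1 M) := by
  unfold P1
  infer_instance

/-- Reduction of points along `M ∣ N`. -/
noncomputable def red {M N : ℕ} (h : M ∣ N) (α : P1 N) : P1 M :=
  (exists_of_isCoprime (isCoprime_zmod_of_dvd h α.exists_rep.choose_spec.choose_spec.isCoprime)).choose

lemma Rep.red {M N : ℕ} (h : M ∣ N) {α : P1 N} {a b : ℤ} (hα : α.Rep a b) :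
    (P1.red h α).Rep a b := by
  have h1 := (exists_of_isCoprime (isCoprime_zmod_of_dvd h
    α.exists_rep.choose_spec.choose_spec.isCoprime)).choose_spec
  refine (h1.iff).2 ⟨isCoprime_zmod_of_dvd h hα.isCoprime, ?_⟩
  exact (Int.natCast_dvd_natCast.2 h).trans (α.exists_rep.choose_spec.choose_spec.dvd hα)

lemma red_eq_iff {M N : ℕ} (h : M ∣ N) {α : P1 N} {β : P1 M} {a b : ℤ} (hα : α.Rep a b) :
    P1.red h α = β ↔ β.Rep a b :=
  ⟨fun e => e ▸ hα.red h, fun e => (hα.red h).eq e⟩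

lemma exists_rep_of_coprime {M N : ℕ} (h : M.Coprime N) (α : P1 M) (β : P1 N) :
    ∃ a b : ℤ, α.Rep a b ∧ β.Rep a b ∧ IsCoprime (a : ZMod (M * N)) (b : ZMod (M * N)) := by
  obtain ⟨a, b, hab⟩ := α.exists_rep
  obtain ⟨a', b', hab'⟩ := β.exists_rep
  obtain ⟨s, t, hst⟩ := Nat.isCoprime_iff_coprime.2 h
  have key : ∀ x y : ℤ, ((x * (t * N) + y * (s * M) : ℤ) : ZMod M) = x ∧
      ((x * (t * N) + y * (s * M) : ℤ) : ZMod N) = y := by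
    intro x y
    constructor
    · rw [ZMod.intCast_eq_intCast_iff_dvd_sub]
      exact ⟨(x - y) * s, by linear_combination (-x) * hst⟩
    · rw [ZMod.intCast_eq_intCast_iff_dvd_sub]
      exact ⟨(y - x) * t, by linear_combination (-y) * hst⟩
  have hr : ∀ {K : ℕ} {γ : P1 K} {x y x' y' : ℤ}, (x' : ZMod K) = x → (y' : ZMod K) = y →
      γ.Rep x y → γ.Rep x' y' := by
    rintro K γ x y x' y' hx hy ⟨hc, h⟩
    have hc' : IsCoprime (x' : ZMod K) (y' : ZMod K) := by rwa [hx, hy]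
    refine ⟨hc', ?_⟩
    rw [← h]
    congr 2
    rw [hx, hy]
  have h1 := hr (key a a').1 (key b b').1 hab
  have h2 := hr (key a a').2 (key b b').2 hab'
  exact ⟨_, _, h1, h2, (isCoprime_zmod_mul_iff _ _ _ _).2 ⟨h1.isCoprime, h2.isCoprime⟩⟩

/-- The Chinese remainder theorem for projective lines. -/
noncomputable def crt {M N : ℕ} (h : M.Coprime N) : P1 (M * N) ≃ P1 M × P1 N :=
  Equiv.ofBijective (fun α => (red (dvd_mul_right M N) α, red (dvd_mul_left N M) α)) <| by
    constructor
    · intro α β he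
      obtain ⟨a, b, hα⟩ := α.exists_rep
      obtain ⟨a', b', hβ⟩ := β.exists_rep
      obtain ⟨h1, h2⟩ := Prod.ext_iff.1 he
      simp only at h1 h2
      rw [red_eq_iff _ hα] at h1 h2
      refine hα.eq (hβ.iff.2 ⟨hα.isCoprime, ?_⟩)
      rw [Nat.cast_mul]
      exact (Nat.isCoprime_iff_coprime.2 h).mul_dvd ((hβ.red _).dvd h1) ((hβ.red _).dvd h2)
    · rintro ⟨α, β⟩
      obtain ⟨a, b, h1, h2, hc⟩ := exists_rep_of_coprime h α β
      obtain ⟨γ, hγ⟩ := exists_of_isCoprime hc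
      exact ⟨γ, Prod.ext ((red_eq_iff (dvd_mul_right M N) hγ).2 h1)
        ((red_eq_iff (dvd_mul_left N M) hγ).2 h2)⟩

lemma card_mul {M N : ℕ} (h : M.Coprime N) :
    Nat.card (P1 (M * N)) = Nat.card (P1 M) * Nat.card (P1 N) := by
  rw [Nat.card_congr (crt h), Nat.card_prod]

lemma card_subtype_mul {M N : ℕ} (h : M.Coprime N) (p : P1 (M * N) → Prop) (p₁ : P1 M → Prop)
    (p₂ : P1 N → Prop)
    (hp : ∀ α, p α ↔ p₁ (red (dvd_mul_right M N) α) ∧ p₂ (red (dvd_mul_left N M) α)) :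
    Nat.card {α // p α} = Nat.card {α // p₁ α} * Nat.card {α // p₂ α} := by
  rw [← Nat.card_prod]
  refine Nat.card_congr (((crt h).subtypeEquiv (q := fun x => p₁ x.1 ∧ p₂ x.2) fun α => ?_).trans
    (Equiv.subtypeProdEquivProd (p := p₁) (q := p₂)))
  exact hp α

/-- The affine chart `[t : 1]` is injective. -/
lemma le_card (M : ℕ) [NeZero M] : M ≤ Nat.card (P1 M) := by
  have hc : ∀ t : ZMod M, IsCoprime t (1 : ZMod M) := fun t => isCoprime_one_right
  have : Function.Injective
      (fun t : ZMod M => (Quotient.mk (p1Setoid M) ⟨(t, 1), hc t⟩ : P1 M)) := by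
    intro t t' h
    have := (exists_unit_smul_iff (hc t) (hc t')).1 (Quotient.exact h)
    simpa using this.symm
  have := Nat.card_le_card_of_injective (β := P1 M) _ this
  rwa [Nat.card_zmod] at this

lemma card_le (M : ℕ) [NeZero M] : Nat.card (P1 M) ≤ M ^ 2 := by
  have h1 : Nat.card (P1 M) ≤ Nat.card {v : ZMod M × ZMod M // IsCoprime v.1 v.2} :=
    Nat.card_le_card_of_surjective _ (Quotient.mk_surjective (s := p1Setoid M))
  have h2 := Nat.card_le_card_of_injective (Subtype.val : {v : ZMod M × ZMod M //
    IsCoprime v.1 v.2} → _) Subtype.val_injective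
  refine h1.trans (h2.trans (le_of_eq ?_))
  rw [Nat.card_prod, Nat.card_zmod, sq]

lemma card_pos (M : ℕ) [NeZero M] : 0 < Nat.card (P1 M) :=
  (Nat.pos_of_ne_zero (NeZero.ne M)).trans_le (le_card M)

end P1
end EllFamily

namespace EllFamily
open Finset
open scoped Classical ArithmeticFunction.Moebius

/-! ### Auxiliary sums -/

/-- Half of the excess decay, `n^(-θ)`, is at most `Y^(-θ)` on the tail; the other half keeps the
series convergent. -/
lemma abs_tsum_sub_sum_Icc_le {f : ℕ → ℝ} {A θ : ℝ} (hθ : 0 < θ) (h0 : f 0 = 0)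
    (hf : ∀ n : ℕ, 1 ≤ n → |f n| ≤ A * (n : ℝ) ^ (-1 - 2 * θ)) {Y : ℕ} (hY : 1 ≤ Y) :
    Summable f ∧ |∑' n, f n - ∑ n ∈ Icc 1 Y, f n| ≤
      A * (∑' n : ℕ, (n : ℝ) ^ (-1 - θ)) * (Y : ℝ) ^ (-θ) := by
  have hs : Summable fun n : ℕ => (n : ℝ) ^ (-1 - θ) := Real.summable_nat_rpow.2 (by linarith)
  have hA : 0 ≤ A := by simpa using (abs_nonneg _).trans (hf 1 le_rfl)
  have hle : ∀ n : ℕ, 1 ≤ n → A * (n : ℝ) ^ (-1 - 2 * θ) = A * (n : ℝ) ^ (-1 - θ) * (n : ℝ) ^ (-θ) := by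
    intro n hn
    rw [mul_assoc, ← Real.rpow_add (by exact_mod_cast hn)]
    ring_nf
  have hone : ∀ n : ℕ, 1 ≤ n → (n : ℝ) ^ (-θ) ≤ 1 := fun n hn =>
    Real.rpow_le_one_of_one_le_of_nonpos (by exact_mod_cast hn) (by linarith)
  have hfs : Summable f := by
    refine Summable.of_norm_bounded (hs.mul_left A) fun n => ?_
    rcases Nat.eq_zero_or_pos n with rfl | hn
    · rw [h0, norm_zero]; positivity
    · refine (hf n hn).trans ((hle n hn).trans_le ?_)
      exact mul_le_of_le_one_right (by positivity) (hone n hn)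
  refine ⟨hfs, ?_⟩
  have heq : ∑' n, f n - ∑ n ∈ Icc 1 Y, f n = ∑' n, if n ∈ Icc 1 Y then 0 else f n := by
    have h1 : Summable fun n => if n ∈ Icc 1 Y then 0 else f n :=
      Summable.of_norm_bounded hfs.norm fun n => by split_ifs <;> simp
    have h2 : Summable fun n => if n ∈ Icc 1 Y then f n else 0 :=
      Summable.of_norm_bounded hfs.norm fun n => by split_ifs <;> simp
    have h3 : ∑' n, (if n ∈ Icc 1 Y then f n else 0) = ∑ n ∈ Icc 1 Y, f n := by
      rw [tsum_eq_sum (s := Icc 1 Y) fun n hn => if_neg hn]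
      exact sum_congr rfl fun n hn => if_pos hn
    rw [sub_eq_iff_eq_add, ← h3, ← h1.tsum_add h2]
    congr 1; ext n; split_ifs <;> simp
  rw [heq, ← Real.norm_eq_abs]
  have hg : Summable fun n : ℕ => A * (Y : ℝ) ^ (-θ) * (n : ℝ) ^ (-1 - θ) := hs.mul_left _
  refine (tsum_of_norm_bounded hg.hasSum fun n => ?_).trans (le_of_eq ?_)
  · split_ifs with hn
    · rw [norm_zero]; positivity
    · rcases Nat.eq_zero_or_pos n with rfl | hn1
      · rw [h0, norm_zero]; positivity
      · have hYn : Y ≤ n := by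
          by_contra! hlt
          exact hn (mem_Icc.2 ⟨hn1, hlt.le⟩)
        refine (hf n hn1).trans ((hle n hn1).trans_le ?_)
        have : (n : ℝ) ^ (-θ) ≤ (Y : ℝ) ^ (-θ) :=
          Real.rpow_le_rpow_of_nonpos (by exact_mod_cast hY) (by exact_mod_cast hYn) (by linarith)
        calc A * (n : ℝ) ^ (-1 - θ) * (n : ℝ) ^ (-θ) ≤ A * (n : ℝ) ^ (-1 - θ) * (Y : ℝ) ^ (-θ) := by
              gcongr
          _ = _ := by ring
  · rw [tsum_mul_left]; ring

/-- A square root in place of a logarithm is enough, since only some power saving is wanted. The sum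
telescopes against `2(√(n+1) - √n)`. -/
lemma sum_Icc_inv_le (Y : ℕ) : ∑ d ∈ Icc 1 Y, (1 : ℝ) / d ≤ 2 * √Y := by
  induction Y with
  | zero => simp
  | succ n ih =>
    rw [sum_Icc_succ_top (by omega)]
    have h1 : √((n + 1 : ℕ) : ℝ) ^ 2 = n + 1 := by rw [Real.sq_sqrt (by positivity)]; push_cast; ring
    have h2 : √(n : ℝ) ^ 2 = n := Real.sq_sqrt (by positivity)
    set a := √((n + 1 : ℕ) : ℝ)
    set b := √(n : ℝ)
    have ha : 0 < a := Real.sqrt_pos.2 (by positivity)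
    have hb : 0 ≤ b := Real.sqrt_nonneg _
    have hab : b ≤ a := Real.sqrt_le_sqrt (by push_cast; linarith)
    have ha1 : 1 ≤ a := by nlinarith
    have : (1 : ℝ) / ((n + 1 : ℕ) : ℝ) ≤ 2 * (a - b) := by
      push_cast
      rw [← h1, div_le_iff₀ (by positivity)]
      have h3 : (a - b) * (a + b) = 1 := by nlinarith
      have h4 : 0 ≤ a - b := by linarith
      nlinarith [mul_nonneg h4 (mul_nonneg (sub_nonneg.2 ha1) ha.le)]
    linarith

/-- Adding `ζ(2)` makes every term nonnegative and the term `d = 1` equal to `2`, so the sum is at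
least `2 - π²/6 > 0`. No Euler product is needed. -/
lemma tsum_moebius_div_sq_pos : 0 < ∑' d : ℕ, (μ d : ℝ) / (d : ℝ) ^ 2 := by
  have h2 := hasSum_zeta_two
  have hb : ∀ d : ℕ, |(μ d : ℝ)| ≤ 1 := fun d => by exact_mod_cast ArithmeticFunction.abs_moebius_le_one
  have hs : Summable fun d : ℕ => (μ d : ℝ) / (d : ℝ) ^ 2 := by
    refine Summable.of_norm_bounded h2.summable fun d => ?_
    rw [norm_div, Real.norm_eq_abs, Real.norm_eq_abs, abs_of_nonneg (by positivity : (0:ℝ) ≤ (d : ℝ) ^ 2)]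
    gcongr; exact hb d
  have h3 : ∑' d : ℕ, ((μ d : ℝ) / (d : ℝ) ^ 2 + 1 / (d : ℝ) ^ 2) ≥ 2 := by
    have h4 : Summable fun d : ℕ => (μ d : ℝ) / (d : ℝ) ^ 2 + 1 / (d : ℝ) ^ 2 := hs.add h2.summable
    have := h4.sum_le_tsum {1} (fun d _ => by
      rw [← add_div]
      have := (abs_le.1 (hb d)).1
      apply div_nonneg <;> [linarith; positivity])
    refine le_trans ?_ this
    simp; norm_num
  rw [hs.tsum_add h2.summable, h2.tsum_eq] at h3
  have := Real.pi_lt_d2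
  have := Real.pi_gt_three
  nlinarith

/-! ### Lattice points in residue classes -/

namespace IsGauge

variable {G : ℝ × ℝ → ℝ} {C : ℝ}

lemma finite_ball (h : IsGauge G C) (T : ℝ) : {w : ℤ × ℤ | G (toR w) ≤ T}.Finite := by
  simpa using h.finite_shift 0 T

/-- The integer points in the ball of radius `T` of the gauge. -/
noncomputable def pts (h : IsGauge G C) (T : ℝ) : Finset (ℤ × ℤ) := (h.finite_ball T).toFinset

@[simp] lemma mem_pts (h : IsGauge G C) {T : ℝ} {w : ℤ × ℤ} : w ∈ h.pts T ↔ G (toR w) ≤ T := by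
  simp [pts]

/-- The class is `M` times the lattice shifted by `(x, y)/M`, so this is the shifted count at radius
`T/M`. The error, of order `T/M + 1`, is weakened to one independent of `M`. -/
lemma abs_card_residue_sub_le (h : IsGauge G C) {M : ℕ} (hM : 1 ≤ M) (x y : ZMod M) {T : ℝ}
    (hT : 0 ≤ T) :
    |(#{w ∈ h.pts T | (w.1 : ZMod M) = x ∧ (w.2 : ZMod M) = y} : ℝ) - vol G / M ^ 2 * T ^ 2| ≤
      vol G * (2 * C ^ 2) * (T + 1) := by
  obtain ⟨x, rfl⟩ := ZMod.intCast_surjective x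
  obtain ⟨y, rfl⟩ := ZMod.intCast_surjective y
  have hM0 : (0 : ℝ) < M := by exact_mod_cast hM
  have hMz : (M : ℤ) ≠ 0 := by exact_mod_cast (by omega : M ≠ 0)
  have key := h.abs_ncard_shift_sub_le ((M : ℝ)⁻¹ • toR (x, y)) (T := T / M) (by positivity)
  have hcard : {w : ℤ × ℤ | G (toR w + (M : ℝ)⁻¹ • toR (x, y)) ≤ T / M}.ncard =
      #{w ∈ h.pts T | (w.1 : ZMod M) = x ∧ (w.2 : ZMod M) = y} := by
    rw [← Set.ncard_coe_finset]
    refine Set.ncard_congr (fun w _ => (M * w.1 + x, M * w.2 + y)) ?_ ?_ ?_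
    · intro w hw
      have : toR (M * w.1 + x, M * w.2 + y) = (M : ℝ) • (toR w + (M : ℝ)⁻¹ • toR (x, y)) := by
        ext <;> simp [toR, mul_add, hM0.ne']
      simp only [coe_filter, mem_pts, Set.mem_ofPred_eq] at hw ⊢
      rw [this, h.smul _ hM0, mul_comm, ← le_div_iff₀ hM0]
      exact ⟨hw, by simp, by simp⟩
    · intro w w' _ _ he
      obtain ⟨h1, h2⟩ := Prod.ext_iff.1 he
      exact Prod.ext (mul_left_cancel₀ hMz (add_right_cancel h1))
        (mul_left_cancel₀ hMz (add_right_cancel h2))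
    · intro v hv
      simp only [coe_filter, mem_pts, Set.mem_ofPred_eq] at hv
      obtain ⟨hv, h1, h2⟩ := hv
      rw [eq_comm, ZMod.intCast_eq_intCast_iff_dvd_sub] at h1 h2
      obtain ⟨a, ha⟩ := h1
      obtain ⟨b, hb⟩ := h2
      refine ⟨(a, b), ?_, ?_⟩
      · have : toR v = (M : ℝ) • (toR (a, b) + (M : ℝ)⁻¹ • toR (x, y)) := by
          ext
          · simp [toR, mul_add, hM0.ne']; exact_mod_cast (by linarith : v.1 = M * a + x)
          · simp [toR, mul_add, hM0.ne']; exact_mod_cast (by linarith : v.2 = M * b + y)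
        rw [this, h.smul _ hM0, mul_comm, ← le_div_iff₀ hM0] at hv
        exact hv
      · ext <;> simp <;> linarith
  rw [hcard] at key
  have h1 : vol G * (T / M) ^ 2 = vol G / M ^ 2 * T ^ 2 := by ring
  rw [h1] at key
  refine key.trans ?_
  have := h.vol_pos
  have : T / M ≤ T := div_le_self hT (by exact_mod_cast hM)
  gcongr

/-- Division by `d`, a unit modulo `M`, carries these points to the class of `d⁻¹(x, y)` in radius
`T/d`; excluding the origin changes the count by at most one. -/
lemma abs_card_residue_dvd_sub_le (h : IsGauge G C) {M : ℕ} (hM : 1 ≤ M) (x y : ZMod M) {T : ℝ}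
    (hT : 0 ≤ T) {d : ℕ} (hd : 1 ≤ d) (hdM : d.Coprime M) :
    |(#{w ∈ h.pts T | ((w.1 : ZMod M) = x ∧ (w.2 : ZMod M) = y) ∧ w ≠ 0 ∧
        d ∣ Int.gcd w.1 w.2} : ℝ) - vol G / M ^ 2 * T ^ 2 / d ^ 2| ≤
      (vol G * (2 * C ^ 2) + 1) * (T / d + 1) := by
  have hd0 : (0 : ℝ) < d := by exact_mod_cast hd
  have hdz : (d : ℤ) ≠ 0 := by exact_mod_cast (by omega : d ≠ 0)
  let u : (ZMod M)ˣ := ZMod.unitOfCoprime d hdM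
  have hu : (u : ZMod M) = (d : ZMod M) := rfl
  have key := h.abs_card_residue_sub_le hM (↑u⁻¹ * x) (↑u⁻¹ * y) (T := T / d) (by positivity)
  set F := {w ∈ h.pts (T / d) | (w.1 : ZMod M) = ↑u⁻¹ * x ∧ (w.2 : ZMod M) = ↑u⁻¹ * y} with hF
  have hcard : #{w ∈ h.pts T | ((w.1 : ZMod M) = x ∧ (w.2 : ZMod M) = y) ∧ w ≠ 0 ∧
        d ∣ Int.gcd w.1 w.2} = #(F.erase 0) := by
    symm
    refine card_bij (fun w _ => (d * w.1, d * w.2)) ?_ ?_ ?_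
    · intro w hw
      simp only [hF, mem_erase, mem_filter, mem_pts] at hw ⊢
      obtain ⟨h0, h1, h2, h3⟩ := hw
      have : toR (d * w.1, d * w.2) = (d : ℝ) • toR w := by ext <;> simp [toR]
      rw [this, h.smul _ hd0, mul_comm, ← le_div_iff₀ hd0]
      refine ⟨h1, ⟨?_, ?_⟩, ?_, ?_⟩
      · push_cast; rw [h2, ← hu, Units.mul_inv_cancel_left]
      · push_cast; rw [h3, ← hu, Units.mul_inv_cancel_left]
      · intro he
        apply h0
        simp only [Prod.mk_eq_zero, mul_eq_zero, hdz, false_or] at he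
        exact Prod.ext he.1 he.2
      · exact Int.dvd_gcd (dvd_mul_right _ _) (dvd_mul_right _ _)
    · intro w _ w' _ he
      obtain ⟨h1, h2⟩ := Prod.ext_iff.1 he
      exact Prod.ext (mul_left_cancel₀ hdz h1) (mul_left_cancel₀ hdz h2)
    · intro v hv
      simp only [mem_filter, mem_pts] at hv
      obtain ⟨h1, ⟨h2, h3⟩, h4, h5⟩ := hv
      obtain ⟨a, ha⟩ := (Int.natCast_dvd_natCast.2 h5).trans (Int.gcd_dvd_left _ _)
      obtain ⟨b, hb⟩ := (Int.natCast_dvd_natCast.2 h5).trans (Int.gcd_dvd_right _ _)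
      refine ⟨(a, b), ?_, Prod.ext ha.symm hb.symm⟩
      simp only [hF, mem_erase, mem_filter, mem_pts]
      have : toR v = (d : ℝ) • toR (a, b) := by ext <;> simp [toR, ha, hb]
      rw [this, h.smul _ hd0, mul_comm, ← le_div_iff₀ hd0] at h1
      refine ⟨?_, h1, ?_, ?_⟩
      · rintro he
        obtain ⟨rfl, rfl⟩ := Prod.mk_eq_zero.1 he
        exact h4 (Prod.ext (by simp [ha]) (by simp [hb]))
      · rw [← h2, ha, Units.eq_inv_mul_iff_mul_eq, hu]; push_cast; rfl
      · rw [← h3, hb, Units.eq_inv_mul_iff_mul_eq, hu]; push_cast; rfl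
  have hle : |(#(F.erase 0) : ℝ) - #F| ≤ 1 := by
    have h1 := card_le_card (erase_subset 0 F)
    have h2 := pred_card_le_card_erase (s := F) (a := 0)
    rw [abs_le]
    constructor
    · have : #F ≤ #(F.erase 0) + 1 := by omega
      have : (#F : ℝ) ≤ #(F.erase 0) + 1 := by exact_mod_cast this
      linarith
    · have : (#(F.erase 0) : ℝ) ≤ #F := by exact_mod_cast h1
      linarith
  rw [hcard]
  have e : vol G / M ^ 2 * T ^ 2 / d ^ 2 = vol G / M ^ 2 * (T / d) ^ 2 := by ring
  rw [e]
  calc _ = |((#(F.erase 0) : ℝ) - #F) + ((#F : ℝ) - vol G / M ^ 2 * (T / d) ^ 2)| := by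
        congr 1; ring
    _ ≤ 1 + vol G * (2 * C ^ 2) * (T / d + 1) := (abs_add_le _ _).trans (add_le_add hle key)
    _ ≤ _ := by
      have : 0 ≤ T / d := by positivity
      nlinarith

end IsGauge
end EllFamily

/-! ### Primitive lattice points in classes -/

namespace EllFamily
open Finset
open scoped Classical ArithmeticFunction.Moebius

lemma sum_Icc_moebius_dvd {k Y : ℕ} (hk : 1 ≤ k) (hY : k ≤ Y) :
    ∑ d ∈ Icc 1 Y, (if d ∣ k then (μ d : ℝ) else 0) = if k = 1 then 1 else 0 := by
  rw [← sum_filter]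
  have : {d ∈ Icc 1 Y | d ∣ k} = k.divisors := by
    ext d
    simp only [mem_filter, mem_Icc, Nat.mem_divisors]
    constructor
    · exact fun h => ⟨h.2, by omega⟩
    · exact fun h => ⟨⟨Nat.pos_of_dvd_of_pos h.1 hk, (Nat.le_of_dvd hk h.1).trans hY⟩, h.1⟩
  rw [this]
  have h := congrArg (fun f : ArithmeticFunction ℤ => f k) ArithmeticFunction.moebius_mul_coe_zeta
  simp only [ArithmeticFunction.coe_mul_zeta_apply, ArithmeticFunction.one_apply] at h
  exact_mod_cast congrArg (Int.cast (R := ℝ)) h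

namespace IsGauge

variable {G : ℝ × ℝ → ℝ} {C : ℝ}

/-- The density of primitive integer points in a unimodular residue class modulo `M`. -/
noncomputable def residueDensity (G : ℝ × ℝ → ℝ) (M : ℕ) : ℝ :=
  vol G / M ^ 2 * ∑' d : ℕ, if d.Coprime M then (μ d : ℝ) / (d : ℝ) ^ 2 else 0

lemma abs_le_of_mem_pts (h : IsGauge G C) {T : ℝ} {w : ℤ × ℤ} (hw : w ∈ h.pts T) :
    (|w.1| : ℝ) ≤ C * T ∧ (|w.2| : ℝ) ≤ C * T := by
  have := (h.norm_le _).trans (mul_le_mul_of_nonneg_left (h.mem_pts.1 hw) h.pos.le)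
  rwa [Prod.norm_def, max_le_iff, Real.norm_eq_abs, Real.norm_eq_abs] at this

lemma gcd_le_of_mem_pts (h : IsGauge G C) {T : ℝ} {w : ℤ × ℤ} (hw : w ∈ h.pts T) (h0 : w ≠ 0) :
    (Int.gcd w.1 w.2 : ℝ) ≤ C * T := by
  obtain ⟨h1, h2⟩ := h.abs_le_of_mem_pts hw
  by_cases hw1 : w.1 = 0
  · have hw2 : w.2 ≠ 0 := fun hw2 => h0 (Prod.ext hw1 hw2)
    refine le_trans ?_ h2
    have := Int.le_of_dvd (abs_pos.2 hw2) ((dvd_abs _ _).2 (Int.gcd_dvd_right w.1 w.2))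
    exact_mod_cast this
  · refine le_trans ?_ h1
    have := Int.le_of_dvd (abs_pos.2 hw1) ((dvd_abs _ _).2 (Int.gcd_dvd_left w.1 w.2))
    exact_mod_cast this

/-- Möbius detection of `gcd = 1`. The sum may stop at `Y` because coercivity bounds the gcd of a
nonzero point of the ball by `C * T`. -/
lemma card_primitive_eq (h : IsGauge G C) (P : ℤ × ℤ → Prop) [DecidablePred P] {T : ℝ} {Y : ℕ} (hY : C * T ≤ Y) :
    (#{w ∈ h.pts T | P w ∧ Int.gcd w.1 w.2 = 1} : ℝ) =
      ∑ d ∈ Icc 1 Y, (μ d : ℝ) * #{w ∈ h.pts T | P w ∧ w ≠ 0 ∧ d ∣ Int.gcd w.1 w.2} := by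
  have e1 : {w ∈ h.pts T | P w ∧ Int.gcd w.1 w.2 = 1} =
      {w ∈ {w ∈ h.pts T | P w ∧ w ≠ 0} | Int.gcd w.1 w.2 = 1} := by
    ext w
    simp only [mem_filter]
    constructor
    · rintro ⟨h1, h2, h3⟩
      exact ⟨⟨h1, h2, by rintro rfl; simp at h3⟩, h3⟩
    · rintro ⟨⟨h1, h2, _⟩, h3⟩
      exact ⟨h1, h2, h3⟩
  rw [e1, card_filter, Nat.cast_sum]
  have e2 : ∀ w ∈ {w ∈ h.pts T | P w ∧ w ≠ 0}, ((if Int.gcd w.1 w.2 = 1 then 1 else 0 : ℕ) : ℝ) =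
      ∑ d ∈ Icc 1 Y, (if d ∣ Int.gcd w.1 w.2 then (μ d : ℝ) else 0) := by
    intro w hw
    obtain ⟨hw1, _, hw2⟩ := mem_filter.1 hw
    rw [sum_Icc_moebius_dvd]
    · push_cast; rfl
    · refine Nat.pos_of_ne_zero fun h0 => hw2 ?_
      rw [Int.gcd_eq_zero_iff] at h0
      exact Prod.ext h0.1 h0.2
    · exact_mod_cast (h.gcd_le_of_mem_pts hw1 hw2).trans hY
  rw [sum_congr rfl e2, sum_comm]
  refine sum_congr rfl fun d _ => ?_
  rw [← sum_filter, sum_const, nsmul_eq_mul, mul_comm, filter_filter]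
  simp only [and_assoc]

/-- Only `d` prime to `M` contribute, because a `d` dividing both coordinates of a point in a
unimodular class is prime to `M`. For these the errors `T/d + 1` sum to `O(T√T)`, and completing the
truncated series costs `T² Y^(-1/2)`, of the same order. -/
theorem exists_abs_card_primitive_residue_sub_le (h : IsGauge G C) :
    ∃ K : ℝ, 0 ≤ K ∧ ∀ M : ℕ, 1 ≤ M → ∀ x y : ZMod M, IsCoprime x y → ∀ T : ℝ, 1 ≤ T →
      |(#{w ∈ h.pts T | ((w.1 : ZMod M) = x ∧ (w.2 : ZMod M) = y) ∧ Int.gcd w.1 w.2 = 1} : ℝ) -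
        residueDensity G M * T ^ 2| ≤ K * (T * √T) := by
  set A := ∑' n : ℕ, (n : ℝ) ^ (-1 - (1 / 2 : ℝ)) with hA
  have hA0 : 0 ≤ A := tsum_nonneg fun n => by positivity
  set B := vol G * (2 * C ^ 2) + 1 with hB
  have hV := h.vol_pos
  have hC := h.one_le
  have hC0 := h.pos
  have hB0 : 0 ≤ B := by positivity
  refine ⟨vol G * A + B * (1 + 2 * C) * (2 * √(2 * C)), by positivity, ?_⟩
  intro M hM x y hxy T hT
  have hM1 : (1 : ℝ) ≤ M := by exact_mod_cast hM
  have hT0 : 0 < T := by linarith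
  set Y := ⌈C * T⌉₊ with hYdef
  have hCT : 1 ≤ C * T := by nlinarith
  have hY : C * T ≤ Y := Nat.le_ceil _
  have hY2 : (Y : ℝ) ≤ 2 * C * T := by
    have := Nat.ceil_lt_add_one (by linarith : 0 ≤ C * T)
    linarith
  have hY1 : 1 ≤ Y := by
    have : (1 : ℝ) ≤ Y := hCT.trans hY
    exact_mod_cast this
  have hTY : T ≤ Y := by nlinarith
  set c : ℕ → ℝ := fun d => if d.Coprime M then (μ d : ℝ) / (d : ℝ) ^ 2 else 0 with hc
  have hμ : ∀ d : ℕ, |(μ d : ℝ)| ≤ 1 := fun d => by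
    exact_mod_cast ArithmeticFunction.abs_moebius_le_one
  have htail := (abs_tsum_sub_sum_Icc_le (f := c) (A := 1) (θ := 1 / 2) (by norm_num) (by simp [hc])
    (fun n hn => by
      have hn0 : (0 : ℝ) < n := by exact_mod_cast hn
      have e : (n : ℝ) ^ (-1 - 2 * (1 / 2) : ℝ) = 1 / (n : ℝ) ^ 2 := by
        rw [show (-1 - 2 * (1 / 2) : ℝ) = -((2 : ℕ) : ℝ) by norm_num, Real.rpow_neg hn0.le,
          Real.rpow_natCast, one_div]
      rw [e, one_mul]
      simp only [hc]
      split_ifs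
      · rw [abs_div, abs_of_nonneg (by positivity : (0 : ℝ) ≤ (n : ℝ) ^ 2)]
        gcongr; exact hμ n
      · rw [abs_zero]; positivity) hY1).2
  rw [one_mul, ← hA] at htail
  rw [h.card_primitive_eq (fun w => (w.1 : ZMod M) = x ∧ (w.2 : ZMod M) = y) hY]
  have hterm : ∀ d ∈ Icc 1 Y, |(μ d : ℝ) * #{w ∈ h.pts T | ((w.1 : ZMod M) = x ∧ (w.2 : ZMod M) = y) ∧
      w ≠ 0 ∧ d ∣ Int.gcd w.1 w.2} - vol G / M ^ 2 * T ^ 2 * c d| ≤ B * (1 + 2 * C) * T * (1 / d) := by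
    intro d hd
    obtain ⟨hd1, hdY⟩ := mem_Icc.1 hd
    have hd0 : (0 : ℝ) < d := by exact_mod_cast hd1
    by_cases hdM : d.Coprime M
    · have key := h.abs_card_residue_dvd_sub_le hM x y hT0.le hd1 hdM
      simp only [hc, if_pos hdM]
      calc _ = |(μ d : ℝ)| * |(#{w ∈ h.pts T | ((w.1 : ZMod M) = x ∧ (w.2 : ZMod M) = y) ∧
            w ≠ 0 ∧ d ∣ Int.gcd w.1 w.2} : ℝ) - vol G / M ^ 2 * T ^ 2 / d ^ 2| := by
            rw [← abs_mul]; congr 1; ring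
        _ ≤ 1 * (B * (T / d + 1)) := by
            apply mul_le_mul (hμ d) key (abs_nonneg _) zero_le_one
        _ ≤ _ := by
            -- Since `d ≤ Y ≤ 2CT`, the constant error is absorbed into `T/d`.
            have : 1 ≤ 2 * C * (T / d) := by
              rw [← mul_div_assoc, le_div_iff₀ hd0, one_mul]
              exact le_trans (by exact_mod_cast hdY) hY2
            have h2 : T / d + 1 ≤ (1 + 2 * C) * (T / d) := by linarith
            calc 1 * (B * (T / d + 1)) ≤ 1 * (B * ((1 + 2 * C) * (T / d))) := by gcongr
              _ = _ := by ring
    · have : {w ∈ h.pts T | ((w.1 : ZMod M) = x ∧ (w.2 : ZMod M) = y) ∧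
          w ≠ 0 ∧ d ∣ Int.gcd w.1 w.2} = ∅ := by
        refine filter_eq_empty_iff.2 fun w _ => ?_
        rintro ⟨⟨rfl, rfl⟩, _, hdw⟩
        rw [isCoprime_zmod_iff, Nat.isCoprime_iff_coprime] at hxy
        exact hdM (Nat.Coprime.coprime_dvd_left hdw hxy)
      rw [this]
      simp only [hc, if_neg hdM]
      simp
      positivity
  have hsum : |∑ d ∈ Icc 1 Y, (μ d : ℝ) * #{w ∈ h.pts T | ((w.1 : ZMod M) = x ∧ (w.2 : ZMod M) = y) ∧
      w ≠ 0 ∧ d ∣ Int.gcd w.1 w.2} - vol G / M ^ 2 * T ^ 2 * ∑ d ∈ Icc 1 Y, c d| ≤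
      B * (1 + 2 * C) * T * (2 * √Y) := by
    rw [mul_sum, ← sum_sub_distrib]
    refine (abs_sum_le_sum_abs _ _).trans ((sum_le_sum hterm).trans ?_)
    rw [← mul_sum]
    have := sum_Icc_inv_le Y
    gcongr
  have hsq : √(Y : ℝ) ≤ √(2 * C) * √T := by
    rw [← Real.sqrt_mul (by positivity)]
    exact Real.sqrt_le_sqrt hY2
  have hYr : (Y : ℝ) ^ (-(1 / 2) : ℝ) ≤ 1 / √T := by
    rw [Real.rpow_neg (by positivity), ← Real.sqrt_eq_rpow, one_div]
    have := Real.sqrt_pos.2 hT0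
    gcongr
  have hTs : T ^ 2 * (1 / √T) = T * √T := by
    have := Real.sqrt_pos.2 hT0
    rw [mul_one_div, div_eq_iff this.ne', mul_assoc, Real.mul_self_sqrt hT0.le, sq]
  have h2 : |vol G / M ^ 2 * T ^ 2 * ∑ d ∈ Icc 1 Y, c d - residueDensity G M * T ^ 2| ≤
      vol G * A * (T * √T) := by
    rw [residueDensity, abs_sub_comm]
    calc _ = vol G / M ^ 2 * T ^ 2 * |∑' d, c d - ∑ d ∈ Icc 1 Y, c d| := by
          rw [← abs_of_nonneg (by positivity : 0 ≤ vol G / M ^ 2 * T ^ 2), ← abs_mul,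
            abs_of_nonneg (by positivity : 0 ≤ vol G / M ^ 2 * T ^ 2)]
          congr 1; ring
      _ ≤ vol G / 1 ^ 2 * T ^ 2 * (A * (1 / √T)) := by
          have := htail.trans (mul_le_mul_of_nonneg_left hYr hA0)
          gcongr
      _ = vol G * A * (T ^ 2 * (1 / √T)) := by ring
      _ = _ := by rw [hTs]
  calc _ ≤ _ + _ := abs_sub_le _ (vol G / M ^ 2 * T ^ 2 * ∑ d ∈ Icc 1 Y, c d) _
    _ ≤ B * (1 + 2 * C) * T * (2 * (√(2 * C) * √T)) + vol G * A * (T * √T) := by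
        refine add_le_add (hsum.trans ?_) h2
        gcongr
    _ = _ := by ring

/-- The density of all primitive integer points. -/
noncomputable def density (G : ℝ × ℝ → ℝ) : ℝ := residueDensity G 1

lemma density_pos (h : IsGauge G C) : 0 < density G := by
  have := tsum_moebius_div_sq_pos
  have hV := h.vol_pos
  simp only [density, residueDensity, Nat.coprime_one_right_eq_true, if_true]
  positivity

end IsGauge

/-- The units act freely on unimodular pairs, since a Bezout relation recovers the multiplier, and
the fibres are the orbits. -/
lemma P1.card_fiber {M : ℕ} (α : P1 M) :
    Nat.card {u : {v : ZMod M × ZMod M // IsCoprime v.1 v.2} //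
      (Quotient.mk (p1Setoid M) u : P1 M) = α} = Nat.card (ZMod M)ˣ := by
  induction α using Quotient.inductionOn with
  | h v =>
    symm
    have hc : ∀ c : (ZMod M)ˣ, IsCoprime (c * v.1.1) (c * v.1.2) := fun c => by
      obtain ⟨s, t, hst⟩ := v.2
      exact ⟨s * ↑c⁻¹, t * ↑c⁻¹, by
        linear_combination hst + (s * v.1.1 + t * v.1.2) * c.inv_mul⟩
    refine Nat.card_congr (Equiv.ofBijective (fun c => ⟨⟨(c * v.1.1, c * v.1.2), hc c⟩,
      (Quotient.sound ⟨c, rfl⟩ : Quotient.mk (p1Setoid M) v = _).symm⟩) ⟨?_, ?_⟩)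
    · intro c c' he
      simp only [Subtype.mk.injEq, Prod.mk.injEq] at he
      obtain ⟨s, t, hst⟩ := v.2
      refine Units.ext ?_
      linear_combination s * he.1 + t * he.2 - (c - c' : ZMod M) * hst
    · rintro ⟨u, hu⟩
      obtain ⟨c, hc⟩ := Quotient.exact hu.symm
      exact ⟨c, Subtype.ext (Subtype.ext hc.symm)⟩

namespace IsGauge

variable {G : ℝ × ℝ → ℝ} {C : ℝ}

lemma card_primitive_class_eq (h : IsGauge G C) {M : ℕ} [NeZero M] (α : P1 M) (T : ℝ) :
    #{w ∈ h.pts T | α.Rep w.1 w.2 ∧ Int.gcd w.1 w.2 = 1} =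
      ∑ u : {u : {v : ZMod M × ZMod M // IsCoprime v.1 v.2} //
        (Quotient.mk (p1Setoid M) u : P1 M) = α},
        #{w ∈ h.pts T | ((w.1 : ZMod M) = u.1.1.1 ∧ (w.2 : ZMod M) = u.1.1.2) ∧
          Int.gcd w.1 w.2 = 1} := by
  rw [← card_biUnion]
  · congr 1
    ext w
    simp only [mem_filter, mem_biUnion, mem_univ, true_and, Subtype.exists]
    constructor
    · rintro ⟨h1, ⟨hc, h2⟩, h3⟩
      exact ⟨_, hc, h2, h1, ⟨rfl, rfl⟩, h3⟩
    · rintro ⟨⟨x, y⟩, hc, h2, h1, ⟨rfl, rfl⟩, h3⟩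
      exact ⟨h1, ⟨hc, h2⟩, h3⟩
  · intro u _ u' _ hne
    refine disjoint_left.2 fun w hw hw' => hne ?_
    obtain ⟨_, ⟨h1, h2⟩, _⟩ := mem_filter.1 hw
    obtain ⟨_, ⟨h1', h2'⟩, _⟩ := mem_filter.1 hw'
    exact Subtype.ext (Subtype.ext (Prod.ext (h1.symm.trans h1') (h2.symm.trans h2')))

/-- A class is a union of residue pairs, one for each unit modulo `M`, all with the same density.
That density is identified without evaluating its series: the classes partition the primitive
points, so their equal densities must add up to `density G`. -/
theorem exists_abs_card_primitive_class_sub_le (h : IsGauge G C) :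
    ∃ K : ℝ, 0 ≤ K ∧ ∀ M : ℕ, 1 ≤ M → ∀ α : P1 M, ∀ T : ℝ, 1 ≤ T →
      |(#{w ∈ h.pts T | α.Rep w.1 w.2 ∧ Int.gcd w.1 w.2 = 1} : ℝ) -
        density G / Nat.card (P1 M) * T ^ 2| ≤ K * M * (T * √T) := by
  obtain ⟨K, hK, key⟩ := h.exists_abs_card_primitive_residue_sub_le
  refine ⟨K, hK, fun M hM => ?_⟩
  have : NeZero M := ⟨by omega⟩
  have : Fintype (P1 M) := Fintype.ofFinite _
  set φ := Nat.card (ZMod M)ˣ with hφ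
  have hφM : (φ : ℝ) ≤ M := by
    have := Nat.card_le_card_of_injective (Units.val : (ZMod M)ˣ → ZMod M) Units.val_injective
    rw [Nat.card_zmod] at this
    exact_mod_cast this
  have hM1 : (1 : ℝ) ≤ M := by exact_mod_cast hM
  have step : ∀ α : P1 M, ∀ T : ℝ, 1 ≤ T →
      |(#{w ∈ h.pts T | α.Rep w.1 w.2 ∧ Int.gcd w.1 w.2 = 1} : ℝ) -
        φ * residueDensity G M * T ^ 2| ≤ K * M * (T * √T) := by
    intro α T hT
    have hc : (φ : ℝ) = ∑ u : {u : {v : ZMod M × ZMod M // IsCoprime v.1 v.2} //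
        (Quotient.mk (p1Setoid M) u : P1 M) = α}, (1 : ℝ) := by
      rw [sum_const, card_univ, ← Nat.card_eq_fintype_card, P1.card_fiber]; simp [hφ]
    rw [h.card_primitive_class_eq α T, Nat.cast_sum, hc, sum_mul, sum_mul, ← sum_sub_distrib]
    refine (abs_sum_le_sum_abs _ _).trans ?_
    calc _ ≤ ∑ u : {u : {v : ZMod M × ZMod M // IsCoprime v.1 v.2} //
        (Quotient.mk (p1Setoid M) u : P1 M) = α}, (1 : ℝ) * (K * (T * √T)) := by
          refine sum_le_sum fun u _ => ?_
          rw [one_mul, one_mul]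
          exact key M hM _ _ u.1.2 T hT
      _ = φ * (K * (T * √T)) := by rw [← sum_mul, ← hc]
      _ ≤ M * (K * (T * √T)) := by
          have : 0 ≤ T * √T := mul_nonneg (by linarith) (Real.sqrt_nonneg _)
          gcongr
      _ = _ := by ring
  have htot : ∀ T : ℝ, (#{w ∈ h.pts T | (((w.1 : ZMod 1) = 0 ∧ (w.2 : ZMod 1) = 0) ∧
      Int.gcd w.1 w.2 = 1)} : ℝ) =
      ∑ α : P1 M, (#{w ∈ h.pts T | α.Rep w.1 w.2 ∧ Int.gcd w.1 w.2 = 1} : ℝ) := by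
    intro T
    rw [← Nat.cast_sum, ← card_biUnion]
    · congr 2
      ext w
      simp only [mem_filter, mem_biUnion, mem_univ, true_and]
      constructor
      · rintro ⟨h1, _, h3⟩
        obtain ⟨α, hα⟩ := P1.exists_of_isCoprime (isCoprime_zmod_of_gcd_eq_one M h3)
        exact ⟨α, h1, hα, h3⟩
      · rintro ⟨α, h1, _, h3⟩
        exact ⟨h1, ⟨Subsingleton.elim _ _, Subsingleton.elim _ _⟩, h3⟩
    · intro α _ β _ hne
      refine disjoint_left.2 fun w hw hw' => hne ?_
      exact (mem_filter.1 hw).2.1.eq (mem_filter.1 hw').2.1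
  -- Both sides are coefficients of `T²` in asymptotics of the same count with error `O(T√T)` for
  -- fixed `M`; a discrepancy would contradict this for large `T`.
  have hdens : (Nat.card (P1 M) : ℝ) * (φ * residueDensity G M) = density G := by
    by_contra hne
    set D := |(Nat.card (P1 M) : ℝ) * (φ * residueDensity G M) - density G| with hD
    have hD0 : 0 < D := abs_pos.2 (sub_ne_zero.2 hne)
    set L := Nat.card (P1 M) * (K * M) + K with hL
    have hL0 : 0 ≤ L := by positivity
    have hb : ∀ T : ℝ, 1 ≤ T → D * √T ≤ L := by
      intro T hT
      have hT0 : 0 < T := by linarith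
      have h1 := key 1 le_rfl 0 0 ⟨0, 0, Subsingleton.elim _ _⟩ T hT
      rw [htot T] at h1
      have h2 : |∑ α : P1 M, (#{w ∈ h.pts T | α.Rep w.1 w.2 ∧ Int.gcd w.1 w.2 = 1} : ℝ) -
          Nat.card (P1 M) * (φ * residueDensity G M) * T ^ 2| ≤
          Nat.card (P1 M) * (K * M * (T * √T)) := by
        have e : (Nat.card (P1 M) : ℝ) * (φ * residueDensity G M) * T ^ 2 =
            ∑ α : P1 M, φ * residueDensity G M * T ^ 2 := by
          rw [sum_const, card_univ, nsmul_eq_mul, Nat.card_eq_fintype_card]; ring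
        rw [e, ← sum_sub_distrib]
        refine (abs_sum_le_sum_abs _ _).trans ((sum_le_sum fun α _ => step α T hT).trans ?_)
        rw [sum_const, card_univ, nsmul_eq_mul, Nat.card_eq_fintype_card]
      have h3 : D * T ^ 2 ≤ L * (T * √T) := by
        rw [hD, ← abs_of_nonneg (sq_nonneg T), ← abs_mul]
        rw [abs_sub_comm] at h2
        refine le_trans ?_ ((add_le_add h2 h1).trans (le_of_eq ?_))
        · refine le_trans (le_of_eq ?_) (abs_sub_le _ _ _)
          congr 1; rw [density]; ring
        · rw [hL]; ring
      have hs := Real.sqrt_pos.2 hT0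
      have h4 : T ^ 2 = (T * √T) * √T := by rw [mul_assoc, Real.mul_self_sqrt hT0.le, sq]
      rw [h4] at h3
      have h5 : 0 < T * √T := by positivity
      nlinarith
    obtain ⟨T, hT⟩ := exists_nat_gt (L / D)
    have h6 := hb ((T + 1 : ℝ) ^ 2) (by nlinarith [(Nat.cast_nonneg T : (0 : ℝ) ≤ T)])
    rw [Real.sqrt_sq (by positivity)] at h6
    rw [div_lt_iff₀ hD0] at hT
    nlinarith
  intro α T hT
  have hc0 : (Nat.card (P1 M) : ℝ) ≠ 0 := by exact_mod_cast (P1.card_pos M).ne'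
  have : density G / Nat.card (P1 M) = φ * residueDensity G M := by
    rw [← hdens]; field_simp
  rw [this]
  exact step α T hT

end IsGauge
end EllFamily

namespace EllFamily
open Finset
open scoped Classical

/-! ### Primitive vectors with divisible determinants -/

lemma eq_of_proportional {a b a' b' : ℤ} (h : Int.gcd a b = 1) (h' : Int.gcd a' b' = 1)
    (hs : 0 < a ↔ 0 < a') (ha : a ≠ 0) (ha' : a' ≠ 0) (hd : a * b' = b * a') :
    a = a' ∧ b = b' := by
  have h1 : a ∣ a' := (Int.isCoprime_iff_gcd_eq_one.2 h).dvd_of_dvd_mul_left ⟨b', hd.symm⟩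
  have h2 : a' ∣ a := (Int.isCoprime_iff_gcd_eq_one.2 h').dvd_of_dvd_mul_right
    ⟨b, by rw [hd, mul_comm]⟩
  have h3 : a = a' := by
    rcases lt_or_gt_of_ne ha with hn | hp
    · have h4 : a' < 0 := by
        rcases lt_or_gt_of_ne ha' with h5 | h5
        · exact h5
        · exact absurd (hs.2 h5) (not_lt.2 hn.le)
      have := Int.dvd_antisymm (a := -a) (b := -a') (by omega) (by omega) (by simpa) (by simpa)
      omega
    · exact Int.dvd_antisymm hp.le (hs.1 hp).le h1 h2
  refine ⟨h3, ?_⟩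
  subst h3
  exact (mul_left_cancel₀ ha (hd.trans (mul_comm _ _))).symm

/-- The slopes differ by the determinant over `a a'`. If the determinant is nonzero it is at least
`E` in absolute value, so the slopes are at least `E / L²` apart and cannot share a cell of that
length. Hence the vectors are proportional, and being primitive with the same sign they agree. -/
lemma eq_of_floor_slope_eq {a b a' b' : ℤ} (h : Int.gcd a b = 1) (h' : Int.gcd a' b' = 1)
    (hs : 0 < a ↔ 0 < a') (ha : a ≠ 0) (ha' : a' ≠ 0) {E : ℕ} (hE : 1 ≤ E)
    (hdvd : (E : ℤ) ∣ a * b' - b * a') {L : ℝ} (hL : (|a| : ℝ) ≤ L) (hL' : (|a'| : ℝ) ≤ L)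
    (hfl : ⌊(b : ℝ) / a * (L ^ 2 / E)⌋ = ⌊(b' : ℝ) / a' * (L ^ 2 / E)⌋) :
    a = a' ∧ b = b' := by
  refine eq_of_proportional h h' hs ha ha' ?_
  by_contra hne
  have hE0 : (0 : ℝ) < E := by exact_mod_cast hE
  have haR : (a : ℝ) ≠ 0 := by exact_mod_cast ha
  have haR' : (a' : ℝ) ≠ 0 := by exact_mod_cast ha'
  have h1 := Int.abs_sub_lt_one_of_floor_eq_floor hfl
  have h2 : (b : ℝ) / a * (L ^ 2 / E) - (b' : ℝ) / a' * (L ^ 2 / E) =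
      (b * a' - a * b') * L ^ 2 / (a * a' * E) := by field_simp
  have h3 : (E : ℤ) ≤ |a * b' - b * a'| :=
    Int.le_of_dvd (abs_pos.2 (sub_ne_zero.2 hne)) ((dvd_abs _ _).2 hdvd)
  have h4 : (E : ℝ) ≤ |(b : ℝ) * a' - a * b'| := by
    rw [abs_sub_comm]; exact_mod_cast h3
  have hp : 0 < |(a : ℝ)| := abs_pos.2 haR
  have hp' : 0 < |(a' : ℝ)| := abs_pos.2 haR'
  rw [h2, abs_div, abs_mul, abs_mul, abs_mul, abs_of_pos hE0, abs_of_nonneg (sq_nonneg L),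
    div_lt_one (by positivity)] at h1
  have h5 : |(a : ℝ)| * |(a' : ℝ)| ≤ L ^ 2 := by
    rw [sq]; exact mul_le_mul hL hL' hp'.le (hp.le.trans hL)
  nlinarith [mul_le_mul h4 h5 (by positivity) (abs_nonneg _)]

/-- Pigeonhole on slopes. A vector is sorted by which coordinate dominates, by the sign of that
coordinate, and by the cell of length `E / L²` holding its slope in `[-1, 1]`. No two vectors share
a box, and there are `4(2⌈L²/E⌉ + 1)` boxes. -/
theorem card_le_of_dvd_det {S : Finset (ℤ × ℤ)} {E : ℕ} (hE : 1 ≤ E) {L : ℝ}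
    (hprim : ∀ w ∈ S, Int.gcd w.1 w.2 = 1) (hL : ∀ w ∈ S, (|w.1| : ℝ) ≤ L ∧ (|w.2| : ℝ) ≤ L)
    (hdet : ∀ w ∈ S, ∀ w' ∈ S, (E : ℤ) ∣ w.1 * w'.2 - w.2 * w'.1) :
    (#S : ℝ) ≤ 12 * (L ^ 2 / E + 1) := by
  have hE0 : (0 : ℝ) < E := by exact_mod_cast hE
  set x := L ^ 2 / E with hx
  have hx0 : 0 ≤ x := by positivity
  set K : ℤ := ⌈x⌉ with hK
  let key : ℤ × ℤ → (Prop × Prop) × ℤ := fun w =>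
    if |w.2| ≤ |w.1| then ((True, 0 < w.1), ⌊(w.2 : ℝ) / w.1 * x⌋)
    else ((False, 0 < w.2), ⌊(w.1 : ℝ) / w.2 * x⌋)
  have hne : ∀ w ∈ S, |w.2| ≤ |w.1| → w.1 ≠ 0 := by
    intro w hw hle h0
    have := hprim w hw
    rw [h0, abs_zero, abs_nonpos_iff] at hle
    rw [h0, hle] at this
    simp at this
  have hinj : Set.InjOn key S := by
    intro w hw w' hw' he
    have hw := mem_coe.1 hw
    have hw' := mem_coe.1 hw'
    have hd := hdet w hw w' hw'
    have hp := hprim w hw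
    have hp' := hprim w' hw'
    simp only [key] at he
    split_ifs at he with h1 h2 h2
    · simp only [Prod.mk.injEq, true_and, eq_iff_iff] at he
      obtain ⟨e1, e2⟩ := eq_of_floor_slope_eq hp hp' he.1 (hne w hw h1) (hne w' hw' h2) hE hd
        (hL w hw).1 (hL w' hw').1 he.2
      exact Prod.ext e1 e2
    · simp at he
    · simp at he
    · simp only [Prod.mk.injEq, true_and, eq_iff_iff] at he
      have hz : ∀ v : ℤ × ℤ, ¬ |v.2| ≤ |v.1| → v.2 ≠ 0 := by
        intro v hv h0; rw [h0] at hv; simp at hv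
      obtain ⟨e1, e2⟩ := eq_of_floor_slope_eq (by rwa [Int.gcd_comm]) (by rwa [Int.gcd_comm]) he.1
        (hz w h1) (hz w' h2) hE (by have := dvd_neg.2 hd; rwa [neg_sub] at this)
        (hL w hw).2 (hL w' hw').2 he.2
      exact Prod.ext e2 e1
  have hsl : ∀ a b : ℤ, |b| ≤ |a| → ⌊(b : ℝ) / a * x⌋ ∈ Icc (-K) K := by
    intro a b hab
    have h1 : |(b : ℝ) / a| ≤ 1 := by
      rw [abs_div]
      exact div_le_one_of_le₀ (by exact_mod_cast hab) (abs_nonneg _)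
    obtain ⟨h2, h3⟩ := abs_le.1 h1
    have hKx : x ≤ K := Int.le_ceil x
    rw [mem_Icc]
    constructor
    · rw [Int.le_floor]; push_cast; nlinarith
    · have := Int.floor_le ((b : ℝ) / a * x)
      have h4 : (⌊(b : ℝ) / a * x⌋ : ℝ) ≤ K := by nlinarith
      exact_mod_cast h4
  have himg : S.image key ⊆ (univ : Finset (Prop × Prop)) ×ˢ Icc (-K) K := by
    intro z hz
    obtain ⟨w, _, rfl⟩ := mem_image.1 hz
    refine mem_product.2 ⟨mem_univ _, ?_⟩
    simp only [key]
    split_ifs with h1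
    · exact hsl _ _ h1
    · exact hsl _ _ (not_le.1 h1).le
  have hcard := card_le_card himg
  rw [card_image_of_injOn hinj, card_product, Int.card_Icc] at hcard
  have h4 : #(univ : Finset (Prop × Prop)) = 4 := by simp
  rw [h4] at hcard
  have hK0 : 0 ≤ K := Int.ceil_nonneg hx0
  have h5 : (#S : ℤ) ≤ 4 * (2 * K + 1) := by
    have : ((K + 1 - -K).toNat : ℤ) = 2 * K + 1 := by omega
    have h6 : (#S : ℤ) ≤ 4 * ((K + 1 - -K).toNat : ℤ) := by exact_mod_cast hcard
    rw [this] at h6; exact h6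
  have h6 : (#S : ℝ) ≤ 4 * (2 * K + 1) := by exact_mod_cast h5
  have h7 : (K : ℝ) < x + 1 := Int.ceil_lt_add_one x
  linarith

/-! ### Roots of a squarefree polynomial modulo prime powers -/

/-- Squarefree means separable over `ℚ`; clearing denominators leaves `Δ`, which plays the part of a
discriminant: it bounds how far a root modulo a prime power can fail to be simple. -/
lemma exists_bezout_derivative {P : ℤ[X]} (hP : Squarefree (P.map (Int.castRingHom ℚ))) :
    ∃ (U V : ℤ[X]) (Δ : ℤ), Δ ≠ 0 ∧ U * P + V * derivative P = C Δ := by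
  have hinj : Function.Injective (Int.castRingHom ℚ) := Int.cast_injective
  obtain ⟨u, v, huv⟩ := (PerfectField.separable_iff_squarefree.2 hP : Separable _)
  obtain ⟨b, hb0, hb⟩ := IsLocalization.integerNormalization_spec (nonZeroDivisors ℤ) u
  obtain ⟨c, hc0, hc⟩ := IsLocalization.integerNormalization_spec (nonZeroDivisors ℤ) v
  refine ⟨C c * IsLocalization.integerNormalization (nonZeroDivisors ℤ) u,
    C b * IsLocalization.integerNormalization (nonZeroDivisors ℤ) v, b * c,
    mul_ne_zero (nonZeroDivisors.ne_zero hb0) (nonZeroDivisors.ne_zero hc0), ?_⟩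
  apply Polynomial.map_injective _ hinj
  have e : algebraMap ℤ ℚ = Int.castRingHom ℚ := rfl
  rw [e] at hb hc
  simp only [Polynomial.map_add, Polynomial.map_mul, hb, hc, Polynomial.map_C, derivative_map] at huv ⊢
  rw [← derivative_map, zsmul_eq_mul, zsmul_eq_mul]
  have : (C ((Int.castRingHom ℚ) (b * c)) : ℚ[X]) = (b : ℚ[X]) * (c : ℚ[X]) := by simp
  rw [this]
  simp only [eq_intCast, map_intCast]
  rw [← derivative_map] at huv
  linear_combination (b * c : ℚ[X]) * huv

lemma exists_pow_dvd_of_pow_dvd_mul {p : ℕ} (hp : p.Prime) {k : ℕ} {a b : ℤ}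
    (h : (p : ℤ) ^ k ∣ a * b) : ∃ i j, i + j = k ∧ (p : ℤ) ^ i ∣ a ∧ (p : ℤ) ^ j ∣ b := by
  have hpz := Nat.prime_iff_prime_int.1 hp
  obtain ⟨d₁, d₂, h1, h2, he⟩ := exists_dvd_and_dvd_of_dvd_mul h
  obtain ⟨i, hi, hi'⟩ := (dvd_prime_pow hpz _).1 (Dvd.intro _ he.symm)
  obtain ⟨j, hj, hj'⟩ := (dvd_prime_pow hpz _).1 (Dvd.intro_left _ he.symm)
  refine ⟨i, j, ?_, hi'.symm.dvd.trans h1, hj'.symm.dvd.trans h2⟩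
  have := (hi'.mul_mul hj')
  rw [← he, ← pow_add] at this
  have h3 := Int.associated_iff_natAbs.1 this
  simp only [Int.natAbs_pow, Int.natAbs_natCast] at h3
  exact (Nat.pow_right_injective hp.two_le h3).symm

/-- Roots modulo `p ^ k` that agree modulo `p ^ (δ + 1)` agree modulo `p ^ (k - δ)`. -/
lemma pow_dvd_sub_of_roots {P U V : ℤ[X]} {Δ : ℤ} (hΔ : U * P + V * derivative P = C Δ)
    {p : ℕ} (hp : p.Prime) {δ k : ℕ} (hδ : ¬ (p : ℤ) ^ (δ + 1) ∣ Δ) (hk : δ < k) {x y : ℤ}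
    (hx : (p : ℤ) ^ k ∣ P.eval x) (hy : (p : ℤ) ^ k ∣ P.eval y)
    (hxy : (p : ℤ) ^ (δ + 1) ∣ y - x) : (p : ℤ) ^ (k - δ) ∣ y - x := by
  obtain ⟨c, hc⟩ := P.binomExpansion x (y - x)
  rw [add_sub_cancel] at hc
  have h1 : P.eval y - P.eval x = (y - x) * ((derivative P).eval x + c * (y - x)) := by
    rw [hc]; ring
  obtain ⟨i, j, hij, hi, hj⟩ := exists_pow_dvd_of_pow_dvd_mul hp (h1 ▸ dvd_sub hy hx)
  -- If the second factor took `δ + 1` factors of `p`, then so would the derivative at `x`, and the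
  -- Bezout identity would put `p ^ (δ + 1)` into `Δ`.
  by_cases hjδ : δ + 1 ≤ j
  · exfalso
    apply hδ
    have h2 : (p : ℤ) ^ (δ + 1) ∣ (derivative P).eval x := by
      have := (pow_dvd_pow (p : ℤ) hjδ).trans hj
      exact (dvd_add_left (hxy.mul_left c)).1 this
    have h3 := congrArg (Polynomial.eval x) hΔ
    rw [eval_add, eval_mul, eval_mul, eval_C] at h3
    rw [← h3]
    exact dvd_add (((pow_dvd_pow (p : ℤ) hk).trans hx).mul_left _) (h2.mul_left _)
  · exact (pow_dvd_pow (p : ℤ) (by omega)).trans hi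

/-- The roots of `P` modulo `M`. -/
def rootsMod (P : ℤ[X]) (M : ℕ) : Set (ZMod M) := {x | (P.map (Int.castRingHom (ZMod M))).eval x = 0}

lemma intCast_mem_rootsMod {P : ℤ[X]} {M : ℕ} {x : ℤ} :
    (x : ZMod M) ∈ rootsMod P M ↔ (M : ℤ) ∣ P.eval x := by
  rw [← ZMod.intCast_zmod_eq_zero_iff_dvd]
  simp only [rootsMod, Set.mem_ofPred_eq]
  rw [← eq_intCast (Int.castRingHom (ZMod M)) x, eval_map, eval₂_at_apply, eq_intCast]

/-- If `p ∤ Δ`, reduction modulo `p` is injective on the roots, so there are at most `deg P` (the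
added `1` is for `k = 0`). If `p^δ` exactly divides `Δ` with `δ ≥ 1` and `k > δ`, a root is
determined by its residue modulo `p^(δ+1)` and its top `δ` digits. For `k ≤ δ` the whole ring has at
most `|Δ|` elements. -/
theorem exists_ncard_rootsMod_le {P : ℤ[X]} (hP : Squarefree (P.map (Int.castRingHom ℚ))) :
    ∃ B : ℕ, ∀ p : ℕ, p.Prime → ∀ k, (rootsMod P (p ^ k)).ncard ≤ B := by
  obtain ⟨U, V, Δ, hΔ0, hΔ⟩ := exists_bezout_derivative hP
  have hN : 1 ≤ Δ.natAbs := Int.natAbs_pos.2 hΔ0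
  refine ⟨P.natDegree + 1 + Δ.natAbs ^ 3, fun p hp k => ?_⟩
  have : NeZero (p ^ k) := ⟨(pow_pos hp.pos k).ne'⟩
  have hfin : (rootsMod P (p ^ k)).Finite := Set.toFinite _
  have hle : (rootsMod P (p ^ k)).ncard ≤ p ^ k := by
    have := Set.ncard_le_ncard (Set.subset_univ (rootsMod P (p ^ k)))
    rwa [Set.ncard_univ, Nat.card_zmod] at this
  have hval : ∀ x ∈ rootsMod P (p ^ k), (p : ℤ) ^ k ∣ P.eval (x.val : ℤ) := by
    intro x hx
    have : ((x.val : ℤ) : ZMod (p ^ k)) = x := by simp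
    rw [← this] at hx
    exact_mod_cast intCast_mem_rootsMod.1 hx
  by_cases hpΔ : (p : ℤ) ∣ Δ
  · obtain ⟨δ, hδ1, hδ2⟩ : ∃ δ, (p : ℤ) ^ δ ∣ Δ ∧ ¬ (p : ℤ) ^ (δ + 1) ∣ Δ := by
      have hfm : FiniteMultiplicity (p : ℤ) Δ :=
        Int.finiteMultiplicity_iff.2 ⟨by simpa using hp.one_lt.ne', hΔ0⟩
      exact ⟨_, pow_multiplicity_dvd _ _, hfm.not_pow_dvd_of_multiplicity_lt (Nat.lt_succ_self _)⟩
    have hδ0 : 1 ≤ δ := by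
      by_contra! h0
      have : δ = 0 := by omega
      subst this
      simp at hδ2; contradiction
    have hpδ : p ^ δ ≤ Δ.natAbs := by
      have := Int.natAbs_dvd_natAbs.2 hδ1
      rw [Int.natAbs_pow, Int.natAbs_natCast] at this
      exact Nat.le_of_dvd hN this
    have hcube : Δ.natAbs ≤ Δ.natAbs ^ 3 := Nat.le_self_pow (by norm_num) _
    by_cases hk : δ < k
    · have hmaps : ∀ x ∈ rootsMod P (p ^ k), (x.val % p ^ (δ + 1), x.val / p ^ (k - δ)) ∈
          ((range (p ^ (δ + 1)) ×ˢ range (p ^ δ) : Finset (ℕ × ℕ)) : Set (ℕ × ℕ)) := by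
        intro x _
        simp only [coe_product, coe_range, Set.mem_prod, Set.mem_Iio]
        refine ⟨Nat.mod_lt _ (pow_pos hp.pos _), ?_⟩
        rw [Nat.div_lt_iff_lt_mul (pow_pos hp.pos _), ← pow_add]
        have := ZMod.val_lt x
        rwa [show δ + (k - δ) = k by omega]
      have hinj : Set.InjOn (fun x : ZMod (p ^ k) => (x.val % p ^ (δ + 1), x.val / p ^ (k - δ)))
          (rootsMod P (p ^ k)) := by
        intro x hx y hy he
        simp only [Prod.mk.injEq] at he
        apply ZMod.val_injective
        have h1 : (p : ℤ) ^ (δ + 1) ∣ (y.val : ℤ) - x.val := by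
          have := (Nat.modEq_iff_dvd (n := p ^ (δ + 1))).1 he.1
          exact_mod_cast this
        have h2 := pow_dvd_sub_of_roots hΔ hp hδ2 hk (hval x hx) (hval y hy) h1
        have h3 : x.val % p ^ (k - δ) = y.val % p ^ (k - δ) :=
          (Nat.modEq_iff_dvd (n := p ^ (k - δ))).2 (by exact_mod_cast h2)
        rw [← Nat.div_add_mod x.val (p ^ (k - δ)), ← Nat.div_add_mod y.val (p ^ (k - δ)), he.2, h3]
      have h1 := Set.ncard_le_ncard_of_injOn _ hmaps hinj (finite_toSet _)
      rw [Set.ncard_coe_finset, card_product, card_range, card_range] at h1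
      -- The cube comes from `2δ + 1 ≤ 3δ`, valid since `δ ≥ 1`.
      have h2 : p ^ (δ + 1) * p ^ δ ≤ (p ^ δ) ^ 3 := by
        rw [← pow_add, ← pow_mul]
        exact Nat.pow_le_pow_right hp.pos (by omega)
      have h3 : (p ^ δ) ^ 3 ≤ Δ.natAbs ^ 3 := Nat.pow_le_pow_left hpδ 3
      omega
    · have : p ^ k ≤ p ^ δ := Nat.pow_le_pow_right hp.pos (by omega)
      omega
  · rcases Nat.eq_zero_or_pos k with rfl | hk
    · have : p ^ 0 = 1 := pow_zero p
      omega
    have : Fact p.Prime := ⟨hp⟩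
    set Q := P.map (Int.castRingHom (ZMod p)) with hQ
    have hQ0 : Q ≠ 0 := by
      intro h0
      have h1 := congrArg (Polynomial.map (Int.castRingHom (ZMod p))) hΔ
      rw [Polynomial.map_add, Polynomial.map_mul, Polynomial.map_mul, ← derivative_map, ← hQ, h0] at h1
      simp at h1
      have h2 : ((Δ : ℤ) : ZMod p) = 0 := by
        have := congrArg (fun q => Polynomial.coeff q 0) h1
        simpa using this.symm
      exact hpΔ ((ZMod.intCast_zmod_eq_zero_iff_dvd _ _).1 h2)
    have hmaps : ∀ x ∈ rootsMod P (p ^ k), ((x.val : ℤ) : ZMod p) ∈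
        (Q.roots.toFinset : Set (ZMod p)) := by
      intro x hx
      rw [mem_coe, Multiset.mem_toFinset, mem_roots hQ0, IsRoot]
      exact intCast_mem_rootsMod.2 ((dvd_pow_self _ hk.ne').trans (hval x hx))
    have hinj : Set.InjOn (fun x : ZMod (p ^ k) => ((x.val : ℤ) : ZMod p)) (rootsMod P (p ^ k)) := by
      intro x hx y hy he
      apply ZMod.val_injective
      have h1 : (p : ℤ) ∣ (y.val : ℤ) - x.val :=
        (ZMod.intCast_eq_intCast_iff_dvd_sub _ _ _).1 he
      have h2 := pow_dvd_sub_of_roots (δ := 0) hΔ hp (by simpa using hpΔ) hk (hval x hx) (hval y hy)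
        (by simpa using h1)
      rw [Nat.sub_zero] at h2
      have h3 : x.val % p ^ k = y.val % p ^ k :=
        (Nat.modEq_iff_dvd (n := p ^ k)).2 (by exact_mod_cast h2)
      rwa [Nat.mod_eq_of_lt (ZMod.val_lt x), Nat.mod_eq_of_lt (ZMod.val_lt y)] at h3
    have h1 := Set.ncard_le_ncard_of_injOn _ hmaps hinj (finite_toSet _)
    rw [Set.ncard_coe_finset] at h1
    have h2 := (Multiset.toFinset_card_le Q.roots).trans (card_roots' Q)
    have h3 : Q.natDegree ≤ P.natDegree := natDegree_map_le
    omega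

end EllFamily

namespace EllFamily
open Finset
open scoped Classical

/-! ### Binary forms -/

/-- The value at `(a, b)` of the form `y ^ n * p (x / y)`. -/
noncomputable def form {R : Type*} [CommRing R] (p : ℤ[X]) (n : ℕ) (a b : R) : R :=
  MvPolynomial.aeval ![a, b] (p.homogenize n)

section form
variable {R : Type*} [CommRing R]

lemma formA_eq (f : ℤ[X]) (m : ℕ) (a b : ℤ) : formA f m a b = form f (4 * m) a b := by
  exact (DFunLike.congr_fun (MvPolynomial.coe_aeval_eq_eval _) _).symm

lemma formB_eq (f : ℤ[X]) (m : ℕ) (a b : ℤ) : formB f m a b = form f (6 * m) a b := by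
  exact (DFunLike.congr_fun (MvPolynomial.coe_aeval_eq_eval _) _).symm

lemma form_eq_sum (p : ℤ[X]) (n : ℕ) (a b : R) :
    form p n a b = ∑ i ∈ antidiagonal n, (p.coeff i.1 : R) * (a ^ i.1 * b ^ i.2) := by
  rw [form, Polynomial.homogenize, map_sum]
  refine sum_congr rfl fun i _ => ?_
  rw [MvPolynomial.aeval_monomial]
  simp [Finsupp.update_eq_add_single, Finsupp.prod_add_index', pow_add, Finsupp.prod_single_index]

lemma form_mul {p q : ℤ[X]} {k n : ℕ} (hp : p.natDegree ≤ k) (hq : q.natDegree ≤ n) (a b : R) :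
    form (p * q) (k + n) a b = form p k a b * form q n a b := by
  rw [form, homogenize_mul _ _ hp hq, map_mul]; rfl

lemma form_one (n : ℕ) (a b : R) : form 1 n a b = b ^ n := by simp [form]

lemma form_pow {p : ℤ[X]} {n : ℕ} (hp : p.natDegree ≤ n) (k : ℕ) (a b : R) :
    form (p ^ k) (k * n) a b = form p n a b ^ k := by
  induction k with
  | zero => simp [form_one]
  | succ k ih =>
    rw [pow_succ, pow_succ, Nat.succ_mul, form_mul (natDegree_pow_le_of_le k hp) hp, ih]

lemma form_add (p q : ℤ[X]) (n : ℕ) (a b : R) :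
    form (p + q) n a b = form p n a b + form q n a b := by
  simp [form, homogenize_add]

lemma form_C_mul_X_pow (c : ℤ) {i n : ℕ} (hi : i ≤ n) (a b : R) :
    form (C c * X ^ i) n a b = c * (a ^ i * b ^ (n - i)) := by
  rw [form, homogenize_C_mul, homogenize_X_pow hi]
  simp

lemma form_smul (p : ℤ[X]) (n : ℕ) (c a b : R) :
    form p n (c * a) (c * b) = c ^ n * form p n a b := by
  rw [form_eq_sum, form_eq_sum, mul_sum]
  refine sum_congr rfl fun i hi => ?_
  rw [← mem_antidiagonal.1 hi]
  ring

lemma map_form {S : Type*} [CommRing S] (φ : R →+* S) (p : ℤ[X]) (n : ℕ) (a b : R) :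
    φ (form p n a b) = form p n (φ a) (φ b) := by
  simp [form_eq_sum]

lemma form_intCast (p : ℤ[X]) (n : ℕ) (a b : ℤ) :
    ((form p n a b : ℤ) : R) = form p n (a : R) (b : R) := by
  simpa using map_form (Int.castRingHom R) p n a b

lemma form_right_one {p : ℤ[X]} {n : ℕ} (hp : p.natDegree ≤ n) (x : R) :
    form p n x 1 = aeval x p := by
  rw [form, aeval_homogenize_of_eq_one hp] <;> simp

lemma form_left_one {p : ℤ[X]} {n : ℕ} (hp : p.natDegree ≤ n) (x : R) :
    form p n 1 x = aeval x (p.reflect n) := by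
  have hd : (p.reflect n).natDegree ≤ n := (natDegree_reflect_le).trans (by simp [hp])
  rw [← form_right_one hd, form_eq_sum, form_eq_sum, ← Finset.Nat.sum_antidiagonal_swap]
  refine sum_congr rfl fun i hi => ?_
  have hi := mem_antidiagonal.1 hi
  rw [coeff_reflect, revAt_le (by omega), show n - i.1 = i.2 by omega]
  simp

lemma form_right_zero (p : ℤ[X]) (n : ℕ) (x : R) : form p n x 0 = p.coeff n * x ^ n := by
  rw [form_eq_sum, sum_eq_single (n, 0)]
  · simp
  · rintro ⟨i, j⟩ hij hne
    have hij := mem_antidiagonal.1 hij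
    have : j ≠ 0 := by rintro rfl; exact hne (by simpa using hij)
    simp [this]
  · simp

lemma form_dvd_of_congr {M : ℕ} (p : ℤ[X]) (n : ℕ) {a b a' b' c : ℤ}
    (ha : (a : ZMod M) = (c * a' : ℤ)) (hb : (b : ZMod M) = (c * b' : ℤ))
    (h : (M : ℤ) ∣ form p n a' b') : (M : ℤ) ∣ form p n a b := by
  rw [← ZMod.intCast_zmod_eq_zero_iff_dvd, form_intCast] at h ⊢
  rw [ha, hb]
  push_cast
  rw [form_smul, h, mul_zero]

lemma form_real_ne_zero {p : ℤ[X]} {n : ℕ} (hp : p.natDegree ≤ n) {x y : ℝ} (hy : y ≠ 0)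
    (h : form p n x y = 0) : aeval (x / y) p = 0 := by
  have h1 := form_smul p n y (x / y) 1
  rw [mul_div_cancel₀ _ hy, mul_one, h, form_right_one hp] at h1
  exact (mul_eq_zero.1 h1.symm).resolve_left (pow_ne_zero _ hy)

end form

/-! ### Bounds for real forms -/

lemma abs_form_le (p : ℤ[X]) (n : ℕ) :
    ∃ K : ℝ, 0 ≤ K ∧ ∀ v : ℝ × ℝ, |form p n v.1 v.2| ≤ K * ‖v‖ ^ n := by
  refine ⟨∑ i ∈ antidiagonal n, |(p.coeff i.1 : ℝ)|, sum_nonneg fun _ _ => abs_nonneg _,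
    fun v => ?_⟩
  rw [form_eq_sum, sum_mul]
  refine (abs_sum_le_sum_abs _ _).trans (sum_le_sum fun i hi => ?_)
  rw [abs_mul, abs_mul, abs_pow, abs_pow, ← mem_antidiagonal.1 hi, pow_add]
  have h1 : |v.1| ≤ ‖v‖ := norm_fst_le v
  have h2 : |v.2| ≤ ‖v‖ := norm_snd_le v
  gcongr

/-- The mean value bound, multiplied through by `t` so that the exponent `i - 1` does not appear and
`i = 0` needs no separate treatment. -/
lemma abs_pow_sub_pow_le {x y t e : ℝ} (i : ℕ) (hx : |x| ≤ t) (hy : |y| ≤ t) (hxy : |x - y| ≤ e) :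
    |x ^ i - y ^ i| * t ≤ i * e * t ^ i := by
  have ht : 0 ≤ t := (abs_nonneg x).trans hx
  have he : 0 ≤ e := (abs_nonneg _).trans hxy
  induction i with
  | zero => simp
  | succ i ih =>
    have e1 : x ^ (i + 1) - y ^ (i + 1) = x * (x ^ i - y ^ i) + (x - y) * y ^ i := by ring
    have h1 : |x * (x ^ i - y ^ i)| ≤ t * |x ^ i - y ^ i| := by
      rw [abs_mul]; gcongr
    have h2 : |(x - y) * y ^ i| ≤ e * t ^ i := by
      rw [abs_mul, abs_pow]; gcongr
    have h3 := (abs_add_le (x * (x ^ i - y ^ i)) ((x - y) * y ^ i)).trans (add_le_add h1 h2)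
    rw [e1]
    calc _ ≤ (t * |x ^ i - y ^ i| + e * t ^ i) * t := by gcongr
      _ = t * (|x ^ i - y ^ i| * t) + e * t ^ i * t := by ring
      _ ≤ t * (i * e * t ^ i) + e * t ^ i * t := by gcongr
      _ = _ := by push_cast; ring

lemma abs_form_sub_le (p : ℤ[X]) (n : ℕ) :
    ∃ K : ℝ, 0 ≤ K ∧ ∀ (v w : ℝ × ℝ) (t : ℝ), ‖v‖ ≤ t → ‖w‖ ≤ t →
      |form p n v.1 v.2 - form p n w.1 w.2| * t ≤ K * ‖v - w‖ * t ^ n := by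
  refine ⟨∑ i ∈ antidiagonal n, |(p.coeff i.1 : ℝ)| * n,
    sum_nonneg fun _ _ => by positivity, fun v w t hv hw => ?_⟩
  have ht : 0 ≤ t := (norm_nonneg v).trans hv
  rw [form_eq_sum, form_eq_sum, ← sum_sub_distrib]
  refine (mul_le_mul_of_nonneg_right (abs_sum_le_sum_abs _ _) ht).trans ?_
  rw [sum_mul, sum_mul, sum_mul]
  refine sum_le_sum fun i hi => ?_
  have hin := mem_antidiagonal.1 hi
  have hv1 : |v.1| ≤ t := (norm_fst_le v).trans hv
  have hv2 : |v.2| ≤ t := (norm_snd_le v).trans hv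
  have hw1 : |w.1| ≤ t := (norm_fst_le w).trans hw
  have hw2 : |w.2| ≤ t := (norm_snd_le w).trans hw
  have h1 := abs_pow_sub_pow_le i.1 hv1 hw1 (norm_fst_le (v - w))
  have h2 := abs_pow_sub_pow_le i.2 hv2 hw2 (norm_snd_le (v - w))
  have e1 : (p.coeff i.1 : ℝ) * (v.1 ^ i.1 * v.2 ^ i.2) - (p.coeff i.1 : ℝ) * (w.1 ^ i.1 * w.2 ^ i.2)
      = (p.coeff i.1 : ℝ) * ((v.1 ^ i.1 - w.1 ^ i.1) * v.2 ^ i.2 + w.1 ^ i.1 * (v.2 ^ i.2 - w.2 ^ i.2)) := by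
    ring
  have h3 : |(v.1 ^ i.1 - w.1 ^ i.1) * v.2 ^ i.2 + w.1 ^ i.1 * (v.2 ^ i.2 - w.2 ^ i.2)| ≤
      |v.1 ^ i.1 - w.1 ^ i.1| * t ^ i.2 + t ^ i.1 * |v.2 ^ i.2 - w.2 ^ i.2| := by
    refine (abs_add_le _ _).trans ?_
    rw [abs_mul, abs_mul, abs_pow, abs_pow]
    gcongr
  rw [e1, abs_mul]
  calc _ ≤ |(p.coeff i.1 : ℝ)| * (|v.1 ^ i.1 - w.1 ^ i.1| * t ^ i.2 +
        t ^ i.1 * |v.2 ^ i.2 - w.2 ^ i.2|) * t := by gcongr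
    _ = |(p.coeff i.1 : ℝ)| * ((|v.1 ^ i.1 - w.1 ^ i.1| * t) * t ^ i.2 +
        t ^ i.1 * (|v.2 ^ i.2 - w.2 ^ i.2| * t)) := by ring
    _ ≤ |(p.coeff i.1 : ℝ)| * ((i.1 * ‖v - w‖ * t ^ i.1) * t ^ i.2 +
        t ^ i.1 * (i.2 * ‖v - w‖ * t ^ i.2)) := by
        gcongr
    _ = _ := by
        rw [← hin, pow_add]; push_cast; ring

/-! ### The resultant of two forms -/

/-- The Sylvester map composed with its adjugate is multiplication by the resultant. So the
resultant times `X^i` is a combination of `F` and `G` with cofactors of degree below `n`; homogenise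
it in degree `2n - 1`. -/
lemma exists_form_combination {F G : ℤ[X]} {n : ℕ} (hn : 1 ≤ n) (hF : F.natDegree ≤ n)
    (hG : G.natDegree ≤ n) (a b : ℤ) {i : ℕ} (hi : i ≤ 2 * n - 1) :
    ∃ u v : ℤ, form F n a b * u + form G n a b * v =
      resultant F G n n * (a ^ i * b ^ (2 * n - 1 - i)) := by
  have key : ∃ P Q : ℤ[X], P.degree < n ∧ Q.degree < n ∧
      F * P + G * Q = C (resultant F G n n) * X ^ i := by
    have hX : (X ^ i : ℤ[X]) ∈ degreeLT ℤ (n + n) := by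
      rw [mem_degreeLT, degree_X_pow]
      exact_mod_cast (by omega : i < n + n)
    have h := congrArg (fun L => L ⟨X ^ i, hX⟩) (sylveserMap_comp_adjSylvester F G hF hG)
    simp only [LinearMap.comp_apply, LinearMap.smul_apply, LinearMap.id_apply] at h
    generalize adjSylvester (m := n) (n := n) F G ⟨X ^ i, hX⟩ = PQ at h
    obtain ⟨⟨Q, hQ⟩, ⟨P, hP⟩⟩ := PQ
    refine ⟨P, Q, mem_degreeLT.1 hP, mem_degreeLT.1 hQ, ?_⟩
    have h2 := congrArg Subtype.val h
    rw [← smul_eq_C_mul]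
    exact h2
  obtain ⟨P, Q, hP, hQ, he⟩ := key
  have hP' : P.natDegree ≤ n - 1 := by
    by_cases h0 : P = 0
    · simp [h0]
    · have := (natDegree_lt_iff_degree_lt h0).2 hP; omega
  have hQ' : Q.natDegree ≤ n - 1 := by
    by_cases h0 : Q = 0
    · simp [h0]
    · have := (natDegree_lt_iff_degree_lt h0).2 hQ; omega
  refine ⟨form P (n - 1) a b, form Q (n - 1) a b, ?_⟩
  have h := congrArg (fun p => form p (n + (n - 1)) a b) he
  simp only [form_add] at h
  rw [form_mul hF hP', form_mul hG hQ', form_C_mul_X_pow _ (by omega)] at h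
  rw [h, show n + (n - 1) = 2 * n - 1 by omega]
  simp

/-- The two extreme monomials suffice: `k` divides `t` times the resultant times both `a^(2n-1)` and
`b^(2n-1)`, whose gcd is a power of `gcd(a, b)` and so prime to `k`. -/
lemma dvd_mul_resultant {F G : ℤ[X]} {n : ℕ} (hn : 1 ≤ n) (hF : F.natDegree ≤ n)
    (hG : G.natDegree ≤ n) {a b : ℤ} {k t : ℤ} (hab : IsCoprime k (Int.gcd a b))
    (h1 : k ∣ t * form F n a b) (h2 : k ∣ t * form G n a b) : k ∣ t * resultant F G n n := by
  have hcomb : ∀ i ≤ 2 * n - 1, k ∣ t * resultant F G n n * (a ^ i * b ^ (2 * n - 1 - i)) := by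
    intro i hi
    obtain ⟨u, v, huv⟩ := exists_form_combination hn hF hG a b hi
    rw [mul_assoc, ← huv, mul_add, ← mul_assoc, ← mul_assoc]
    exact dvd_add (h1.mul_right u) (h2.mul_right v)
  have ha := hcomb (2 * n - 1) le_rfl
  have hb := hcomb 0 (Nat.zero_le _)
  simp only [Nat.sub_self, pow_zero, mul_one, one_mul, Nat.sub_zero] at ha hb
  have hg : k ∣ t * resultant F G n n * ((Int.gcd (a ^ (2 * n - 1)) (b ^ (2 * n - 1)) : ℕ) : ℤ) := by
    rw [Int.gcd_eq_gcd_ab, mul_add, ← mul_assoc, ← mul_assoc]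
    exact dvd_add (ha.mul_right _) (hb.mul_right _)
  have hgp : ((Int.gcd (a ^ (2 * n - 1)) (b ^ (2 * n - 1)) : ℕ) : ℤ) = (Int.gcd a b : ℤ) ^ (2 * n - 1) := by
    rw [← Nat.cast_pow, Nat.cast_inj, Int.gcd, Int.gcd, Int.natAbs_pow, Int.natAbs_pow,
      Nat.pow_gcd_pow]
  rw [hgp] at hg
  exact hab.pow_right.dvd_of_dvd_mul_right hg

/-- Raising the formal degree of one polynomial multiplies the resultant, up to sign, by a power of
the other one's leading coefficient. That is harmless when the other has full degree, i.e. when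
there is no common zero at infinity. -/
lemma resultant_ne_zero_of_isCoprime {K : Type*} [Field K] {F G : K[X]} {n : ℕ}
    (h : IsCoprime F G) (hF : F.natDegree ≤ n) (hG : G.natDegree ≤ n)
    (hFG : F.natDegree = n ∨ G.natDegree = n) (hn : 1 ≤ n) : resultant F G n n ≠ 0 := by
  have aux : ∀ {F G : K[X]}, IsCoprime F G → F.natDegree = n → G.natDegree ≤ n →
      resultant F G n n ≠ 0 := by
    intro F G h hF hG
    obtain ⟨k, hk⟩ := Nat.exists_eq_add_of_le hG
    have hF0 : F ≠ 0 := by rintro rfl; simp at hF; omega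
    have e : resultant F G n n = resultant F G n (G.natDegree + k) := by rw [← hk]
    rw [e, resultant_add_right_deg _ _ _ _ _ le_rfl]
    refine mul_ne_zero (pow_ne_zero _ ?_) ?_
    · rw [← hF]; simpa using hF0
    · rw [← hF]; exact resultant_ne_zero F G h
  rcases hFG with h1 | h1
  · exact aux h h1 hG
  · rw [resultant_comm]
    exact mul_ne_zero (pow_ne_zero _ (neg_ne_zero.2 one_ne_zero)) (aux h.symm h1 hF)

end EllFamily

namespace EllFamily
open Finset
open scoped Classical

/-! ### The common factor of `f ^ 3` and `g ^ 2` -/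

/-- The factorisations `f ^ 3 = h ^ r * F` and `g ^ 2 = h ^ r * G` with `h` squarefree and `F`, `G`
coprime, with the inequalities between the degrees. -/
structure FamilyData (f g : ℤ[X]) (m r : ℕ) (h F G : ℤ[X]) (n : ℕ) (R : ℤ) : Prop where
  one_le_m : 1 ≤ m
  one_le_r : 1 ≤ r
  natDegree_f : f.natDegree ≤ 4 * m
  natDegree_g : g.natDegree ≤ 6 * m
  f_pow : f ^ 3 = h ^ r * F
  g_pow : g ^ 2 = h ^ r * G
  one_le_n : 1 ≤ n
  deg_add : r * h.natDegree + n = 12 * m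
  natDegree_F : F.natDegree ≤ n
  natDegree_G : G.natDegree ≤ n
  squarefree_h : Squarefree (h.map (Int.castRingHom ℚ))
  form_h_ne_zero : ∀ v : ℝ × ℝ, v ≠ 0 → form h h.natDegree v.1 v.2 ≠ 0
  form_ne_zero : ∀ v : ℝ × ℝ, v ≠ 0 → form f (4 * m) v.1 v.2 ≠ 0 ∨ form g (6 * m) v.1 v.2 ≠ 0
  R_ne_zero : R ≠ 0
  R_eq : R = resultant F G n n
  cofactorResultant_eq : cofactorResultant f g m = R
  lt_m : r * (2 + m) < 12 * m
  lt_deg : r * h.natDegree * (2 + m) < 24 * m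

/-- The primitive part is a competitor of the same degree, so minimality of the leading coefficient
excludes a content above `1`. -/
lemma IsPolyGcd.isPrimitive {u v s : ℤ[X]} (h : IsPolyGcd u v s) : s.IsPrimitive := by
  have hs0 : s ≠ 0 := by rintro rfl; simpa using h.leadingCoeff_pos
  have hc0 : s.content ≠ 0 := mt content_eq_zero_iff.1 hs0
  have hc : 0 < s.content :=
    lt_of_le_of_ne (Int.nonneg_of_normalize_eq_self normalize_content) hc0.symm
  have he := s.eq_C_content_mul_primPart
  have hl : s.leadingCoeff = s.content * s.primPart.leadingCoeff := by
    conv_lhs => rw [he]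
    rw [leadingCoeff_mul, leadingCoeff_C]
  have hd : s.primPart.map (Int.castRingHom ℚ) ∣ s.map (Int.castRingHom ℚ) := by
    conv_rhs => rw [he]
    rw [Polynomial.map_mul]
    exact dvd_mul_left _ _
  have hpos : 0 < s.primPart.leadingCoeff := by
    have := h.leadingCoeff_pos
    rw [hl] at this
    exact (pos_iff_pos_of_mul_pos this).1 hc
  have hle := h.leadingCoeff_le s.primPart (hd.trans h.dvd_left) (hd.trans h.dvd_right)
    (natDegree_primPart s) hpos
  rw [hl] at hle
  rw [isPrimitive_iff_content_eq_one]
  nlinarith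

lemma exists_map_eq_C_mul (t : ℚ[X]) :
    ∃ (w : ℤ[X]) (b : ℚ), b ≠ 0 ∧ w.map (Int.castRingHom ℚ) = C b * t := by
  obtain ⟨b, hb0, hb⟩ := IsLocalization.integerNormalization_spec (nonZeroDivisors ℤ) t
  refine ⟨IsLocalization.integerNormalization (nonZeroDivisors ℤ) t, (b : ℚ),
    by exact_mod_cast nonZeroDivisors.ne_zero hb0, ?_⟩
  have e : algebraMap ℤ ℚ = Int.castRingHom ℚ := rfl
  rw [e] at hb
  rw [hb, zsmul_eq_mul]; simp

/-- A nonconstant common factor of the cofactors could be multiplied into `s`, against the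
maximality of its degree. -/
lemma IsPolyGcd.isCoprime {u v s F G : ℤ[X]} (h : IsPolyGcd u v s) (hF : u = s * F) (hG : v = s * G)
    (huv : u ≠ 0) : IsCoprime (F.map (Int.castRingHom ℚ)) (G.map (Int.castRingHom ℚ)) := by
  have hinj : Function.Injective (Int.castRingHom ℚ) := Int.cast_injective
  set φ := Int.castRingHom ℚ
  have hF0 : F.map φ ≠ 0 := by
    rw [Ne, Polynomial.map_eq_zero_iff hinj]
    rintro rfl; exact huv (by rw [hF, mul_zero])
  have hs0 : s ≠ 0 := by rintro rfl; exact huv (by rw [hF, zero_mul])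
  rw [← EuclideanDomain.gcd_isUnit_iff]
  set t := EuclideanDomain.gcd (F.map φ) (G.map φ) with ht
  have ht0 : t ≠ 0 := by
    intro h0
    exact hF0 (EuclideanDomain.gcd_eq_zero_iff.1 h0).1
  obtain ⟨w, b, hb, hw⟩ := exists_map_eq_C_mul t
  have hbu : IsUnit (C b : ℚ[X]) := isUnit_C.2 (isUnit_iff_ne_zero.2 hb)
  have hw0 : w ≠ 0 := by
    rintro rfl
    rw [Polynomial.map_zero] at hw
    exact mul_ne_zero hbu.ne_zero ht0 hw.symm
  have h1 : (s * w).map φ ∣ u.map φ := by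
    rw [hF, Polynomial.map_mul, Polynomial.map_mul, hw]
    exact mul_dvd_mul_left _ (hbu.mul_left_dvd.2 (EuclideanDomain.gcd_dvd_left _ _))
  have h2 : (s * w).map φ ∣ v.map φ := by
    rw [hG, Polynomial.map_mul, Polynomial.map_mul, hw]
    exact mul_dvd_mul_left _ (hbu.mul_left_dvd.2 (EuclideanDomain.gcd_dvd_right _ _))
  have h3 := h.natDegree_le _ h1 h2
  rw [natDegree_mul hs0 hw0] at h3
  have h4 : w.natDegree = t.natDegree := by
    rw [← natDegree_map_eq_of_injective hinj, hw, natDegree_C_mul hb]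
  rw [Polynomial.isUnit_iff_degree_eq_zero, degree_eq_natDegree ht0]
  exact_mod_cast (by omega : t.natDegree = 0)

/-- An `r`-th power in `ℚ[X]` which is a primitive integer polynomial with positive leading
coefficient is the `r`-th power of an integer polynomial. -/
lemma exists_eq_pow_of_map_eq_pow {s : ℤ[X]} (hs : s.IsPrimitive) (hpos : 0 < s.leadingCoeff)
    {r : ℕ} (hr : 1 ≤ r) {k : ℚ[X]} (hk : s.map (Int.castRingHom ℚ) = k ^ r) :
    ∃ (h : ℤ[X]) (c : ℚ), c ≠ 0 ∧ s = h ^ r ∧ k = C c * h.map (Int.castRingHom ℚ) := by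
  have hinj : Function.Injective (Int.castRingHom ℚ) := Int.cast_injective
  set φ := Int.castRingHom ℚ
  have hs0 : s ≠ 0 := hs.ne_zero
  have hk0 : k ≠ 0 := by
    rintro rfl
    rw [zero_pow (by omega), Polynomial.map_eq_zero_iff hinj] at hk
    exact hs0 hk
  obtain ⟨w, b, hb, hw⟩ := exists_map_eq_C_mul k
  have hw0 : w ≠ 0 := by
    rintro rfl
    rw [Polynomial.map_zero] at hw
    exact mul_ne_zero (C_ne_zero.2 hb) hk0 hw.symm
  have hkw : ∃ (h : ℤ[X]) (c : ℚ), h.IsPrimitive ∧ 0 < h.leadingCoeff ∧ c ≠ 0 ∧ k = C c * h.map φ := by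
    have hc0 : (w.content : ℚ) ≠ 0 := by exact_mod_cast (mt content_eq_zero_iff.1 hw0)
    have he : w.map φ = C (w.content : ℚ) * w.primPart.map φ := by
      conv_lhs => rw [w.eq_C_content_mul_primPart]
      simp [φ]
    have hkp : k = C (b⁻¹ * w.content) * w.primPart.map φ := by
      rw [C_mul, mul_assoc, ← he, hw, ← mul_assoc, ← C_mul, inv_mul_cancel₀ hb, C_1, one_mul]
    have hp0 : w.primPart ≠ 0 := w.isPrimitive_primPart.ne_zero
    rcases lt_or_gt_of_ne (leadingCoeff_ne_zero.2 hp0) with hneg | hp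
    · refine ⟨-w.primPart, -(b⁻¹ * w.content), ?_, by rw [leadingCoeff_neg]; omega,
        neg_ne_zero.2 (mul_ne_zero (inv_ne_zero hb) hc0), ?_⟩
      · have := w.isPrimitive_primPart
        intro r hr
        exact this r ((dvd_neg).1 hr)
      · rw [hkp, Polynomial.map_neg, C_neg]; ring
    · exact ⟨w.primPart, _, w.isPrimitive_primPart, hp, mul_ne_zero (inv_ne_zero hb) hc0, hkp⟩
  obtain ⟨h, c, hprim, hlc, hc0, hkh⟩ := hkw
  refine ⟨h, c, hc0, ?_, hkh⟩
  have hprimr : (h ^ r).IsPrimitive := by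
    clear hk hr
    induction r with
    | zero => rw [pow_zero]; exact isPrimitive_one
    | succ r ih => rw [pow_succ]; exact ih.mul hprim
  have hmap : s.map φ = C (c ^ r) * (h ^ r).map φ := by
    rw [hk, hkh, mul_pow, Polynomial.map_pow, C_pow]
  have hu : IsUnit (C (c ^ r) : ℚ[X]) := isUnit_C.2 (isUnit_iff_ne_zero.2 (pow_ne_zero _ hc0))
  have h1 : s ∣ h ^ r := hs.dvd_of_fraction_map_dvd_fraction_map (K := ℚ) (by
    rw [show algebraMap ℤ ℚ = φ from rfl, hmap]; exact hu.mul_left_dvd.2 dvd_rfl)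
  have h2 : h ^ r ∣ s := hprimr.dvd_of_fraction_map_dvd_fraction_map (K := ℚ) (by
    rw [show algebraMap ℤ ℚ = φ from rfl, hmap]; exact dvd_mul_left _ _)
  obtain ⟨u, hu'⟩ := associated_of_dvd_dvd h1 h2
  obtain ⟨e, he, heu⟩ := Polynomial.isUnit_iff.1 u.isUnit
  rw [← heu] at hu'
  have hl := congrArg leadingCoeff hu'
  rw [leadingCoeff_mul, leadingCoeff_C, leadingCoeff_pow] at hl
  have hlp : 0 < h.leadingCoeff ^ r := pow_pos hlc r
  rw [← hl] at hlp
  have hep : 0 < e := (pos_iff_pos_of_mul_pos hlp).1 hpos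
  rcases Int.isUnit_iff.1 he with rfl | rfl
  · simpa using hu'
  · omega

/-- Primitivity of `s` makes both divisions integral and gives `s` an integral `r`-th root `h`. A
real root of `h` would be a common root of `f` and `g`, so `h` has none; in particular its degree is
not one, which is where the inequality `lt_m` comes from. -/
theorem exists_familyData {f g : ℤ[X]} {m r : ℕ} (hm : 1 ≤ m)
    (hroot : ∀ x : ℝ, ¬ (aeval x f = 0 ∧ aeval x g = 0))
    (hdeg : max ((f.natDegree : ℚ) / 2) ((g.natDegree : ℚ) / 3) = 2 * m)
    (hs : ∃ κ : ℝ, (m : ℝ) < κ ∧ ((polyGcd (f ^ 3) (g ^ 2)).natDegree : ℝ) ≤ 24 * m / (2 + κ))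
    (hr : IsPowerExponent (polyGcd (f ^ 3) (g ^ 2)) r) :
    ∃ h F G n R, FamilyData f g m r h F G n R := by
  have hinj : Function.Injective (Int.castRingHom ℚ) := Int.cast_injective
  set φ := Int.castRingHom ℚ with hφ
  have hm1 : (1 : ℝ) ≤ m := by exact_mod_cast hm
  have hdf : f.natDegree ≤ 4 * m := by
    have := (le_max_left _ _).trans_eq hdeg
    have h2 : (f.natDegree : ℚ) ≤ 4 * m := by linarith
    exact_mod_cast h2
  have hdg : g.natDegree ≤ 6 * m := by
    have := (le_max_right _ _).trans_eq hdeg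
    have h2 : (g.natDegree : ℚ) ≤ 6 * m := by linarith
    exact_mod_cast h2
  have hdfg : f.natDegree = 4 * m ∨ g.natDegree = 6 * m := by
    rcases max_choice ((f.natDegree : ℚ) / 2) ((g.natDegree : ℚ) / 3) with h1 | h1
    · left
      rw [h1] at hdeg
      have h2 : (f.natDegree : ℚ) = 4 * m := by linarith
      exact_mod_cast h2
    · right
      rw [h1] at hdeg
      have h2 : (g.natDegree : ℚ) = 6 * m := by linarith
      exact_mod_cast h2
  have hfg : f ^ 3 ≠ 0 ∨ g ^ 2 ≠ 0 := by
    rcases hdfg with h1 | h1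
    · left; apply pow_ne_zero; rintro rfl; simp at h1; omega
    · right; apply pow_ne_zero; rintro rfl; simp at h1; omega
  have hgcd := isPolyGcd_polyGcd hfg
  set s := polyGcd (f ^ 3) (g ^ 2) with hsdef
  have hprim := hgcd.isPrimitive
  have hs0 : s ≠ 0 := hprim.ne_zero
  have hsD : s.natDegree * (2 + m) < 24 * m := by
    obtain ⟨κ, hκ, hle⟩ := hs
    rw [le_div_iff₀ (by linarith)] at hle
    rcases Nat.eq_zero_or_pos s.natDegree with h0 | h0
    · rw [h0]; omega
    · have h1 : (0 : ℝ) < s.natDegree := by exact_mod_cast h0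
      have : (s.natDegree : ℝ) * (2 + m) < 24 * m := by nlinarith
      exact_mod_cast this
  have hsd : s.natDegree < 12 * m := by nlinarith
  obtain ⟨F, hF⟩ : s ∣ f ^ 3 := hprim.dvd_of_fraction_map_dvd_fraction_map (K := ℚ) hgcd.dvd_left
  obtain ⟨G, hG⟩ : s ∣ g ^ 2 := hprim.dvd_of_fraction_map_dvd_fraction_map (K := ℚ) hgcd.dvd_right
  -- If `f = 0`, the gcd would have the degree `12m` of `g ^ 2`, too large for the bound on `deg s`.
  have hf0 : f ^ 3 ≠ 0 := by
    intro h0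
    have hg : g.natDegree = 6 * m := by
      rcases hdfg with h1 | h1
      · rw [pow_eq_zero_iff (by norm_num)] at h0
        rw [h0] at h1; simp at h1; omega
      · exact h1
    have := hgcd.natDegree_le (g ^ 2) (by rw [h0]; simp) dvd_rfl
    rw [natDegree_pow] at this
    omega
  have hg0 : g ^ 2 ≠ 0 := by
    intro h0
    have hg : f.natDegree = 4 * m := by
      rcases hdfg with h1 | h1
      · exact h1
      · rw [pow_eq_zero_iff (by norm_num)] at h0
        rw [h0] at h1; simp at h1; omega
    have := hgcd.natDegree_le (f ^ 3) dvd_rfl (by rw [h0]; simp)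
    rw [natDegree_pow] at this
    omega
  have hcop := hgcd.isCoprime hF hG hf0
  have hF0 : F ≠ 0 := by rintro rfl; exact hf0 (by rw [hF, mul_zero])
  have hG0 : G ≠ 0 := by rintro rfl; exact hg0 (by rw [hG, mul_zero])
  have hdF : 3 * f.natDegree = s.natDegree + F.natDegree := by
    rw [← natDegree_mul hs0 hF0, ← hF, natDegree_pow]
  have hdG : 2 * g.natDegree = s.natDegree + G.natDegree := by
    rw [← natDegree_mul hs0 hG0, ← hG, natDegree_pow]
  set n := 12 * m - s.natDegree with hn
  have hFn : F.natDegree ≤ n := by omega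
  have hGn : G.natDegree ≤ n := by omega
  obtain ⟨h, hsq, hsh, hr1⟩ : ∃ h : ℤ[X], Squarefree (h.map φ) ∧ s = h ^ r ∧
      1 ≤ r ∧ (h.natDegree = 0 → r = 1) := by
    rcases hr with ⟨h0, rfl⟩ | ⟨h0, hr, k, hk, hsk⟩
    · refine ⟨s, ?_, (pow_one s).symm, le_rfl, fun _ => rfl⟩
      have hsC := eq_C_of_natDegree_eq_zero h0
      rw [hsC, Polynomial.map_C]
      refine IsUnit.squarefree (isUnit_C.2 (isUnit_iff_ne_zero.2 ?_))
      have : s.coeff 0 ≠ 0 := by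
        intro h1; rw [h1, C_0] at hsC; exact hs0 hsC
      simpa using this
    · have hr1 : 1 ≤ r := by omega
      obtain ⟨h, c, hc0, hsh, hkh⟩ := exists_eq_pow_of_map_eq_pow hprim hgcd.leadingCoeff_pos hr1 hsk
      refine ⟨h, ?_, hsh, hr1, fun h1 => ?_⟩
      · rw [hkh] at hk
        exact hk.squarefree_of_dvd (dvd_mul_left _ _)
      · rw [hsh, natDegree_pow, h1] at h0; omega
  obtain ⟨hr1, hr0⟩ := hr1
  have hh0 : h ≠ 0 := by
    rintro rfl
    rw [zero_pow (by omega)] at hsh; exact hs0 hsh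
  have hsdeg : s.natDegree = r * h.natDegree := by rw [hsh, natDegree_pow]
  have hnoroot : ∀ x : ℝ, aeval x h ≠ 0 := by
    intro x hx
    refine hroot x ⟨?_, ?_⟩
    · have := congrArg (aeval x) hF
      rw [hsh, map_mul, map_pow, map_pow, hx, zero_pow (by omega), zero_mul] at this
      exact pow_eq_zero_iff (by norm_num) |>.1 this
    · have := congrArg (aeval x) hG
      rw [hsh, map_mul, map_pow, map_pow, hx, zero_pow (by omega), zero_mul] at this
      exact pow_eq_zero_iff (by norm_num) |>.1 this
  have hd1 : h.natDegree ≠ 1 := by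
    intro h1
    have hl : h.coeff 1 ≠ 0 := by
      have := leadingCoeff_ne_zero.2 hh0
      rwa [leadingCoeff, h1] at this
    have hlR : (h.coeff 1 : ℝ) ≠ 0 := by exact_mod_cast hl
    refine hnoroot (-(h.coeff 0 : ℝ) / h.coeff 1) ?_
    have hev : ∀ x : ℝ, aeval x h = h.coeff 1 * x + h.coeff 0 := by
      intro x
      conv_lhs => rw [eq_X_add_C_of_natDegree_le_one h1.le]
      simp
    rw [hev]
    field_simp
    ring
  refine ⟨h, F, G, n, resultant F G n n, hm, hr1, hdf, hdg, hsh ▸ hF, hsh ▸ hG, by omega,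
    by omega, hFn, hGn, hsq, ?_, ?_, ?_, rfl, ?_, ?_, hsdeg ▸ hsD⟩
  · rintro ⟨x, y⟩ hv h0
    by_cases hy : y = 0
    · subst hy
      have hx : x ≠ 0 := by rintro rfl; exact hv rfl
      simp only at h0
      rw [form_right_zero] at h0
      have : (h.coeff h.natDegree : ℝ) ≠ 0 := by exact_mod_cast leadingCoeff_ne_zero.2 hh0
      exact mul_ne_zero this (pow_ne_zero _ hx) h0
    · exact hnoroot _ (form_real_ne_zero le_rfl hy h0)
  · rintro ⟨x, y⟩ hv
    by_contra! h0
    simp only at h0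
    by_cases hy : y = 0
    · subst hy
      have hx : x ≠ 0 := by rintro rfl; exact hv rfl
      rw [form_right_zero, form_right_zero] at h0
      have h1 : (f.coeff (4 * m) : ℝ) = 0 := (mul_eq_zero.1 h0.1).resolve_right (pow_ne_zero _ hx)
      have h2 : (g.coeff (6 * m) : ℝ) = 0 := (mul_eq_zero.1 h0.2).resolve_right (pow_ne_zero _ hx)
      rcases hdfg with h3 | h3
      · rw [← h3] at h1
        have : f = 0 := leadingCoeff_eq_zero.1 (by exact_mod_cast h1)
        rw [this] at hf0; simp at hf0
      · rw [← h3] at h2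
        have : g = 0 := leadingCoeff_eq_zero.1 (by exact_mod_cast h2)
        rw [this] at hg0; simp at hg0
    · exact hroot _ ⟨form_real_ne_zero hdf hy h0.1, form_real_ne_zero hdg hy h0.2⟩
  · intro h0
    have h1 : resultant (F.map φ) (G.map φ) n n = 0 := by
      rw [resultant_map_map, h0, map_zero]
    refine resultant_ne_zero_of_isCoprime hcop ?_ ?_ ?_ (by omega) h1
    · exact (natDegree_map_eq_of_injective hinj F).trans_le hFn
    · exact (natDegree_map_eq_of_injective hinj G).trans_le hGn
    · rw [natDegree_map_eq_of_injective hinj, natDegree_map_eq_of_injective hinj]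
      omega
  · have hsm : s.map φ ≠ 0 := by rwa [Ne, Polynomial.map_eq_zero_iff hinj]
    rw [cofactorResultant, ← hsdef, hF, hG, Polynomial.map_mul, Polynomial.map_mul,
      mul_div_cancel_left₀ _ hsm, mul_div_cancel_left₀ _ hsm, ← hφ, resultant_map_map]
    simp [hφ]; rfl
  -- Either `h` is constant and `r = 1`, or `deg s = r deg h ≥ 2r` and the bound `deg s (2 + m) <
  -- 24m` can be halved.
  · rcases Nat.lt_or_ge h.natDegree 2 with h2 | h2
    · rw [hr0 (by omega)]; omega
    · rw [hsdeg] at hsD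
      nlinarith [Nat.mul_le_mul_left r h2]

end EllFamily

namespace EllFamily
open Finset
open scoped Classical

/-! ### The height as a gauge -/

/-- The untwisted height of a real point. -/
noncomputable def hgt (f g : ℤ[X]) (m : ℕ) (v : ℝ × ℝ) : ℝ :=
  max (4 * |form f (4 * m) v.1 v.2| ^ 3) (27 * form g (6 * m) v.1 v.2 ^ 2)

/-- The `12 m`-th root of the untwisted height. -/
noncomputable def gauge (f g : ℤ[X]) (m : ℕ) (v : ℝ × ℝ) : ℝ :=
  hgt f g m v ^ (1 / (12 * m : ℝ))

lemma hgt_nonneg (f g : ℤ[X]) (m : ℕ) (v : ℝ × ℝ) : 0 ≤ hgt f g m v :=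
  le_max_of_le_right (by positivity)

lemma gauge_nonneg (f g : ℤ[X]) (m : ℕ) (v : ℝ × ℝ) : 0 ≤ gauge f g m v :=
  Real.rpow_nonneg (hgt_nonneg f g m v) _

lemma gauge_pow (f g : ℤ[X]) {m : ℕ} (hm : 1 ≤ m) (v : ℝ × ℝ) :
    gauge f g m v ^ (12 * m) = hgt f g m v := by
  have : (12 * m : ℝ) = ((12 * m : ℕ) : ℝ) := by push_cast; ring
  rw [gauge, this, one_div, Real.rpow_inv_natCast_pow (hgt_nonneg f g m v) (by omega)]

lemma hgt_smul (f g : ℤ[X]) (m : ℕ) {t : ℝ} (ht : 0 < t) (v : ℝ × ℝ) :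
    hgt f g m (t • v) = t ^ (12 * m) * hgt f g m v := by
  simp only [hgt, Prod.smul_fst, Prod.smul_snd, smul_eq_mul, form_smul]
  rw [mul_max_of_nonneg _ _ (by positivity), abs_mul, abs_of_pos (by positivity : 0 < t ^ (4 * m))]
  congr 1 <;> ring

lemma continuous_form (p : ℤ[X]) (n : ℕ) : Continuous fun v : ℝ × ℝ => form p n v.1 v.2 := by
  simp only [form_eq_sum]
  fun_prop

lemma continuous_hgt (f g : ℤ[X]) (m : ℕ) : Continuous (hgt f g m) := by
  have := continuous_form f (4 * m)
  have := continuous_form g (6 * m)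
  unfold hgt
  fun_prop

/-- A homogeneous function that is positive away from the origin is bounded below. -/
lemma exists_pos_mul_norm_pow_le {H : ℝ × ℝ → ℝ} {n : ℕ} (hc : Continuous H)
    (hsmul : ∀ t : ℝ, 0 < t → ∀ v, H (t • v) = t ^ n * H v) (hpos : ∀ v, v ≠ 0 → 0 < H v)
    (hn : 1 ≤ n) (h0 : 0 ≤ H 0) : ∃ c, 0 < c ∧ ∀ v, c * ‖v‖ ^ n ≤ H v := by
  obtain ⟨u, hu, hmin⟩ := (isCompact_sphere (0 : ℝ × ℝ) 1).exists_isMinOn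
    ⟨(1, 0), by simp [Prod.norm_def]⟩ hc.continuousOn
  have hu0 : u ≠ 0 := by rintro rfl; simp at hu
  refine ⟨H u, hpos u hu0, fun v => ?_⟩
  by_cases hv : v = 0
  · subst hv; simpa [zero_pow (by omega : n ≠ 0)] using h0
  · have hv0 : 0 < ‖v‖ := norm_pos_iff.2 hv
    have h1 : H u ≤ H (‖v‖⁻¹ • v) := hmin (by
      rw [mem_sphere_zero_iff_norm, norm_smul, norm_inv, norm_norm, inv_mul_cancel₀ hv0.ne'])
    have h2 := hsmul ‖v‖ hv0 (‖v‖⁻¹ • v)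
    rw [smul_smul, mul_inv_cancel₀ hv0.ne', one_smul] at h2
    rw [h2, mul_comm]
    gcongr

lemma hgt_le (f g : ℤ[X]) (m : ℕ) : ∃ K : ℝ, 0 ≤ K ∧ ∀ v, hgt f g m v ≤ K * ‖v‖ ^ (12 * m) := by
  obtain ⟨K₁, h1, hK₁⟩ := abs_form_le f (4 * m)
  obtain ⟨K₂, h2, hK₂⟩ := abs_form_le g (6 * m)
  refine ⟨4 * K₁ ^ 3 + 27 * K₂ ^ 2, by positivity, fun v => max_le ?_ ?_⟩
  · have := hK₁ v
    calc _ ≤ 4 * (K₁ * ‖v‖ ^ (4 * m)) ^ 3 := by gcongr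
      _ = 4 * K₁ ^ 3 * ‖v‖ ^ (12 * m) := by ring
      _ ≤ _ := by gcongr; linarith [sq_nonneg K₂]
  · have := hK₂ v
    calc _ = 27 * |form g (6 * m) v.1 v.2| ^ 2 := by rw [sq_abs]
      _ ≤ 27 * (K₂ * ‖v‖ ^ (6 * m)) ^ 2 := by gcongr
      _ = 27 * K₂ ^ 2 * ‖v‖ ^ (12 * m) := by ring
      _ ≤ _ := by gcongr; linarith [pow_nonneg h1 3]

/-- The increment of `H` is `O(‖w‖ t^(12m-1))` with `t = ‖v‖ + ‖w‖`, again multiplied by `t`. It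
serves to show that the root of `H` is Lipschitz. -/
lemma hgt_add_le (f g : ℤ[X]) (m : ℕ) : ∃ K : ℝ, 0 ≤ K ∧ ∀ v w,
    hgt f g m (v + w) * (‖v‖ + ‖w‖) ≤
      hgt f g m v * (‖v‖ + ‖w‖) + K * ‖w‖ * (‖v‖ + ‖w‖) ^ (12 * m) := by
  obtain ⟨K₁, h1, hK₁⟩ := abs_form_le f (4 * m)
  obtain ⟨K₂, h2, hK₂⟩ := abs_form_le g (6 * m)
  obtain ⟨L₁, h3, hL₁⟩ := abs_form_sub_le f (4 * m)
  obtain ⟨L₂, h4, hL₂⟩ := abs_form_sub_le g (6 * m)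
  refine ⟨12 * K₁ ^ 2 * L₁ + 54 * K₂ * L₂, by positivity, fun v w => ?_⟩
  set t := ‖v‖ + ‖w‖ with ht
  have ht0 : 0 ≤ t := by positivity
  have hvw : ‖v + w‖ ≤ t := norm_add_le v w
  have hv : ‖v‖ ≤ t := by rw [ht]; linarith [norm_nonneg w]
  have e1 := hL₁ (v + w) v t hvw hv
  have e2 := hL₂ (v + w) v t hvw hv
  rw [add_sub_cancel_left] at e1 e2
  rw [hgt, max_mul_of_nonneg _ _ ht0]
  have hbound : ∀ p n K, 0 ≤ K → (∀ v : ℝ × ℝ, |form p n v.1 v.2| ≤ K * ‖v‖ ^ n) →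
      ∀ u : ℝ × ℝ, ‖u‖ ≤ t → |form p n u.1 u.2| ≤ K * t ^ n := fun p n K hK h u hu =>
    (h u).trans (by gcongr)
  refine max_le ?_ ?_
  · set a := form f (4 * m) (v + w).1 (v + w).2
    set b := form f (4 * m) v.1 v.2
    have ha := hbound f _ K₁ h1 hK₁ _ hvw
    have hb := hbound f _ K₁ h1 hK₁ _ hv
    set B := K₁ * t ^ (4 * m)
    have hB : 0 ≤ B := by positivity
    have h5 : |a| ^ 3 - |b| ^ 3 ≤ |a - b| * (3 * B ^ 2) := by
      have e : |a| ^ 3 - |b| ^ 3 = (|a| - |b|) * (|a| ^ 2 + |a| * |b| + |b| ^ 2) := by ring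
      have h6 : |a| ^ 2 + |a| * |b| + |b| ^ 2 ≤ 3 * B ^ 2 := by
        nlinarith [mul_le_mul ha ha (abs_nonneg a) hB, mul_le_mul ha hb (abs_nonneg b) hB,
          mul_le_mul hb hb (abs_nonneg b) hB]
      rw [e]
      exact mul_le_mul (abs_sub_abs_le_abs_sub a b) h6 (by positivity) (abs_nonneg _)
    have h7 : 4 * |b| ^ 3 ≤ hgt f g m v := le_max_left _ _
    calc 4 * |a| ^ 3 * t ≤ 4 * |b| ^ 3 * t + 4 * (|a - b| * t) * (3 * B ^ 2) := by
          nlinarith [mul_le_mul_of_nonneg_right h5 ht0]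
      _ ≤ hgt f g m v * t + 4 * (L₁ * ‖w‖ * t ^ (4 * m)) * (3 * B ^ 2) := by gcongr
      _ = hgt f g m v * t + 12 * K₁ ^ 2 * L₁ * ‖w‖ * t ^ (12 * m) := by simp only [B]; ring
      _ ≤ _ := by gcongr; linarith [mul_nonneg h2 h4]
  · set a := form g (6 * m) (v + w).1 (v + w).2
    set b := form g (6 * m) v.1 v.2
    have ha := hbound g _ K₂ h2 hK₂ _ hvw
    have hb := hbound g _ K₂ h2 hK₂ _ hv
    set B := K₂ * t ^ (6 * m)
    have hB : 0 ≤ B := by positivity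
    have h5 : a ^ 2 - b ^ 2 ≤ |a - b| * (2 * B) := by
      have e : a ^ 2 - b ^ 2 = (a - b) * (a + b) := by ring
      rw [e]
      refine (le_abs_self _).trans ?_
      rw [abs_mul]
      gcongr
      exact (abs_add_le a b).trans (by linarith)
    have h7 : 27 * b ^ 2 ≤ hgt f g m v := le_max_right _ _
    calc 27 * a ^ 2 * t ≤ 27 * b ^ 2 * t + 27 * (|a - b| * t) * (2 * B) := by
          nlinarith [mul_le_mul_of_nonneg_right h5 ht0]
      _ ≤ hgt f g m v * t + 27 * (L₂ * ‖w‖ * t ^ (6 * m)) * (2 * B) := by gcongr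
      _ = hgt f g m v * t + 54 * K₂ * L₂ * ‖w‖ * t ^ (12 * m) := by simp only [B]; ring
      _ ≤ _ := by gcongr; linarith [mul_nonneg (sq_nonneg K₁) h3]

/-- Coercivity is compactness of the unit sphere together with the absence of nontrivial zeros. The
Lipschitz bound is proved on `12m`-th powers, where it follows from `hgt_add_le` and the upper bound
for `H`. -/
theorem FamilyData.exists_isGauge {f g h F G : ℤ[X]} {m r n : ℕ} {R : ℤ}
    (D : FamilyData f g m r h F G n R) : ∃ C, IsGauge (gauge f g m) C := by
  have hm := D.one_le_m
  obtain ⟨c, hc, hlow⟩ := exists_pos_mul_norm_pow_le (continuous_hgt f g m)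
    (fun t ht v => hgt_smul f g m ht v) (fun v hv => by
      rcases D.form_ne_zero v hv with h1 | h1
      · exact lt_max_of_lt_left (by positivity)
      · exact lt_max_of_lt_right (by positivity)) (by omega : 1 ≤ 12 * m) (hgt_nonneg f g m 0)
  obtain ⟨K₀, hK₀, hup⟩ := hgt_le f g m
  obtain ⟨K, hK, hadd⟩ := hgt_add_le f g m
  set N := 12 * m with hN
  have hN1 : 1 ≤ N := by omega
  have hN0 : N ≠ 0 := by omega
  set c' := (1 + c⁻¹) with hc'
  have hc'1 : 1 ≤ c' := by rw [hc']; linarith [inv_pos.2 hc]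
  have hnorm : ∀ v, ‖v‖ ≤ c' * gauge f g m v := by
    intro v
    refine le_of_pow_le_pow_left₀ hN0 (mul_nonneg (by linarith) (gauge_nonneg f g m v)) ?_
    rw [mul_pow, gauge_pow f g hm]
    have h1 : c⁻¹ ≤ c' ^ N := by
      have : c' ≤ c' ^ N := le_self_pow₀ hc'1 hN0
      linarith
    calc ‖v‖ ^ N = c⁻¹ * (c * ‖v‖ ^ N) := by rw [inv_mul_cancel_left₀ hc.ne']
      _ ≤ c' ^ N * hgt f g m v :=
        mul_le_mul h1 (hlow v) (by positivity) (by positivity)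
  -- One summand for each use: coercivity, small `w`, large `w`.
  set C := c' + K * (c' + 1) ^ (N - 1) + (K₀ + 1) * (c' + 1) with hC
  have hC1 : c' ≤ C := by
    have : 0 ≤ K * (c' + 1) ^ (N - 1) := by positivity
    have : 0 ≤ (K₀ + 1) * (c' + 1) := by positivity
    linarith
  have hC2 : K * (c' + 1) ^ (N - 1) ≤ C := by
    have : 0 ≤ (K₀ + 1) * (c' + 1) := by positivity
    linarith
  have hC3 : (K₀ + 1) * (c' + 1) ≤ C := by
    have : 0 ≤ K * (c' + 1) ^ (N - 1) := by positivity
    linarith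
  refine ⟨C, by linarith, fun v => (hnorm v).trans ?_, fun v w => ?_, fun t ht v => ?_⟩
  · exact mul_le_mul_of_nonneg_right hC1 (gauge_nonneg f g m v)
  · set T := gauge f g m v with hT
    have hT0 : 0 ≤ T := gauge_nonneg f g m v
    set e := ‖w‖ with he
    have he0 : 0 ≤ e := norm_nonneg w
    have hC0 : 0 ≤ C := by linarith
    refine le_of_pow_le_pow_left₀ hN0 (by positivity) ?_
    rw [gauge_pow f g hm]
    -- If `‖w‖` is at most `G(v)`, the increment `O(‖w‖ T^(N-1))` is absorbed in `(T + Ce)^N`;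
    -- otherwise `‖v + w‖ = O(‖w‖)` and the crude upper bound for `H` is enough.
    rcases le_or_gt e T with hle | hlt
    · rcases he0.eq_or_lt with h0 | hpos
      · have hw : w = 0 := norm_eq_zero.1 h0.symm
        rw [hw, add_zero, ← h0, mul_zero, add_zero, hT, gauge_pow f g hm]
      · have ht : ‖v‖ + e ≤ (c' + 1) * T := by linarith [hnorm v]
        have ht0 : 0 < ‖v‖ + e := by positivity
        have h1 := hadd v w
        rw [← he, show N = (N - 1) + 1 by omega, pow_succ, ← mul_assoc, ← add_mul] at h1
        have h2 := le_of_mul_le_mul_right h1 ht0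
        rw [show N = (N - 1) + 1 by omega, pow_succ']
        calc _ ≤ hgt f g m v + K * e * (‖v‖ + e) ^ (N - 1) := h2
          _ ≤ T ^ N + K * e * ((c' + 1) * T) ^ (N - 1) := by
            rw [← gauge_pow f g hm v]; gcongr
          _ = (T + K * (c' + 1) ^ (N - 1) * e) * T ^ (N - 1) := by
            rw [show N = (N - 1) + 1 by omega, pow_succ', mul_pow]; simp; ring
          _ ≤ (T + C * e) * (T + C * e) ^ (N - 1) := by
            have : 0 ≤ C * e := by positivity
            gcongr
            linarith
    · calc _ ≤ K₀ * ‖v + w‖ ^ N := hup _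
        _ ≤ (K₀ + 1) ^ N * ((c' + 1) * e) ^ N := by
          have h1 : K₀ ≤ (K₀ + 1) ^ N := by
            have : K₀ + 1 ≤ (K₀ + 1) ^ N := le_self_pow₀ (by linarith) hN0
            linarith
          have h2 : ‖v + w‖ ≤ (c' + 1) * e := by
            have := norm_add_le v w
            have h3 := hnorm v
            have : c' * T ≤ c' * e := by gcongr
            linarith
          gcongr
        _ = ((K₀ + 1) * (c' + 1) * e) ^ N := by rw [← mul_pow, mul_assoc]
        _ ≤ (T + C * e) ^ N := by
          have : (K₀ + 1) * (c' + 1) * e ≤ C * e := by gcongr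
          gcongr
          linarith
  · rw [gauge, hgt_smul f g m ht, Real.mul_rpow (by positivity) (hgt_nonneg f g m v), gauge]
    congr 1
    have : (12 * m : ℝ) = ((12 * m : ℕ) : ℝ) := by push_cast; ring
    rw [this, one_div, Real.pow_rpow_inv_natCast ht.le (by omega)]

end EllFamily

namespace EllFamily
open Finset
open scoped Classical

/-! ### The local conditions -/

/-- `k ^ 4` divides `A (a, b)` and `k ^ 6` divides `B (a, b)`. -/
def LocalCond (f g : ℤ[X]) (m k : ℕ) (a b : ℤ) : Prop :=
  (k : ℤ) ^ 4 ∣ formA f m a b ∧ (k : ℤ) ^ 6 ∣ formB g m a b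

lemma localCond_one (f g : ℤ[X]) (m : ℕ) (a b : ℤ) : LocalCond f g m 1 a b := by
  simp [LocalCond]

lemma localCond_mul (f g : ℤ[X]) (m : ℕ) {k l : ℕ} (h : k.Coprime l) (a b : ℤ) :
    LocalCond f g m (k * l) a b ↔ LocalCond f g m k a b ∧ LocalCond f g m l a b := by
  have hc : IsCoprime (k : ℤ) (l : ℤ) := Nat.isCoprime_iff_coprime.2 h
  have key : ∀ (e : ℕ) (z : ℤ), ((k * l : ℕ) : ℤ) ^ e ∣ z ↔ (k : ℤ) ^ e ∣ z ∧ (l : ℤ) ^ e ∣ z := by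
    intro e z
    rw [Nat.cast_mul, mul_pow]
    exact ⟨fun h => ⟨dvd_of_mul_right_dvd h, dvd_of_mul_left_dvd h⟩,
      fun h => hc.pow.mul_dvd h.1 h.2⟩
  rw [LocalCond, key, key, LocalCond, LocalCond]
  tauto

lemma LocalCond.of_dvd {f g : ℤ[X]} {m k l : ℕ} {a b : ℤ} (h : LocalCond f g m l a b)
    (hk : k ∣ l) : LocalCond f g m k a b :=
  have hk : (k : ℤ) ∣ l := Int.natCast_dvd_natCast.2 hk
  ⟨(pow_dvd_pow_of_dvd hk 4).trans h.1, (pow_dvd_pow_of_dvd hk 6).trans h.2⟩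

namespace FamilyData

variable {f g h F G : ℤ[X]} {m r n : ℕ} {R : ℤ}

lemma form_f_pow {S : Type*} [CommRing S] (D : FamilyData f g m r h F G n R) (a b : S) :
    form f (4 * m) a b ^ 3 = form h h.natDegree a b ^ r * form F n a b := by
  rw [← form_pow D.natDegree_f, D.f_pow, ← form_pow le_rfl,
    ← form_mul (natDegree_pow_le_of_le r le_rfl) D.natDegree_F, D.deg_add]
  congr 1; ring

lemma form_g_pow {S : Type*} [CommRing S] (D : FamilyData f g m r h F G n R) (a b : S) :
    form g (6 * m) a b ^ 2 = form h h.natDegree a b ^ r * form G n a b := by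
  rw [← form_pow D.natDegree_g, D.g_pow, ← form_pow le_rfl,
    ← form_mul (natDegree_pow_le_of_le r le_rfl) D.natDegree_G, D.deg_add]
  congr 1; ring

lemma localCond_iff (D : FamilyData f g m r h F G n R) (k : ℕ) (a b : ℤ) :
    LocalCond f g m k a b ↔ (k : ℤ) ^ 12 ∣ form h h.natDegree a b ^ r * form F n a b ∧
      (k : ℤ) ^ 12 ∣ form h h.natDegree a b ^ r * form G n a b := by
  rw [LocalCond, formA_eq, formB_eq, ← D.form_f_pow, ← D.form_g_pow,
    show (k : ℤ) ^ 12 = ((k : ℤ) ^ 4) ^ 3 by ring, Int.pow_dvd_pow_iff (by norm_num),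
    show ((k : ℤ) ^ 4) ^ 3 = ((k : ℤ) ^ 6) ^ 2 by ring, Int.pow_dvd_pow_iff (by norm_num)]

/-- The resultant eliminates `F` and `G`: at a primitive point they have no common divisor beyond
those of `R`, so the divisibility must come from `h ^ r` up to `R`. -/
lemma pow_dvd_of_localCond (D : FamilyData f g m r h F G n R) {k : ℕ} {a b : ℤ}
    (hab : Int.gcd a b = 1) (hk : LocalCond f g m k a b) :
    (k : ℤ) ^ 12 ∣ form h h.natDegree a b ^ r * R := by
  obtain ⟨h1, h2⟩ := (D.localCond_iff k a b).1 hk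
  rw [D.R_eq]
  exact dvd_mul_resultant D.one_le_n D.natDegree_F D.natDegree_G
    (by rw [hab]; exact isCoprime_one_right) h1 h2

lemma twelve_mul_le (D : FamilyData f g m r h F G n R) (p k : ℕ) : 12 * k ≤ r * nu f g m r p k := by
  have hr : (0 : ℚ) < r := by exact_mod_cast D.one_le_r
  have h1 : (12 * k : ℚ) / r ≤ (nu f g m r p k : ℚ) := by
    have h2 := Int.le_ceil ((12 * k : ℚ) / r)
    have h3 : (⌈(12 * k : ℚ) / r⌉ : ℤ) ≤ (nu f g m r p k : ℤ) := by
      rw [nu]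
      exact (le_max_left _ _).trans (Int.self_le_toNat _)
    exact h2.trans (by exact_mod_cast h3)
  rw [div_le_iff₀ hr, mul_comm (nu f g m r p k : ℚ)] at h1
  exact_mod_cast h1

lemma le_nu_of_pow_dvd (D : FamilyData f g m r h F G n R) {p : ℕ} (hp : p.Prime) (k : ℕ) {l : ℕ}
    (hl : (p : ℤ) ^ l ∣ R) : l ≤ nu f g m r p k := by
  have : Fact p.Prime := ⟨hp⟩
  have h1 : (l : ℤ) ≤ padicValRat p (cofactorResultant f g m) := by
    rw [D.cofactorResultant_eq, padicValRat.of_int]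
    exact_mod_cast (padicValInt_dvd_iff l R).1 hl |>.resolve_left D.R_ne_zero
  rw [nu]
  have := (h1.trans (le_max_right ⌈(12 * k : ℚ) / r⌉ _)).trans (Int.self_le_toNat _)
  exact_mod_cast this

/-- Linearity in `k`, with a constant independent of `p`, makes `psi` polynomially bounded; the
valuation of `R` is crudely replaced by `|R|`. -/
lemma nu_le (D : FamilyData f g m r h F G n R) (p : ℕ) {k : ℕ} (hk : 1 ≤ k) :
    nu f g m r p k ≤ (12 + R.natAbs) * k := by
  rw [nu, Int.toNat_le]
  refine max_le ?_ ?_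
  · rw [Int.ceil_le]
    have hr : (1 : ℚ) ≤ r := by exact_mod_cast D.one_le_r
    rw [div_le_iff₀ (by linarith)]
    have h1 : (12 * k : ℚ) ≤ (12 + R.natAbs) * k := by gcongr; simp
    refine h1.trans ((le_mul_of_one_le_right (by positivity) hr).trans_eq ?_)
    simp [Nat.cast_natAbs]
  · rw [D.cofactorResultant_eq, padicValRat.of_int]
    have h1 : padicValInt p R ≤ R.natAbs :=
      (padicValNat_le_nat_log _).trans (Nat.log_le_self _ _)
    have h2 : R.natAbs ≤ (12 + R.natAbs) * k := by nlinarith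
    exact_mod_cast h1.trans h2

/-- The precision `p^ν` is enough. If `p^ν ∣ h(a, b)`, then `rν ≥ 12k` settles the condition for
both representatives. Otherwise `h(a, b)` has an exact valuation `j < ν`, and `F` and `G` must be
divisible by `p^(12k - rj)`. This power divides `R`, so its exponent is at most `ν` and both
divisibilities can be read modulo `p^ν`. -/
lemma localCond_of_rep_prime_pow (D : FamilyData f g m r h F G n R) {p : ℕ} (hp : p.Prime) {k : ℕ}
    (hk : 1 ≤ k) {α : P1 (p ^ nu f g m r p k)} {a b a' b' : ℤ} (h1 : α.Rep a b) (h2 : α.Rep a' b')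
    (hc : LocalCond f g m (p ^ k) a b) : LocalCond f g m (p ^ k) a' b' := by
  set ν := nu f g m r p k with hν
  have hpz := Nat.prime_iff_prime_int.1 hp
  have hkν := D.twelve_mul_le p k
  rw [← hν] at hkν
  have hν1 : 1 ≤ ν := by
    by_contra! h0
    have : ν = 0 := by omega
    rw [this] at hkν; omega
  obtain ⟨c, hca, hcb⟩ := h1.exists_mul h2
  have hcong : ∀ (P : ℤ[X]) (N i : ℕ), i ≤ ν → (p : ℤ) ^ i ∣ form P N a b → (p : ℤ) ^ i ∣ form P N a' b' := by
    intro P N i hi hd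
    have key : ∀ z w : ℤ, (z : ZMod (p ^ ν)) = (c * w : ℤ) → (z : ZMod (p ^ i)) = (c * w : ℤ) := by
      intro z w hzw
      rw [ZMod.intCast_eq_intCast_iff_dvd_sub] at hzw ⊢
      exact (Int.natCast_dvd_natCast.2 (pow_dvd_pow p hi)).trans hzw
    have := form_dvd_of_congr (M := p ^ i) P N (key _ _ hca) (key _ _ hcb) (by exact_mod_cast hd)
    exact_mod_cast this
  have hcop : IsCoprime (p : ℤ) (Int.gcd a b) := by
    have h3 := h1.isCoprime
    rw [isCoprime_zmod_iff, Nat.cast_pow] at h3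
    exact ((IsCoprime.pow_right_iff hν1).1 h3).symm
  rw [D.localCond_iff] at hc ⊢
  rw [Nat.cast_pow, ← pow_mul] at hc ⊢
  by_cases hA : (p : ℤ) ^ ν ∣ form h h.natDegree a b
  · have h3 : (p : ℤ) ^ (k * 12) ∣ form h h.natDegree a' b' ^ r := by
      have h4 := pow_dvd_pow_of_dvd (hcong _ _ _ le_rfl hA) r
      rw [← pow_mul] at h4
      exact (pow_dvd_pow _ (by linarith)).trans h4
    exact ⟨h3.mul_right _, h3.mul_right _⟩
  · obtain ⟨j, hj1, hj2⟩ : ∃ j, (p : ℤ) ^ j ∣ form h h.natDegree a b ∧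
        ¬ (p : ℤ) ^ (j + 1) ∣ form h h.natDegree a b := by
      by_contra! hall
      have : ∀ j, (p : ℤ) ^ j ∣ form h h.natDegree a b := by
        intro j
        induction j with
        | zero => simp
        | succ j ih => exact hall j ih
      exact hA (this ν)
    have hjν : j < ν := by
      by_contra! hle
      exact hA ((pow_dvd_pow _ hle).trans hj1)
    have hquot : ∀ P : ℤ[X], (p : ℤ) ^ (k * 12) ∣ form h h.natDegree a b ^ r * form P n a b →
        (p : ℤ) ^ (k * 12 - r * j) ∣ form P n a b := by
      intro P hP
      obtain ⟨u, hu⟩ := hj1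
      have hpu : ¬ (p : ℤ) ∣ u := by
        rintro ⟨w, rfl⟩
        exact hj2 ⟨w, by rw [hu, pow_succ]; ring⟩
      by_cases hle : k * 12 ≤ r * j
      · rw [Nat.sub_eq_zero_of_le hle, pow_zero]; exact one_dvd _
      · have e : (p : ℤ) ^ (k * 12) = p ^ (r * j) * p ^ (k * 12 - r * j) := by
          rw [← pow_add]; congr 1; omega
        rw [e, hu, mul_pow, ← pow_mul, mul_comm j r, mul_assoc] at hP
        have hP' := (mul_dvd_mul_iff_left (pow_ne_zero _ hpz.ne_zero)).1 hP
        exact (((Prime.coprime_iff_not_dvd hpz).2 hpu).pow_left.pow_right).dvd_of_dvd_mul_left hP'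
    have hF := hquot F hc.1
    have hG := hquot G hc.2
    have hle : k * 12 - r * j ≤ ν := by
      refine D.le_nu_of_pow_dvd hp k ?_
      have := dvd_mul_resultant (k := (p : ℤ) ^ (k * 12 - r * j)) (t := 1) D.one_le_n D.natDegree_F
        D.natDegree_G hcop.pow_left (by rwa [one_mul]) (by rwa [one_mul])
      rwa [one_mul, ← D.R_eq] at this
    have hh : (p : ℤ) ^ (r * j) ∣ form h h.natDegree a' b' ^ r := by
      have := pow_dvd_pow_of_dvd (hcong _ _ _ hjν.le hj1) r
      rwa [← pow_mul, mul_comm j r] at this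
    have hfin : ∀ z, (p : ℤ) ^ (k * 12 - r * j) ∣ z →
        (p : ℤ) ^ (k * 12) ∣ form h h.natDegree a' b' ^ r * z := by
      intro z hz
      have := mul_dvd_mul hh hz
      rw [← pow_add] at this
      exact (pow_dvd_pow _ (by omega)).trans this
    exact ⟨hfin _ (hcong _ _ _ hle hF), hfin _ (hcong _ _ _ hle hG)⟩

end FamilyData

/-! ### Multiplicativity of the local densities -/

lemma psi_prime_pow (f g : ℤ[X]) (m r : ℕ) {p k : ℕ} (hp : p.Prime) (hk : k ≠ 0) :
    psi f g m r (p ^ k) = p ^ nu f g m r p k := by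
  rw [psi, Nat.primeFactors_prime_pow hk hp, prod_singleton, hp.factorization_pow]
  simp

lemma psi_mul (f g : ℤ[X]) (m r : ℕ) {k l : ℕ} (h : k.Coprime l) :
    psi f g m r (k * l) = psi f g m r k * psi f g m r l := by
  rw [psi, h.primeFactors_mul, prod_union h.disjoint_primeFactors, psi, psi]
  congr 1
  · refine prod_congr rfl fun p hp => ?_
    rw [Nat.factorization_eq_of_coprime_left h (by simpa using hp)]
  · refine prod_congr rfl fun p hp => ?_
    rw [Nat.factorization_eq_of_coprime_right h (by simpa using hp)]

lemma psi_pos (f g : ℤ[X]) (m r k : ℕ) : 0 < psi f g m r k :=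
  prod_pos fun _ hp => pow_pos (Nat.prime_of_mem_primeFactors hp).pos _

lemma psi_coprime (f g : ℤ[X]) (m r : ℕ) {k l : ℕ} (h : k.Coprime l) :
    (psi f g m r k).Coprime l :=
  Nat.Coprime.prod_left fun _ hp => Nat.Coprime.pow_left _
    (h.coprime_dvd_left (Nat.dvd_of_mem_primeFactors hp))

lemma psi_coprime_psi (f g : ℤ[X]) (m r : ℕ) {k l : ℕ} (h : k.Coprime l) :
    (psi f g m r k).Coprime (psi f g m r l) :=
  (psi_coprime f g m r (psi_coprime f g m r h.symm).symm)

/-- The number of points modulo `M` satisfying the local condition. -/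
noncomputable def condCount (f g : ℤ[X]) (m M k : ℕ) : ℕ :=
  Nat.card {P : P1 M // ∃ a b : ℤ, P.Rep a b ∧ LocalCond f g m k a b}

lemma eta_eq (f g : ℤ[X]) (m r k : ℕ) : eta f g m r k = condCount f g m (psi f g m r k) k := rfl

/-- The local condition at `k` only depends on the point modulo `M`. -/
def IsPeriodicCond (f g : ℤ[X]) (m M k : ℕ) : Prop :=
  ∀ (α : P1 M) (a b a' b' : ℤ), α.Rep a b → α.Rep a' b' → LocalCond f g m k a b →
    LocalCond f g m k a' b'

lemma IsPeriodicCond.mul {f g : ℤ[X]} {m M N k l : ℕ} (h : k.Coprime l)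
    (hM : IsPeriodicCond f g m M k) (hN : IsPeriodicCond f g m N l) :
    IsPeriodicCond f g m (M * N) (k * l) := by
  intro α a b a' b' h1 h2 hc
  rw [localCond_mul f g m h] at hc ⊢
  exact ⟨hM _ _ _ _ _ (h1.red (dvd_mul_right M N)) (h2.red (dvd_mul_right M N)) hc.1,
    hN _ _ _ _ _ (h1.red (dvd_mul_left N M)) (h2.red (dvd_mul_left N M)) hc.2⟩

lemma IsPeriodicCond.exists_iff {f g : ℤ[X]} {m M k : ℕ} (h : IsPeriodicCond f g m M k)
    {α : P1 M} {a b : ℤ} (hα : α.Rep a b) :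
    (∃ a b : ℤ, α.Rep a b ∧ LocalCond f g m k a b) ↔ LocalCond f g m k a b :=
  ⟨fun ⟨_, _, h1, h2⟩ => h _ _ _ _ _ h1 hα h2, fun hc => ⟨a, b, hα, hc⟩⟩

lemma condCount_mul {f g : ℤ[X]} {m M N k l : ℕ} (h : k.Coprime l) (hMN : M.Coprime N)
    (hM : IsPeriodicCond f g m M k) (hN : IsPeriodicCond f g m N l) :
    condCount f g m (M * N) (k * l) = condCount f g m M k * condCount f g m N l := by
  refine P1.card_subtype_mul hMN _ _ _ fun α => ?_
  obtain ⟨a, b, hα⟩ := α.exists_rep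
  rw [(hM.mul h hN).exists_iff hα, hM.exists_iff (hα.red _), hN.exists_iff (hα.red _),
    localCond_mul f g m h]

namespace FamilyData

variable {f g h F G : ℤ[X]} {m r n : ℕ} {R : ℤ}

lemma isPeriodicCond (D : FamilyData f g m r h F G n R) {k : ℕ} (hk : 1 ≤ k) :
    IsPeriodicCond f g m (psi f g m r k) k := by
  induction k using Nat.recOnPosPrimePosCoprime with
  | prime_pow p k hp hk0 =>
    rw [psi_prime_pow f g m r hp hk0.ne']
    exact fun α a b a' b' h1 h2 hc => D.localCond_of_rep_prime_pow hp hk0 h1 h2 hc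
  | zero => omega
  | one => exact fun _ _ _ _ _ _ _ _ => localCond_one _ _ _ _ _
  | coprime a b ha hb hab iha ihb =>
    rw [psi_mul f g m r hab]
    exact (iha (by omega)).mul hab (ihb (by omega))

lemma psi_le (D : FamilyData f g m r h F G n R) {k : ℕ} (hk : 1 ≤ k) :
    psi f g m r k ≤ k ^ (12 + R.natAbs) := by
  conv_rhs => rw [← Nat.prod_factorization_pow_eq_self (by omega : k ≠ 0)]
  rw [Finsupp.prod, Nat.support_factorization, psi, ← prod_pow]
  refine prod_le_prod' fun p hp => ?_
  have hp' := Nat.prime_of_mem_primeFactors hp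
  rw [← pow_mul, mul_comm]
  refine Nat.pow_le_pow_right hp'.pos (D.nu_le p ?_)
  exact hp'.factorization_pos_of_dvd (by omega) (Nat.dvd_of_mem_primeFactors hp)

lemma rho_mul (D : FamilyData f g m r h F G n R) {k l : ℕ} (hk : 1 ≤ k) (hl : 1 ≤ l)
    (hkl : k.Coprime l) : rho f g m r (k * l) = rho f g m r k * rho f g m r l := by
  have hc := psi_coprime_psi f g m r hkl
  rw [rho, rho, rho, eta_eq, eta_eq, eta_eq, psi_mul f g m r hkl,
    condCount_mul hkl hc (D.isPeriodicCond hk) (D.isPeriodicCond hl), P1.card_mul hc]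
  push_cast
  ring

lemma rho_one : rho f g m r 1 = 1 := by
  have h1 : eta f g m r 1 = Nat.card (P1 (psi f g m r 1)) := by
    refine Nat.card_congr (Equiv.subtypeUnivEquiv fun α => ?_)
    obtain ⟨a, b, hα⟩ := α.exists_rep
    exact ⟨a, b, hα, by simp, by simp⟩
  have : NeZero (psi f g m r 1) := ⟨(psi_pos f g m r 1).ne'⟩
  rw [rho, h1, div_self]
  exact_mod_cast (P1.card_pos _).ne'

lemma rho_nonneg (k : ℕ) : 0 ≤ rho f g m r k := by unfold rho; positivity

/-- The number of points modulo `q ψ(k)` over `α` with the local condition at `k`. -/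
lemma card_condition_over (D : FamilyData f g m r h F G n R) {q k : ℕ} (hk : 1 ≤ k)
    (hqk : q.Coprime k) (α : P1 q) :
    Nat.card {β : P1 (q * psi f g m r k) // P1.red (dvd_mul_right _ _) β = α ∧
      ∃ a b : ℤ, β.Rep a b ∧ LocalCond f g m k a b} = eta f g m r k := by
  have hc : q.Coprime (psi f g m r k) := (psi_coprime f g m r hqk.symm).symm
  rw [P1.card_subtype_mul hc _ (fun x => x = α)
    (fun x => ∃ a b : ℤ, x.Rep a b ∧ LocalCond f g m k a b), eta_eq, condCount]
  · simp
  · intro β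
    obtain ⟨a, b, hβ⟩ := β.exists_rep
    have hper : IsPeriodicCond f g m (q * psi f g m r k) k := by
      intro γ a b a' b' h1 h2 hc
      exact D.isPeriodicCond hk _ _ _ _ _ (h1.red (dvd_mul_left _ q)) (h2.red (dvd_mul_left _ q)) hc
    rw [hper.exists_iff hβ, (D.isPeriodicCond hk).exists_iff (hβ.red _)]

end FamilyData
end EllFamily

namespace EllFamily
open Finset
open scoped Classical

/-! ### Upper bounds for the counts with a local condition -/

lemma squarefree_mirror {K : Type*} [Field K] {p : K[X]} (hp : Squarefree p) :
    Squarefree p.mirror := by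
  rintro q ⟨c, hc⟩
  have h1 : p = q.mirror * q.mirror * c.mirror := by
    rw [← mirror_mirror p, hc, mirror_mul_of_domain, mirror_mul_of_domain]
  have h2 := hp q.mirror ⟨_, h1⟩
  have hq0 : q ≠ 0 := by
    rintro rfl
    rw [mirror_zero] at h2
    exact not_isUnit_zero h2
  rw [Polynomial.isUnit_iff_degree_eq_zero] at h2 ⊢
  rw [degree_eq_natDegree (mt mirror_eq_zero.1 hq0), mirror_natDegree] at h2
  rwa [degree_eq_natDegree hq0]

/-- The points modulo `M` at which the form attached to `p` vanishes modulo `M`. -/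
def ZeroPoint (p : ℤ[X]) (M : ℕ) (β : P1 M) : Prop :=
  ∃ a b : ℤ, β.Rep a b ∧ (M : ℤ) ∣ form p p.natDegree a b

lemma zeroPoint_iff {p : ℤ[X]} {M : ℕ} {β : P1 M} {a b : ℤ} (hβ : β.Rep a b) :
    ZeroPoint p M β ↔ (M : ℤ) ∣ form p p.natDegree a b := by
  refine ⟨fun ⟨a', b', h1, h2⟩ => ?_, fun h => ⟨a, b, hβ, h⟩⟩
  obtain ⟨c, hc1, hc2⟩ := h1.exists_mul hβ
  exact form_dvd_of_congr p _ hc1 hc2 h2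

/-- Modulo a prime power one coordinate of a point is a unit, so the point lies in a chart `[t : 1]`
or `[1 : t]`; there it is a root of `p` or of its reversal, both squarefree. -/
lemma exists_card_zeroPoint_prime_pow_le {p : ℤ[X]} (hp : Squarefree (p.map (Int.castRingHom ℚ)))
    (h0 : p.coeff 0 ≠ 0) :
    ∃ B : ℕ, ∀ l : ℕ, l.Prime → ∀ k, Nat.card {β // ZeroPoint p (l ^ k) β} ≤ B := by
  have hinj : Function.Injective (Int.castRingHom ℚ) := Int.cast_injective
  obtain ⟨B₁, hB₁⟩ := exists_ncard_rootsMod_le hp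
  -- As `p(0) ≠ 0`, the reversal is the mirror, which is multiplicative and involutive and so
  -- preserves squarefreeness.
  have hrev : Squarefree ((p.reflect p.natDegree).map (Int.castRingHom ℚ)) := by
    have h1 := squarefree_mirror hp
    have h2 : (p.map (Int.castRingHom ℚ)).natTrailingDegree = 0 := by
      refine natTrailingDegree_eq_zero_of_constantCoeff_ne_zero ?_
      rw [constantCoeff_apply, coeff_map]
      simpa using h0
    rwa [mirror, h2, pow_zero, mul_one, reverse, natDegree_map_eq_of_injective hinj,
      reflect_map] at h1
  obtain ⟨B₂, hB₂⟩ := exists_ncard_rootsMod_le hrev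
  refine ⟨B₁ + B₂, fun l hl k => ?_⟩
  have : NeZero (l ^ k) := ⟨(pow_pos hl.pos k).ne'⟩
  have hc1 : ∀ t : ZMod (l ^ k), IsCoprime t (1 : ZMod (l ^ k)) := fun t => isCoprime_one_right
  have hc2 : ∀ t : ZMod (l ^ k), IsCoprime (1 : ZMod (l ^ k)) t := fun t => isCoprime_one_left
  let i₁ : ZMod (l ^ k) → P1 (l ^ k) := fun t => Quotient.mk (p1Setoid _) ⟨(t, 1), hc1 t⟩
  let i₂ : ZMod (l ^ k) → P1 (l ^ k) := fun t => Quotient.mk (p1Setoid _) ⟨(1, t), hc2 t⟩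
  have hi₁ : ∀ t : ℤ, (i₁ t).Rep t 1 := fun t =>
    ⟨by simpa using hc1 t, by simp only [i₁]; congr 2; simp⟩
  have hi₂ : ∀ t : ℤ, (i₂ t).Rep 1 t := fun t =>
    ⟨by simpa using hc2 t, by simp only [i₂]; congr 2; simp⟩
  have hsub : {β | ZeroPoint p (l ^ k) β} ⊆ i₁ '' rootsMod p (l ^ k) ∪
      i₂ '' rootsMod (p.reflect p.natDegree) (l ^ k) := by
    intro β hβ
    obtain ⟨a, b, hr⟩ := β.exists_rep
    have hz := (zeroPoint_iff hr).1 hβ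
    have hcop := hr.isCoprime
    rw [isCoprime_zmod_iff] at hcop
    have hpz := Nat.prime_iff_prime_int.1 hl
    have hone : ∀ x : ℤ, IsCoprime x ((l ^ k : ℕ) : ℤ) → ∃ y : ℤ, ((l ^ k : ℕ) : ℤ) ∣ y * x - 1 := by
      rintro x ⟨u, v, huv⟩
      exact ⟨u, -v, by linear_combination huv⟩
    have hdich : IsCoprime b ((l ^ k : ℕ) : ℤ) ∨ IsCoprime a ((l ^ k : ℕ) : ℤ) := by
      rcases Nat.eq_zero_or_pos k with rfl | hk
      · left; simpa using isCoprime_one_right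
      rw [Nat.cast_pow, IsCoprime.pow_right_iff hk] at hcop ⊢
      rw [IsCoprime.pow_right_iff hk]
      rw [isCoprime_comm (x := b), isCoprime_comm (x := a), Prime.coprime_iff_not_dvd hpz,
        Prime.coprime_iff_not_dvd hpz]
      by_contra! hab
      exact (Prime.coprime_iff_not_dvd hpz).1 hcop.symm (Int.dvd_coe_gcd hab.2 hab.1)
    rcases hdich with hb | ha
    · left
      obtain ⟨y, hy⟩ := hone b hb
      have hrep : β.Rep (y * a) 1 := by
        refine hr.iff.2 ⟨by simpa using hc1 _, ?_⟩
        obtain ⟨w, hw⟩ := hy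
        exact ⟨w * a, by linear_combination a * hw⟩
      refine ⟨((y * a : ℤ) : ZMod (l ^ k)), ?_, (hi₁ _).eq hrep⟩
      rw [intCast_mem_rootsMod]
      have := (zeroPoint_iff hrep).1 hβ
      rw [form_right_one le_rfl] at this
      simpa using this
    · right
      obtain ⟨y, hy⟩ := hone a ha
      have hrep : β.Rep 1 (y * b) := by
        refine hr.iff.2 ⟨by simpa using hc2 _, ?_⟩
        obtain ⟨w, hw⟩ := hy
        exact ⟨-(w * b), by linear_combination (-b) * hw⟩
      refine ⟨((y * b : ℤ) : ZMod (l ^ k)), ?_, (hi₂ _).eq hrep⟩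
      rw [intCast_mem_rootsMod]
      have := (zeroPoint_iff hrep).1 hβ
      rw [form_left_one le_rfl] at this
      simpa using this
  calc Nat.card {β // ZeroPoint p (l ^ k) β} = {β | ZeroPoint p (l ^ k) β}.ncard := rfl
    _ ≤ _ := Set.ncard_le_ncard hsub (Set.toFinite _)
    _ ≤ _ := Set.ncard_union_le _ _
    _ ≤ B₁ + B₂ := by
      gcongr
      · exact (Set.ncard_image_le (Set.toFinite _)).trans (hB₁ l hl k)
      · exact (Set.ncard_image_le (Set.toFinite _)).trans (hB₂ l hl k)

lemma card_zeroPoint_le {p : ℤ[X]} {B : ℕ}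
    (hB : ∀ l : ℕ, l.Prime → ∀ k, Nat.card {β // ZeroPoint p (l ^ k) β} ≤ B) {M : ℕ} (hM : 1 ≤ M) :
    Nat.card {β // ZeroPoint p M β} ≤ B ^ #M.primeFactors := by
  induction M using Nat.recOnPosPrimePosCoprime with
  | prime_pow l k hl hk0 =>
    rw [Nat.primeFactors_prime_pow hk0.ne' hl, card_singleton, pow_one]
    exact hB l hl k
  | zero => omega
  | one =>
    rw [Nat.primeFactors_one, card_empty, pow_zero]
    have : Subsingleton (P1 1) := ⟨fun α β => by
      obtain ⟨a, b, h⟩ := α.exists_rep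
      obtain ⟨a', b', h'⟩ := β.exists_rep
      exact h.eq (h'.iff.2 ⟨h.isCoprime, by simp⟩)⟩
    have h1 := Nat.card_le_card_of_injective (Subtype.val : {β // ZeroPoint p 1 β} → P1 1)
      Subtype.val_injective
    exact h1.trans (P1.card_le 1)
  | coprime a b ha hb hab iha ihb =>
    rw [hab.primeFactors_mul, card_union_of_disjoint hab.disjoint_primeFactors, pow_add,
      P1.card_subtype_mul hab _ (ZeroPoint p a) (ZeroPoint p b)]
    · exact Nat.mul_le_mul (iha (by omega)) (ihb (by omega))
    · intro α
      obtain ⟨x, y, hα⟩ := α.exists_rep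
      rw [zeroPoint_iff hα, zeroPoint_iff (hα.red _), zeroPoint_iff (hα.red _), Nat.cast_mul]
      exact ⟨fun h => ⟨dvd_of_mul_right_dvd h, dvd_of_mul_left_dvd h⟩,
        fun h => (Nat.isCoprime_iff_coprime.2 hab).mul_dvd h.1 h.2⟩

/-- The divisibility `k ^ 12 ∣ z ^ r * R` is divisibility of `z` by a number of size about
`k ^ (12 / r)`. -/
lemma exists_root_modulus {r : ℕ} (hr : 1 ≤ r) {R : ℤ} {k : ℕ} (hk : 1 ≤ k) :
    ∃ E : ℕ, 1 ≤ E ∧ E ∣ k ^ 12 ∧ (k : ℤ) ^ 12 ∣ (E : ℤ) ^ r * R ∧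
      ∀ z : ℤ, (k : ℤ) ^ 12 ∣ z ^ r * R → (E : ℤ) ∣ z := by
  induction k using Nat.recOnPosPrimePosCoprime with
  | prime_pow p k hp hk0 =>
    have hpz := Nat.prime_iff_prime_int.1 hp
    -- The least such exponent `e` gives the local part `p^e` of `E`: the condition on `z` depends
    -- only on the power of `p` in `z`.
    have hex : ∃ e, ((p ^ k : ℕ) : ℤ) ^ 12 ∣ ((p : ℤ) ^ e) ^ r * R := by
      refine ⟨k * 12, ?_⟩
      rw [Nat.cast_pow, ← pow_mul, ← pow_mul]
      exact (pow_dvd_pow _ (Nat.le_mul_of_pos_right _ hr)).mul_right _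
    refine ⟨p ^ Nat.find hex, Nat.one_le_pow _ _ hp.pos, ?_, ?_, fun z hz => ?_⟩
    · rw [← pow_mul]
      refine pow_dvd_pow _ (Nat.find_min' hex ?_)
      rw [Nat.cast_pow, ← pow_mul, ← pow_mul]
      exact (pow_dvd_pow _ (Nat.le_mul_of_pos_right _ hr)).mul_right _
    · have := Nat.find_spec hex
      generalize Nat.find hex = e at this ⊢
      rwa [Nat.cast_pow p e]
    · by_cases hz0 : z = 0
      · rw [hz0]; exact dvd_zero _
      obtain ⟨u, hj, hu⟩ := (Int.finiteMultiplicity_iff.2 ⟨by simpa using hp.one_lt.ne', hz0⟩ :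
        FiniteMultiplicity (p : ℤ) z).exists_eq_pow_mul_and_not_dvd
      generalize multiplicity (p : ℤ) z = j at hj
      rw [Nat.cast_pow]
      rw [hj, mul_pow, mul_right_comm] at hz
      have h3 : IsCoprime (((p ^ k : ℕ) : ℤ) ^ 12) (u ^ r) := by
        rw [Nat.cast_pow, ← pow_mul]
        exact ((Prime.coprime_iff_not_dvd hpz).2 hu).pow
      have h4 := Nat.find_min' hex (h3.dvd_of_dvd_mul_right hz)
      rw [hj]
      exact (pow_dvd_pow _ h4).mul_right _
  | zero => omega
  | one => exact ⟨1, le_rfl, by simp, by simp, by simp⟩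
  | coprime a b ha hb hab iha ihb =>
    obtain ⟨E₁, h1, h2, h3, h4⟩ := iha (by omega)
    obtain ⟨E₂, h1', h2', h3', h4'⟩ := ihb (by omega)
    have hE : IsCoprime (E₁ : ℤ) (E₂ : ℤ) := Nat.isCoprime_iff_coprime.2
      ((hab.pow 12 12).coprime_dvd_left h2 |>.coprime_dvd_right h2')
    have hc : IsCoprime ((a : ℤ) ^ 12) ((b : ℤ) ^ 12) := (Nat.isCoprime_iff_coprime.2 hab).pow
    refine ⟨E₁ * E₂, Nat.mul_pos h1 h1', ?_, ?_, fun z hz => ?_⟩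
    · rw [mul_pow]; exact mul_dvd_mul h2 h2'
    · push_cast
      rw [mul_pow, mul_pow]
      refine hc.mul_dvd (h3.trans ?_) (h3'.trans ?_)
      · exact ⟨(E₂ : ℤ) ^ r, by ring⟩
      · exact ⟨(E₁ : ℤ) ^ r, by ring⟩
    · push_cast at hz ⊢
      rw [mul_pow] at hz
      exact hE.mul_dvd (h4 z (dvd_of_mul_right_dvd hz)) (h4' z (dvd_of_mul_left_dvd hz))

/-- All primes beyond some `p₀` satisfy `B ≤ p^η`; the fewer than `p₀ + 1` remaining ones cost a
bounded factor. So `B^ω(k)` is `O(k^η)`. -/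
lemma exists_pow_card_primeFactors_le (B : ℕ) {η : ℝ} (hη : 0 < η) :
    ∃ K : ℝ, 0 < K ∧ ∀ k : ℕ, 1 ≤ k → (B : ℝ) ^ #k.primeFactors ≤ K * (k : ℝ) ^ η := by
  obtain ⟨p₀, hp₀⟩ : ∃ p₀ : ℕ, ∀ p : ℕ, p₀ ≤ p → (B : ℝ) ≤ (p : ℝ) ^ η := by
    have := (tendsto_rpow_atTop hη).comp tendsto_natCast_atTop_atTop
    exact Filter.eventually_atTop.1 (this.eventually_ge_atTop (B : ℝ))
  have hB1 : (1 : ℝ) ≤ (B : ℝ) + 1 := by linarith [(Nat.cast_nonneg B : (0 : ℝ) ≤ B)]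
  refine ⟨((B : ℝ) + 1) ^ p₀, by positivity, fun k hk => ?_⟩
  have h1 : ∀ p ∈ k.primeFactors, (B : ℝ) ≤ (if p < p₀ then (B : ℝ) + 1 else 1) * (p : ℝ) ^ η := by
    intro p hp
    have hp1 : (1 : ℝ) ≤ p := by exact_mod_cast (Nat.prime_of_mem_primeFactors hp).one_le
    have hpη : 1 ≤ (p : ℝ) ^ η := Real.one_le_rpow hp1 hη.le
    split_ifs with hlt
    · nlinarith
    · rw [one_mul]; exact hp₀ p (not_lt.1 hlt)
  calc (B : ℝ) ^ #k.primeFactors = ∏ p ∈ k.primeFactors, (B : ℝ) := by rw [prod_const]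
    _ ≤ ∏ p ∈ k.primeFactors, (if p < p₀ then (B : ℝ) + 1 else 1) * (p : ℝ) ^ η :=
      prod_le_prod (fun _ _ => Nat.cast_nonneg _) h1
    _ = (∏ p ∈ k.primeFactors, if p < p₀ then (B : ℝ) + 1 else 1) *
        ∏ p ∈ k.primeFactors, (p : ℝ) ^ η := prod_mul_distrib
    _ ≤ ((B : ℝ) + 1) ^ p₀ * (k : ℝ) ^ η := by
      refine mul_le_mul ?_ ?_ (prod_nonneg fun _ _ => by positivity) (by positivity)
      · rw [← prod_filter, prod_const]
        refine pow_le_pow_right₀ hB1 ?_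
        calc _ ≤ #(range p₀) := card_le_card fun p hp => mem_range.2 (mem_filter.1 hp).2
          _ = p₀ := card_range _
      · rw [Real.finsetProd_rpow _ _ (fun _ _ => Nat.cast_nonneg _)]
        refine Real.rpow_le_rpow (by positivity) ?_ hη.le
        rw [← Nat.cast_prod]
        exact_mod_cast Nat.le_of_dvd hk (Nat.prod_primeFactors_dvd k)

namespace FamilyData

variable {f g h F G : ℤ[X]} {m r n : ℕ} {R : ℤ} {C : ℝ}

/-- The primitive points of gauge at most `T` over `α` with the local condition at `k`. -/
noncomputable def condPts (hG : IsGauge (gauge f g m) C) (T : ℝ) {q : ℕ} (α : P1 q) (k : ℕ) :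
    Finset (ℤ × ℤ) :=
  {w ∈ hG.pts T | α.Rep w.1 w.2 ∧ Int.gcd w.1 w.2 = 1 ∧ LocalCond f g m k w.1 w.2}

/-- The points lie over the zeros of `h` modulo some `E` with `|R| E ≥ k^(12/r)`, of which there are
`O(k^η)`. Over each zero the determinants are divisible by `E`, and by `q` because all points lie
over `α`. The factor `1/q` gained here is what later makes the error uniform in `q`. -/
theorem exists_card_condPts_le (D : FamilyData f g m r h F G n R)
    (hG : IsGauge (gauge f g m) C) {η : ℝ} (hη : 0 < η) :
    ∃ K : ℝ, 0 < K ∧ ∀ q : ℕ, 1 ≤ q → ∀ α : P1 q, ∀ k : ℕ, 1 ≤ k → q.Coprime k → ∀ T : ℝ,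
      (#(condPts hG T α k) : ℝ) ≤ K * (k : ℝ) ^ η * (T ^ 2 / (q * (k : ℝ) ^ (12 / r : ℝ)) + 1) := by
  have hh0 : h.coeff 0 ≠ 0 := by
    intro h0
    refine D.form_h_ne_zero (0, 1) (by simp) ?_
    rw [form_right_one le_rfl]
    rw [← coeff_zero_eq_aeval_zero', h0, map_zero]
  obtain ⟨B₀, hB₀⟩ := exists_card_zeroPoint_prime_pow_le D.squarefree_h hh0
  -- Adding one ensures `B ≥ 1`, so that `B ^ ω` is monotone in the exponent.
  set B := B₀ + 1 with hBdef
  have hB : ∀ l : ℕ, l.Prime → ∀ k, Nat.card {β // ZeroPoint h (l ^ k) β} ≤ B :=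
    fun l hl k => (hB₀ l hl k).trans (Nat.le_succ _)
  obtain ⟨K, hK, hKω⟩ := exists_pow_card_primeFactors_le B hη
  have hR1 : (1 : ℝ) ≤ |(R : ℝ)| := by
    exact_mod_cast Int.one_le_abs D.R_ne_zero
  have hC0 := hG.pos
  have hC1 := hG.one_le
  refine ⟨K * (12 * (C ^ 2 * |(R : ℝ)|)), by positivity, fun q hq α k hk hqk T => ?_⟩
  have hq0 : (0 : ℝ) < q := by exact_mod_cast hq
  have hk0 : (0 : ℝ) < k := by exact_mod_cast hk
  obtain ⟨E, hE1, hEk, hER, hEz⟩ := exists_root_modulus D.one_le_r (R := R) hk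
  have hE0 : (0 : ℝ) < E := by exact_mod_cast hE1
  have : NeZero E := ⟨by omega⟩
  have : Fintype {β // ZeroPoint h E β} := Fintype.ofFinite _
  have hqE : q.Coprime E := (hqk.pow_right 12).coprime_dvd_right hEk
  have hEsize : (k : ℝ) ^ (12 / r : ℝ) ≤ |(R : ℝ)| * E := by
    have hr0 : (0 : ℝ) < r := by exact_mod_cast D.one_le_r
    have h1 : (k : ℤ) ^ 12 ≤ (E : ℤ) ^ r * |R| := by
      refine Int.le_of_dvd (mul_pos (pow_pos (by exact_mod_cast hE1) r) (abs_pos.2 D.R_ne_zero)) ?_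
      rw [← dvd_abs, abs_mul, abs_pow, Nat.abs_cast] at hER
      exact hER
    have h2 : (k : ℝ) ^ 12 ≤ (|(R : ℝ)| * E) ^ r := by
      have h3 : (k : ℝ) ^ 12 ≤ (E : ℝ) ^ r * |(R : ℝ)| := by exact_mod_cast h1
      refine h3.trans ?_
      rw [mul_pow, mul_comm]
      have := le_self_pow₀ hR1 (by have := D.one_le_r; omega : r ≠ 0)
      gcongr
    have h4 := Real.rpow_le_rpow (by positivity) h2 (by positivity : (0 : ℝ) ≤ 1 / r)
    rw [one_div, Real.pow_rpow_inv_natCast (by positivity) (by have := D.one_le_r; omega)] at h4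
    rw [← Real.rpow_natCast, ← Real.rpow_mul hk0.le] at h4
    simpa [div_eq_mul_inv] using h4
  set S := condPts hG T α k with hS
  have hmem : ∀ w ∈ S, w ∈ hG.pts T ∧ α.Rep w.1 w.2 ∧ Int.gcd w.1 w.2 = 1 ∧
      LocalCond f g m k w.1 w.2 := fun w hw => mem_filter.1 hw
  have hcover : S ⊆ (univ : Finset {β // ZeroPoint h E β}).biUnion
      fun β => {w ∈ S | β.1.Rep w.1 w.2} := by
    intro w hw
    obtain ⟨_, _, h2, h3⟩ := hmem w hw
    obtain ⟨β, hβ⟩ := P1.exists_of_isCoprime (isCoprime_zmod_of_gcd_eq_one E h2)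
    have hz : ZeroPoint h E β := ⟨_, _, hβ, hEz _ (D.pow_dvd_of_localCond h2 h3)⟩
    exact mem_biUnion.2 ⟨⟨β, hz⟩, mem_univ _, mem_filter.2 ⟨hw, hβ⟩⟩
  have hfib : ∀ β : {β // ZeroPoint h E β}, (#{w ∈ S | β.1.Rep w.1 w.2} : ℝ) ≤
      12 * ((C * T) ^ 2 / ((q * E : ℕ) : ℝ) + 1) := by
    intro β
    refine card_le_of_dvd_det (Nat.mul_pos hq hE1) ?_ ?_ ?_
    · exact fun w hw => (hmem w (mem_filter.1 hw).1).2.2.1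
    · exact fun w hw => hG.abs_le_of_mem_pts (hmem w (mem_filter.1 hw).1).1
    · intro w hw w' hw'
      obtain ⟨h1, h2⟩ := mem_filter.1 hw
      obtain ⟨h1', h2'⟩ := mem_filter.1 hw'
      rw [Nat.cast_mul]
      exact (Nat.isCoprime_iff_coprime.2 hqE).mul_dvd
        ((hmem w' h1').2.1.dvd (hmem w h1).2.1) (h2'.dvd h2)
  have hcard : (Fintype.card {β // ZeroPoint h E β} : ℝ) ≤ K * (k : ℝ) ^ η := by
    refine le_trans ?_ (hKω k hk)
    have h1 := card_zeroPoint_le hB hE1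
    rw [Nat.card_eq_fintype_card] at h1
    have h2 : #E.primeFactors ≤ #k.primeFactors := by
      refine card_le_card ?_
      have := Nat.primeFactors_mono hEk (by positivity)
      rwa [Nat.primeFactors_pow _ (by norm_num)] at this
    have h3 : B ^ #E.primeFactors ≤ B ^ #k.primeFactors := Nat.pow_le_pow_right (by omega) h2
    exact_mod_cast h1.trans h3
  calc (#S : ℝ) ≤ ∑ β : {β // ZeroPoint h E β}, (#{w ∈ S | β.1.Rep w.1 w.2} : ℝ) := by
        exact_mod_cast (card_le_card hcover).trans card_biUnion_le
    _ ≤ ∑ β : {β // ZeroPoint h E β}, 12 * ((C * T) ^ 2 / ((q * E : ℕ) : ℝ) + 1) :=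
        sum_le_sum fun β _ => hfib β
    _ = Fintype.card {β // ZeroPoint h E β} * (12 * ((C * T) ^ 2 / ((q * E : ℕ) : ℝ) + 1)) := by
        rw [sum_const, card_univ, nsmul_eq_mul]
    _ ≤ K * (k : ℝ) ^ η * (12 * (C ^ 2 * |(R : ℝ)| * (T ^ 2 / (q * (k : ℝ) ^ (12 / r : ℝ))) +
        C ^ 2 * |(R : ℝ)|)) := by
        gcongr
        · rw [mul_pow, mul_div_assoc, mul_assoc, ← mul_div_assoc |(R : ℝ)|]
          refine mul_le_mul_of_nonneg_left ?_ (by positivity)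
          push_cast
          rw [div_le_div_iff₀ (by positivity) (by positivity)]
          calc T ^ 2 * (q * (k : ℝ) ^ (12 / r : ℝ)) ≤ T ^ 2 * (q * (|(R : ℝ)| * E)) := by gcongr
            _ = _ := by ring
        · exact one_le_mul_of_one_le_of_one_le (one_le_pow₀ hC1) hR1
    _ = _ := by ring

end FamilyData
end EllFamily

namespace EllFamily
open Finset
open scoped Classical

/-! ### Asymptotics of the counts with a local condition -/

lemma le_of_forall_mul_sq_le {a b c : ℝ}
    (h : ∀ T : ℝ, 1 ≤ T → a * T ^ 2 ≤ b * T ^ 2 + c * (T * √T)) : a ≤ b := by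
  by_contra! hab
  obtain ⟨N, hN⟩ := exists_nat_gt (c / (a - b))
  rw [div_lt_iff₀ (by linarith)] at hN
  have hN0 : (0 : ℝ) ≤ N := Nat.cast_nonneg N
  have h1 := h ((N + 1 : ℝ) ^ 2) (by nlinarith)
  rw [Real.sqrt_sq (by positivity)] at h1
  have h2 : 0 < (N + 1 : ℝ) ^ 3 := by positivity
  have h3 : (a - b) * (N + 1) * (N + 1 : ℝ) ^ 3 ≤ c * (N + 1 : ℝ) ^ 3 := by nlinarith
  have h4 := le_of_mul_le_mul_right h3 h2
  nlinarith

namespace FamilyData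

variable {f g h F G : ℤ[X]} {m r n : ℕ} {R : ℤ} {C : ℝ}

/-- The condition at `k` together with the class `α` selects `eta` classes modulo `M = qψ(k)`, and
each is counted asymptotically. With at most `M²` classes and an error `O(M T√T)` for each, the loss
is polynomial in `q` and `k`. -/
theorem exists_abs_card_condPts_sub_le (D : FamilyData f g m r h F G n R)
    (hG : IsGauge (gauge f g m) C) :
    ∃ K : ℝ, 0 ≤ K ∧ ∀ q : ℕ, 1 ≤ q → ∀ α : P1 q, ∀ k : ℕ, 1 ≤ k → q.Coprime k → ∀ T : ℝ, 1 ≤ T →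
      |(#(condPts hG T α k) : ℝ) -
        IsGauge.density (gauge f g m) / Nat.card (P1 q) * rho f g m r k * T ^ 2| ≤
      K * ((q : ℝ) * (k : ℝ) ^ (12 + R.natAbs)) ^ 3 * (T * √T) := by
  obtain ⟨K, hK, key⟩ := hG.exists_abs_card_primitive_class_sub_le
  refine ⟨K, hK, fun q hq α k hk hqk T hT => ?_⟩
  set ψ := psi f g m r k with hψ
  have hψ0 : 0 < ψ := psi_pos f g m r k
  set M := q * ψ with hM
  have hM1 : 1 ≤ M := Nat.mul_pos hq hψ0
  have : NeZero q := ⟨by omega⟩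
  have : NeZero ψ := ⟨hψ0.ne'⟩
  have : NeZero M := ⟨by omega⟩
  have hTT : 0 ≤ T * √T := mul_nonneg (by linarith) (Real.sqrt_nonneg _)
  let I := {β : P1 (q * ψ) // P1.red (dvd_mul_right _ _) β = α ∧
      ∃ a b : ℤ, β.Rep a b ∧ LocalCond f g m k a b}
  have : Fintype I := Fintype.ofFinite _
  have hI : Fintype.card I = eta f g m r k := by
    rw [← Nat.card_eq_fintype_card]; exact D.card_condition_over hk hqk α
  have hper : IsPeriodicCond f g m (q * ψ) k := by
    intro γ a b a' b' h1 h2 hc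
    exact D.isPeriodicCond hk _ _ _ _ _ (h1.red (dvd_mul_left _ q)) (h2.red (dvd_mul_left _ q)) hc
  have hdecomp : #(condPts hG T α k) =
      ∑ β : I, #{w ∈ hG.pts T | β.1.Rep w.1 w.2 ∧ Int.gcd w.1 w.2 = 1} := by
    rw [← card_biUnion]
    · congr 1
      ext w
      simp only [condPts, mem_filter, mem_biUnion, mem_univ, true_and]
      constructor
      · rintro ⟨h1, h2, h3, h4⟩
        obtain ⟨β, hβ⟩ := P1.exists_of_isCoprime (isCoprime_zmod_of_gcd_eq_one (q * ψ) h3)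
        exact ⟨⟨β, (P1.red_eq_iff _ hβ).2 h2, _, _, hβ, h4⟩, h1, hβ, h3⟩
      · rintro ⟨⟨β, h5, h6⟩, h1, hβ, h3⟩
        exact ⟨h1, (P1.red_eq_iff _ hβ).1 h5, h3, (hper.exists_iff hβ).1 h6⟩
    · intro β _ β' _ hne
      refine disjoint_left.2 fun w hw hw' => hne (Subtype.ext ?_)
      exact (mem_filter.1 hw).2.1.eq (mem_filter.1 hw').2.1
  have hcards : (Nat.card (P1 M) : ℝ) = Nat.card (P1 q) * Nat.card (P1 ψ) := by
    rw [hM, P1.card_mul (psi_coprime f g m r hqk.symm).symm]; push_cast; rfl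
  have hmain : IsGauge.density (gauge f g m) / Nat.card (P1 q) * rho f g m r k * T ^ 2 =
      ∑ β : I, IsGauge.density (gauge f g m) / Nat.card (P1 M) * T ^ 2 := by
    rw [sum_const, card_univ, hI, nsmul_eq_mul, hcards, rho, ← hψ]
    have h1 : (Nat.card (P1 q) : ℝ) ≠ 0 := by exact_mod_cast (P1.card_pos q).ne'
    have h2 : (Nat.card (P1 ψ) : ℝ) ≠ 0 := by exact_mod_cast (P1.card_pos ψ).ne'
    field_simp
  rw [hdecomp, hmain, Nat.cast_sum, ← sum_sub_distrib]
  refine (abs_sum_le_sum_abs _ _).trans ((sum_le_sum fun β _ => key M hM1 β.1 T hT).trans ?_)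
  rw [sum_const, card_univ, nsmul_eq_mul]
  have hIM : (Fintype.card I : ℝ) ≤ (M : ℝ) ^ 2 := by
    have h1 := Nat.card_le_card_of_injective (Subtype.val : I → P1 (q * ψ)) Subtype.val_injective
    rw [Nat.card_eq_fintype_card] at h1
    exact_mod_cast h1.trans (P1.card_le M)
  have hMle : (M : ℝ) ≤ (q : ℝ) * (k : ℝ) ^ (12 + R.natAbs) := by
    have := Nat.mul_le_mul_left q (D.psi_le hk)
    exact_mod_cast this
  calc _ ≤ (M : ℝ) ^ 2 * (K * M * (T * √T)) := by gcongr
    _ = K * (M : ℝ) ^ 3 * (T * √T) := by ring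
    _ ≤ _ := by gcongr

/-- No points modulo `ψ(k)` are counted: `ρ(k)` is the leading coefficient of the asymptotics for `q
= 1`, and letting `T` grow in the uniform upper bound gives the estimate. -/
theorem exists_rho_le (D : FamilyData f g m r h F G n R) (hG : IsGauge (gauge f g m) C) {η : ℝ}
    (hη : 0 < η) : ∃ K : ℝ, 0 < K ∧ ∀ k : ℕ, 1 ≤ k →
      rho f g m r k ≤ K * (k : ℝ) ^ (η - 12 / r) := by
  obtain ⟨K, hK, hup⟩ := D.exists_card_condPts_le hG hη
  obtain ⟨L, hL, has⟩ := D.exists_abs_card_condPts_sub_le hG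
  have hd := hG.density_pos
  refine ⟨K / IsGauge.density (gauge f g m), by positivity, fun k hk => ?_⟩
  have hk0 : (0 : ℝ) < k := by exact_mod_cast hk
  obtain ⟨α, -⟩ := P1.exists_of_isCoprime (M := 1) (a := 1) (b := 0) (by simpa using isCoprime_one_left)
  have hcard : Nat.card (P1 1) = 1 :=
    le_antisymm ((P1.card_le 1).trans_eq (one_pow 2)) (P1.card_pos 1)
  rw [div_mul_eq_mul_div, le_div_iff₀ hd, mul_comm]
  refine le_of_forall_mul_sq_le
    (c := K * (k : ℝ) ^ η + L * ((1 : ℝ) * (k : ℝ) ^ (12 + R.natAbs)) ^ 3) fun T hT => ?_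
  have h1 := (abs_le.1 (has 1 le_rfl α k hk (Nat.coprime_one_left k) T hT)).1
  have h2 := hup 1 le_rfl α k hk (Nat.coprime_one_left k) T
  rw [hcard, Nat.cast_one, div_one] at h1
  rw [Nat.cast_one, one_mul] at h2
  have hTT : 1 ≤ T * √T := one_le_mul_of_one_le_of_one_le hT (Real.one_le_sqrt.2 hT)
  have h3 : K * (k : ℝ) ^ η * (T ^ 2 / (k : ℝ) ^ (12 / r : ℝ) + 1) ≤
      K * (k : ℝ) ^ (η - 12 / r) * T ^ 2 + K * (k : ℝ) ^ η * (T * √T) := by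
    rw [Real.rpow_sub hk0, mul_add, mul_one]
    have : K * (k : ℝ) ^ η ≤ K * (k : ℝ) ^ η * (T * √T) := le_mul_of_one_le_right (by positivity) hTT
    have e : K * (k : ℝ) ^ η * (T ^ 2 / (k : ℝ) ^ (12 / r : ℝ)) =
      K * ((k : ℝ) ^ η / (k : ℝ) ^ (12 / r : ℝ)) * T ^ 2 := by ring
    linarith
  nlinarith

end FamilyData
end EllFamily

namespace EllFamily
open Finset
open scoped Classical ArithmeticFunction.Moebius ArithmeticFunction.zeta

/-! ### The Jordan totient and the Euler product -/

/-- The power function `n ↦ n ^ s`, vanishing at `0`. -/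
noncomputable def rpowFun (s : ℝ) : ArithmeticFunction ℝ :=
  ⟨fun n => if n = 0 then 0 else (n : ℝ) ^ s, if_pos rfl⟩

lemma rpowFun_apply (s : ℝ) {n : ℕ} (hn : n ≠ 0) : rpowFun s n = (n : ℝ) ^ s := if_neg hn

lemma isMultiplicative_rpowFun (s : ℝ) : (rpowFun s).IsMultiplicative := by
  refine ArithmeticFunction.IsMultiplicative.iff_ne_zero.2 ⟨by simp [rpowFun_apply], ?_⟩
  intro k l hk hl _
  rw [rpowFun_apply s hk, rpowFun_apply s hl, rpowFun_apply s (mul_ne_zero hk hl), Nat.cast_mul,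
    Real.mul_rpow (Nat.cast_nonneg k) (Nat.cast_nonneg l)]

/-- Jordan's totient with a real exponent. -/
noncomputable def jordan (s : ℝ) : ArithmeticFunction ℝ := (μ : ArithmeticFunction ℝ) * rpowFun s

lemma isMultiplicative_jordan (s : ℝ) : (jordan s).IsMultiplicative :=
  ArithmeticFunction.isMultiplicative_moebius.intCast.mul (isMultiplicative_rpowFun s)

lemma jordan_apply (s : ℝ) (k : ℕ) :
    jordan s k = ∑ x ∈ k.divisorsAntidiagonal, (μ x.1 : ℝ) * (x.2 : ℝ) ^ s := by
  rw [jordan, ArithmeticFunction.mul_apply]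
  refine sum_congr rfl fun x hx => ?_
  rw [rpowFun_apply s (Nat.ne_zero_of_mem_divisorsAntidiagonal hx).2,
    ArithmeticFunction.intCoe_apply]

lemma sum_divisors_jordan (s : ℝ) {k : ℕ} (hk : k ≠ 0) :
    ∑ d ∈ k.divisors, jordan s d = (k : ℝ) ^ s := by
  rw [← ArithmeticFunction.coe_mul_zeta_apply, jordan, mul_comm, ← mul_assoc,
    ArithmeticFunction.coe_zeta_mul_coe_moebius, one_mul, rpowFun_apply s hk]

/-- The difference of the divisor sums at `p^(k+1)` and `p^k`. It produces the factor `1 - p^(-2/m)`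
in the definition of `λ(p)`. -/
lemma jordan_prime_pow (s : ℝ) {p : ℕ} (hp : p.Prime) (k : ℕ) :
    jordan s (p ^ (k + 1)) = (1 - 1 / (p : ℝ) ^ s) * ((p : ℝ) ^ s) ^ (k + 1) := by
  have hp0 : (0 : ℝ) < p := by exact_mod_cast hp.pos
  have key : ∀ k : ℕ, ∑ i ∈ range (k + 1), jordan s (p ^ i) = ((p : ℝ) ^ s) ^ k := by
    intro k
    have := sum_divisors_jordan s (k := p ^ k) (pow_pos hp.pos k).ne'
    rw [Nat.sum_divisors_prime_pow hp] at this
    rw [this, Nat.cast_pow, ← Real.rpow_natCast, ← Real.rpow_natCast, ← Real.rpow_mul hp0.le,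
      ← Real.rpow_mul hp0.le, mul_comm]
  have h1 := key (k + 1)
  rw [sum_range_succ, key k] at h1
  have h2 : (p : ℝ) ^ s ≠ 0 := (Real.rpow_pos_of_pos hp0 s).ne'
  have h3 : (1 - 1 / (p : ℝ) ^ s) * ((p : ℝ) ^ s) ^ (k + 1) =
      ((p : ℝ) ^ s) ^ (k + 1) - ((p : ℝ) ^ s) ^ k := by
    rw [pow_succ]; field_simp
  rw [h3]; linarith

lemma jordan_nonneg {s : ℝ} (hs : 0 ≤ s) (k : ℕ) : 0 ≤ jordan s k := by
  rcases Nat.eq_zero_or_pos k with rfl | hk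
  · simp
  rw [(isMultiplicative_jordan s).multiplicative_factorization _ hk.ne']
  refine prod_nonneg fun p hp => ?_
  have hp' := Nat.prime_of_mem_primeFactors (Nat.support_factorization k ▸ hp)
  obtain ⟨e, he⟩ := Nat.exists_eq_succ_of_ne_zero (Finsupp.mem_support_iff.1 hp)
  rw [he, Nat.succ_eq_add_one]
  beta_reduce
  rw [jordan_prime_pow s hp']
  have hp1 : (1 : ℝ) ≤ (p : ℝ) ^ s := Real.one_le_rpow (by exact_mod_cast hp'.one_le) hs
  refine mul_nonneg (sub_nonneg.2 ?_) (by positivity)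
  rw [div_le_one (by linarith)]; exact hp1

/-- Only squarefree divisors count, and each is determined by its set of primes. -/
lemma sum_abs_moebius_le {k : ℕ} :
    ∑ x ∈ k.divisorsAntidiagonal, |(μ x.1 : ℝ)| ≤ (2 : ℕ) ^ #k.primeFactors := by
  rw [Nat.sum_divisorsAntidiagonal (fun d _ => |(μ d : ℝ)|)]
  have h1 : ∑ d ∈ k.divisors, |(μ d : ℝ)| ≤ #{d ∈ k.divisors | Squarefree d} := by
    rw [card_filter, Nat.cast_sum]
    refine sum_le_sum fun d _ => ?_
    split_ifs with hd
    · rw [Nat.cast_one]; exact_mod_cast ArithmeticFunction.abs_moebius_le_one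
    · rw [ArithmeticFunction.moebius_eq_zero_of_not_squarefree hd]; simp
  refine h1.trans ?_
  have h2 : #{d ∈ k.divisors | Squarefree d} ≤ #k.primeFactors.powerset := by
    refine card_le_card_of_injOn Nat.primeFactors (fun d hd => ?_) fun d hd d' hd' he => ?_
    · obtain ⟨hd, _⟩ := mem_filter.1 hd
      obtain ⟨hd, hk⟩ := Nat.mem_divisors.1 hd
      exact mem_coe.2 (mem_powerset.2 (Nat.primeFactors_mono hd hk))
    · have hs := (mem_filter.1 (mem_coe.1 hd)).2
      have hs' := (mem_filter.1 (mem_coe.1 hd')).2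
      rw [← Nat.prod_primeFactors_of_squarefree hs, he, Nat.prod_primeFactors_of_squarefree hs']
  rw [card_powerset] at h2
  exact_mod_cast h2

lemma exists_jordan_le {s η : ℝ} (hs : 0 ≤ s) (hη : 0 < η) :
    ∃ K : ℝ, 0 < K ∧ ∀ k : ℕ, 1 ≤ k → jordan s k ≤ K * (k : ℝ) ^ (η + s) := by
  obtain ⟨K, hK, h⟩ := exists_pow_card_primeFactors_le 2 hη
  refine ⟨K, hK, fun k hk => ?_⟩
  have hk0 : (0 : ℝ) < k := by exact_mod_cast hk
  rw [jordan_apply]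
  calc _ ≤ ∑ x ∈ k.divisorsAntidiagonal, |(μ x.1 : ℝ)| * (k : ℝ) ^ s := by
        refine sum_le_sum fun x hx => ?_
        have hx2 : (x.2 : ℝ) ≤ k := by
          have := Nat.le_of_dvd hk (Dvd.intro_left _ (Nat.mem_divisorsAntidiagonal.1 hx).1)
          exact_mod_cast this
        have h1 : (x.2 : ℝ) ^ s ≤ (k : ℝ) ^ s := Real.rpow_le_rpow (Nat.cast_nonneg _) hx2 hs
        calc _ ≤ |(μ x.1 : ℝ)| * (x.2 : ℝ) ^ s := by gcongr; exact le_abs_self _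
          _ ≤ _ := by gcongr
    _ = (∑ x ∈ k.divisorsAntidiagonal, |(μ x.1 : ℝ)|) * (k : ℝ) ^ s := by rw [sum_mul]
    _ ≤ (K * (k : ℝ) ^ η) * (k : ℝ) ^ s := by
        gcongr
        exact sum_abs_moebius_le.trans (by exact_mod_cast h k hk)
    _ = _ := by rw [Real.rpow_add hk0]; ring

/-- The general term of the series whose Euler factors are the inverses of the local factors. -/
noncomputable def densTerm (f g : ℤ[X]) (m r q k : ℕ) : ℝ :=
  if q.Coprime k then jordan (2 / m) k * rho f g m r k else 0

namespace FamilyData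

variable {f g h F G : ℤ[X]} {m r n : ℕ} {R : ℤ} {C : ℝ}

/-- This is `lt_m` divided by `rm`; it is the condition under which `∑ k^(2/m - 12/r)` converges. -/
lemma exponent_pos (D : FamilyData f g m r h F G n R) : (0 : ℝ) < 12 / r - 2 / m - 1 := by
  have hr : (0 : ℝ) < r := by exact_mod_cast D.one_le_r
  have hm : (0 : ℝ) < m := by exact_mod_cast D.one_le_m
  have h1 : (r : ℝ) * (2 + m) < 12 * m := by exact_mod_cast D.lt_m
  have h2 : (12 : ℝ) / r - 2 / m - 1 = (12 * m - r * (2 + m)) / (r * m) := by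
    field_simp; ring
  rw [h2]
  apply div_pos <;> [linarith; positivity]

lemma densTerm_zero (q : ℕ) : densTerm f g m r q 0 = 0 := by simp [densTerm]

lemma densTerm_nonneg (q k : ℕ) : 0 ≤ densTerm f g m r q k := by
  unfold densTerm
  split_ifs
  · exact mul_nonneg (jordan_nonneg (by positivity) k) (rho_nonneg k)
  · exact le_rfl

lemma densTerm_one (q : ℕ) : densTerm f g m r q 1 = 1 := by
  rw [densTerm, if_pos (Nat.coprime_one_right q), rho_one, (isMultiplicative_jordan _).map_one,
    one_mul]

lemma densTerm_mul (D : FamilyData f g m r h F G n R) (q : ℕ) {k l : ℕ} (hkl : k.Coprime l) :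
    densTerm f g m r q (k * l) = densTerm f g m r q k * densTerm f g m r q l := by
  rcases Nat.eq_zero_or_pos k with rfl | hk
  · rw [zero_mul, densTerm_zero, zero_mul]
  rcases Nat.eq_zero_or_pos l with rfl | hl
  · rw [mul_zero, densTerm_zero, mul_zero]
  simp only [densTerm, Nat.coprime_mul_iff_right]
  by_cases h1 : q.Coprime k
  · by_cases h2 : q.Coprime l
    · rw [if_pos ⟨h1, h2⟩, if_pos h1, if_pos h2, (isMultiplicative_jordan _).map_mul_of_coprime hkl,
        D.rho_mul hk hl hkl]
      ring
    · rw [if_neg (fun h => h2 h.2), if_neg h2, mul_zero]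
  · rw [if_neg (fun h => h1 h.1), if_neg h1, zero_mul]

lemma exists_densTerm_le (D : FamilyData f g m r h F G n R) (hG : IsGauge (gauge f g m) C) :
    ∃ θ A : ℝ, 0 < θ ∧ 0 < A ∧ 16 * θ = 12 / r - 2 / m - 1 ∧ ∀ q k : ℕ, 1 ≤ k →
      |densTerm f g m r q k| ≤ A * (k : ℝ) ^ (-1 - 2 * θ) := by
  have hpos := D.exponent_pos
  -- The two losses `k^θ` leave the exponent `-1 - 14θ`, more than is needed. Dividing by as much as
  -- `16` also gives `θ ≤ 1`, used in the sieve.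
  set θ : ℝ := (12 / r - 2 / m - 1) / 16 with hθ
  have hθ0 : 0 < θ := by positivity
  obtain ⟨K, hK, h1⟩ := exists_jordan_le (s := 2 / m) (by positivity) hθ0
  obtain ⟨L, hL, h2⟩ := D.exists_rho_le hG hθ0
  refine ⟨θ, K * L, hθ0, by positivity, by rw [hθ]; ring, fun q k hk => ?_⟩
  have hk1 : (1 : ℝ) ≤ k := by exact_mod_cast hk
  have hk0 : (0 : ℝ) < k := by linarith
  rw [abs_of_nonneg (densTerm_nonneg q k), densTerm]
  split_ifs
  · calc _ ≤ (K * (k : ℝ) ^ (θ + 2 / m)) * (L * (k : ℝ) ^ (θ - 12 / r)) :=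
        mul_le_mul (h1 k hk) (h2 k hk) (rho_nonneg k) (by positivity)
      _ = K * L * (k : ℝ) ^ (θ + 2 / m + (θ - 12 / r)) := by
        rw [Real.rpow_add hk0 (θ + 2 / m) (θ - 12 / r)]; ring
      _ ≤ _ := by
        gcongr
        linarith
  · positivity

lemma summable_densTerm (D : FamilyData f g m r h F G n R) (hG : IsGauge (gauge f g m) C) (q : ℕ) :
    Summable (densTerm f g m r q) := by
  obtain ⟨θ, A, hθ, hA, _, hle⟩ := D.exists_densTerm_le hG
  exact (abs_tsum_sub_sum_Icc_le hθ (densTerm_zero q) (hle q) le_rfl).1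

lemma densTerm_prime_pow {q p : ℕ} (hp : p.Prime) (hq : ¬ p ∣ q) (k : ℕ) :
    densTerm f g m r q (p ^ (k + 1)) =
      (1 - 1 / (p : ℝ) ^ ((2 : ℝ) / m)) * localTerm f g m r p (k + 1) := by
  have hp0 : (0 : ℝ) < p := by exact_mod_cast hp.pos
  have hc : q.Coprime (p ^ (k + 1)) := ((hp.coprime_iff_not_dvd.2 hq).symm.pow_right _)
  rw [densTerm, if_pos hc, jordan_prime_pow _ hp, localTerm, mul_assoc]
  congr 2
  rw [← Real.rpow_natCast, ← Real.rpow_mul hp0.le]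
  congr 1
  push_cast
  ring

/-- Up to the nonzero factor `1 - p^(-2/m)`, the local series is a subseries of the convergent
global one. -/
lemma summable_localTerm (D : FamilyData f g m r h F G n R) (hG : IsGauge (gauge f g m) C)
    {p : ℕ} (hp : p.Prime) : Summable fun k : ℕ => localTerm f g m r p (k + 1) := by
  have hm0 : (0 : ℝ) < m := by exact_mod_cast D.one_le_m
  have h1 : Summable fun k : ℕ => densTerm f g m r 1 (p ^ (k + 1)) :=
    (D.summable_densTerm hG 1).comp_injective
      ((Nat.pow_right_injective hp.two_le).comp (add_left_injective 1))
  have hp1 : 1 < (p : ℝ) ^ ((2 : ℝ) / m) := Real.one_lt_rpow (by exact_mod_cast hp.one_lt) (by positivity)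
  have h2 : (1 - 1 / (p : ℝ) ^ ((2 : ℝ) / m)) ≠ 0 := by
    have : 1 / (p : ℝ) ^ ((2 : ℝ) / m) < 1 := by rw [div_lt_one (by linarith)]; exact hp1
    linarith
  have hp1' : ¬ p ∣ 1 := fun h => hp.one_lt.ne' (Nat.dvd_one.1 h)
  simp only [densTerm_prime_pow hp hp1'] at h1
  exact (summable_mul_left_iff h2).1 h1

lemma tsum_densTerm_prime_pow (D : FamilyData f g m r h F G n R) (hG : IsGauge (gauge f g m) C)
    {q p : ℕ} (hp : p.Prime) (hq : ¬ p ∣ q) :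
    ∑' e, densTerm f g m r q (p ^ e) = (localFactor f g m r p)⁻¹ := by
  have h1 : Summable fun e : ℕ => densTerm f g m r q (p ^ e) :=
    (D.summable_densTerm hG q).comp_injective (Nat.pow_right_injective hp.two_le)
  rw [h1.tsum_eq_zero_add, pow_zero, densTerm_one, localFactor, inv_inv]
  congr 1
  rw [← tsum_mul_left]
  exact tsum_congr fun k => densTerm_prime_pow hp hq k

lemma one_le_inv_localFactor (D : FamilyData f g m r h F G n R) (hG : IsGauge (gauge f g m) C)
    {p : ℕ} (hp : p.Prime) : 1 ≤ (localFactor f g m r p)⁻¹ := by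
  have hp1' : ¬ p ∣ 1 := fun h => hp.one_lt.ne' (Nat.dvd_one.1 h)
  rw [← D.tsum_densTerm_prime_pow hG hp hp1']
  have h1 : Summable fun e : ℕ => densTerm f g m r 1 (p ^ e) :=
    (D.summable_densTerm hG 1).comp_injective (Nat.pow_right_injective hp.two_le)
  have := h1.le_tsum 0 fun e _ => densTerm_nonneg 1 (p ^ e)
  rwa [pow_zero, densTerm_one] at this

/-- Both series are limits of Euler products. At `p ∤ q` their factors agree and equal `1/λ(p)`; at
`p ∣ q` the right-hand factor is `1`, which the extra `λ(p)` on the left compensates. All primes of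
`q` occur once the product runs past `q`. -/
theorem tsum_densTerm_mul (D : FamilyData f g m r h F G n R) (hG : IsGauge (gauge f g m) C)
    {q : ℕ} (hq : 1 ≤ q) :
    (∑' k, densTerm f g m r 1 k) * ∏ p ∈ q.primeFactors, localFactor f g m r p =
      ∑' k, densTerm f g m r q k := by
  have hEP : ∀ q, Filter.Tendsto (fun N : ℕ => ∏ p ∈ Nat.primesBelow N,
      ∑' e, densTerm f g m r q (p ^ e)) Filter.atTop (nhds (∑' k, densTerm f g m r q k)) := fun q =>
    EulerProduct.eulerProduct (densTerm_one q) (fun hkl => D.densTerm_mul q hkl)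
      (D.summable_densTerm hG q).norm (densTerm_zero q)
  refine tendsto_nhds_unique ((hEP 1).mul_const _) ((hEP q).congr' ?_)
  filter_upwards [Filter.eventually_gt_atTop q] with N hN
  have hsub : Nat.primesBelow N ∩ q.primeFactors = q.primeFactors := by
    refine inter_eq_right.2 fun p hp => ?_
    rw [Nat.mem_primesBelow]
    exact ⟨(Nat.le_of_mem_primeFactors hp).trans_lt hN, Nat.prime_of_mem_primeFactors hp⟩
  rw [← hsub, ← prod_ite_mem, ← prod_mul_distrib]
  refine prod_congr rfl fun p hp => ?_
  have hp := Nat.prime_of_mem_primesBelow hp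
  have hp1' : ¬ p ∣ 1 := fun h => hp.one_lt.ne' (Nat.dvd_one.1 h)
  rw [D.tsum_densTerm_prime_pow hG hp hp1']
  by_cases hpq : p ∣ q
  · rw [if_pos (Nat.mem_primeFactors.2 ⟨hp, hpq, by omega⟩), inv_mul_cancel₀, tsum_eq_single 0]
    · rw [pow_zero, densTerm_one]
    · intro e he
      rw [densTerm, if_neg]
      intro hc
      have := Nat.Coprime.coprime_dvd_right (dvd_pow_self p he) hc
      exact hp.one_lt.ne' (Nat.Coprime.eq_one_of_dvd this.symm hpq)
    · have := D.one_le_inv_localFactor hG hp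
      intro h0
      rw [h0, inv_zero] at this
      linarith
  · rw [if_neg (fun h => hpq (Nat.dvd_of_mem_primeFactors h)), mul_one,
      D.tsum_densTerm_prime_pow hG hp hpq]

end FamilyData
end EllFamily

namespace EllFamily
open Finset
open scoped Classical ArithmeticFunction.Moebius ArithmeticFunction.zeta

/-! ### The twisting defect and the counting sets -/

/-- The admissible `d` are closed under least common multiples, so the largest one is a multiple of
all the others. -/
lemma twistDefect_spec {A B : ℤ} (h : A ≠ 0 ∨ B ≠ 0) :
    1 ≤ twistDefect A B ∧ ∀ d : ℕ, d ∣ twistDefect A B ↔ d ^ 12 ∣ Int.gcd (A ^ 3) (B ^ 2) := by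
  set n := Int.gcd (A ^ 3) (B ^ 2) with hn
  have hn0 : 0 < n := by
    refine Nat.pos_of_ne_zero fun h0 => ?_
    obtain ⟨h1, h2⟩ := Int.gcd_eq_zero_iff.1 h0
    exact h.elim (fun h => h (pow_eq_zero_iff (by norm_num) |>.1 h1))
      fun h => h (pow_eq_zero_iff (by norm_num) |>.1 h2)
  have hbdd : BddAbove {d : ℕ | d ^ 12 ∣ n} :=
    ⟨n, fun d hd => (Nat.le_self_pow (by norm_num) d).trans (Nat.le_of_dvd hn0 hd)⟩
  have hmem : twistDefect A B ^ 12 ∣ n := Nat.sSup_mem ⟨1, by simp⟩ hbdd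
  have hone : 1 ≤ twistDefect A B := le_csSup hbdd (by simp)
  refine ⟨hone, fun d => ⟨fun hd => (pow_dvd_pow_of_dvd hd 12).trans hmem, fun hd => ?_⟩⟩
  have h1 : Nat.lcm d (twistDefect A B) ^ 12 ∣ n := by
    rw [← Nat.pow_lcm_pow]; exact Nat.lcm_dvd hd hmem
  have h2 : Nat.lcm d (twistDefect A B) ≤ twistDefect A B := le_csSup hbdd h1
  have h3 : Nat.lcm d (twistDefect A B) = twistDefect A B :=
    le_antisymm h2 (Nat.le_of_dvd (Nat.pos_of_ne_zero fun h0 => by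
      rw [h0] at h1
      exact hn0.ne' (Nat.eq_zero_of_zero_dvd (by simpa using h1))) (Nat.dvd_lcm_right _ _))
  exact h3 ▸ Nat.dvd_lcm_left d _

lemma localCond_iff_pow_dvd_gcd (f g : ℤ[X]) (m k : ℕ) (a b : ℤ) :
    LocalCond f g m k a b ↔ k ^ 12 ∣ Int.gcd (formA f m a b ^ 3) (formB g m a b ^ 2) := by
  rw [← Int.natCast_dvd_natCast, Int.dvd_coe_gcd_iff, LocalCond, Nat.cast_pow,
    show (k : ℤ) ^ 12 = ((k : ℤ) ^ 4) ^ 3 by ring, Int.pow_dvd_pow_iff (by norm_num),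
    show ((k : ℤ) ^ 4) ^ 3 = ((k : ℤ) ^ 6) ^ 2 by ring, Int.pow_dvd_pow_iff (by norm_num)]

/-- The twisting defect at a point. -/
noncomputable def defect (f g : ℤ[X]) (m : ℕ) (v : ℤ × ℤ) : ℕ :=
  twistDefect (formA f m v.1 v.2) (formB g m v.1 v.2)

lemma toR_ne_zero {v : ℤ × ℤ} (hv : Int.gcd v.1 v.2 = 1) : toR v ≠ 0 := by
  intro h0
  rw [toR, Prod.mk_eq_zero] at h0
  have h1 : v.1 = 0 := by exact_mod_cast h0.1
  have h2 : v.2 = 0 := by exact_mod_cast h0.2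
  rw [h1, h2] at hv
  simp at hv

lemma hgt_toR (f g : ℤ[X]) (m : ℕ) (v : ℤ × ℤ) : hgt f g m (toR v) =
    ((max (4 * |formA f m v.1 v.2| ^ 3) (27 * formB g m v.1 v.2 ^ 2) : ℤ) : ℝ) := by
  simp only [hgt, toR, ← form_intCast, formA_eq, formB_eq]
  push_cast
  rfl

/-- The radius of the ball that contains the points of defect `e` and height at most
`X ^ (12 m)`. -/
noncomputable def radius (m : ℕ) (X : ℝ) (e : ℕ) : ℝ := X * (e : ℝ) ^ (1 / m : ℝ)

lemma radius_pow {m : ℕ} (hm : 1 ≤ m) (X : ℝ) (e : ℕ) : radius m X e ^ m = X ^ m * e := by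
  rw [radius, mul_pow, one_div, Real.rpow_inv_natCast_pow (Nat.cast_nonneg e) (by omega)]

lemma radius_nonneg (m : ℕ) {X : ℝ} (hX : 0 ≤ X) (e : ℕ) : 0 ≤ radius m X e := by
  unfold radius; positivity

lemma radius_mono (m : ℕ) {X : ℝ} (hX : 0 ≤ X) {d e : ℕ} (h : d ≤ e) :
    radius m X d ≤ radius m X e := by
  unfold radius; gcongr

/-- The points of the class `α` with height at most `X ^ (12 m)`. -/
def ballSet (f g : ℤ[X]) (m : ℕ) (X : ℝ) {q : ℕ} (α : P1 q) : Set (ℤ × ℤ) :=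
  {v | Int.gcd v.1 v.2 = 1 ∧ α.Rep v.1 v.2 ∧
    gauge f g m (toR v) ≤ radius m X (defect f g m v)}

namespace FamilyData

variable {f g h F G : ℤ[X]} {m r n : ℕ} {R : ℤ} {C : ℝ}

lemma form_int_ne_zero (D : FamilyData f g m r h F G n R) {v : ℤ × ℤ}
    (hv : Int.gcd v.1 v.2 = 1) : formA f m v.1 v.2 ≠ 0 ∨ formB g m v.1 v.2 ≠ 0 := by
  have := D.form_ne_zero (toR v) (toR_ne_zero hv)
  simp only [toR, ← form_intCast, ← formA_eq, ← formB_eq] at this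
  exact_mod_cast this

lemma one_le_defect (D : FamilyData f g m r h F G n R) {v : ℤ × ℤ} (hv : Int.gcd v.1 v.2 = 1) :
    1 ≤ defect f g m v := (twistDefect_spec (D.form_int_ne_zero hv)).1

lemma dvd_defect_iff (D : FamilyData f g m r h F G n R) {v : ℤ × ℤ} (hv : Int.gcd v.1 v.2 = 1)
    (k : ℕ) : k ∣ defect f g m v ↔ LocalCond f g m k v.1 v.2 := by
  rw [localCond_iff_pow_dvd_gcd]
  exact (twistDefect_spec (D.form_int_ne_zero hv)).2 k

/-- The twelfth power of the defect divides whichever of `A ^ 3`, `B ^ 2` is nonzero. Consequently a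
nonempty counting set has `N ≥ 1`. -/
lemma defect_pow_le_hgt (D : FamilyData f g m r h F G n R) {v : ℤ × ℤ}
    (hv : Int.gcd v.1 v.2 = 1) : (defect f g m v : ℝ) ^ 12 ≤ hgt f g m (toR v) := by
  have hd := ((twistDefect_spec (D.form_int_ne_zero hv)).2 (defect f g m v)).1 dvd_rfl
  obtain ⟨h1, h2⟩ := Int.dvd_coe_gcd_iff.1 (Int.natCast_dvd_natCast.2 hd)
  rw [hgt_toR]
  rw [Nat.cast_pow] at h1 h2
  have key : (defect f g m v : ℤ) ^ 12 ≤
      max (4 * |formA f m v.1 v.2| ^ 3) (27 * formB g m v.1 v.2 ^ 2) := by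
    rcases D.form_int_ne_zero hv with hA | hB
    · refine le_max_of_le_left ?_
      rw [← dvd_abs, abs_pow] at h1
      have h3 : 0 < |formA f m v.1 v.2| ^ 3 := by positivity
      have := Int.le_of_dvd h3 h1
      linarith
    · refine le_max_of_le_right ?_
      have h3 : 0 < formB g m v.1 v.2 ^ 2 := by positivity
      have := Int.le_of_dvd h3 h2
      linarith
  exact_mod_cast key

lemma mem_countSet_iff (D : FamilyData f g m r h F G n R) {N : ℝ} (hN : 0 ≤ N) (v : ℤ × ℤ) :
    v ∈ countSet f g m N ↔ Int.gcd v.1 v.2 = 1 ∧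
      gauge f g m (toR v) ≤ radius m (N ^ (1 / (12 * m : ℝ))) (defect f g m v) := by
  have hm := D.one_le_m
  rw [countSet, Set.mem_ofPred_eq, ← hgt_toR, ← gauge_pow f g hm]
  refine and_congr_right fun _ => ?_
  have hX : 0 ≤ N ^ (1 / (12 * m : ℝ)) := Real.rpow_nonneg hN _
  rw [← pow_le_pow_iff_left₀ (gauge_nonneg f g m _) (radius_nonneg m hX _)
    (by omega : 12 * m ≠ 0)]
  have h1 : radius m (N ^ (1 / (12 * m : ℝ))) (defect f g m v) ^ (12 * m) =
      N * (defect f g m v : ℝ) ^ 12 := by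
    have h2 : (N ^ (1 / (12 * m : ℝ))) ^ (12 * m) = N := by
      have : (12 * m : ℝ) = ((12 * m : ℕ) : ℝ) := by push_cast; ring
      rw [this, one_div, Real.rpow_inv_natCast_pow hN (by omega)]
    calc _ = (radius m (N ^ (1 / (12 * m : ℝ))) (defect f g m v) ^ m) ^ 12 := by
          rw [← pow_mul, mul_comm m]
      _ = (N ^ (1 / (12 * m : ℝ))) ^ (12 * m) * (defect f g m v : ℝ) ^ 12 := by
          rw [radius_pow hm, mul_pow, ← pow_mul, mul_comm m]
      _ = _ := by rw [h2]
  rw [h1]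
  rfl

lemma one_le_of_mem_countSet (D : FamilyData f g m r h F G n R) {N : ℝ} {v : ℤ × ℤ}
    (hv : v ∈ countSet f g m N) : 1 ≤ N := by
  obtain ⟨h1, h2⟩ := hv
  rw [← hgt_toR] at h2
  have h3 := (D.defect_pow_le_hgt h1).trans h2
  have h4 : (0 : ℝ) < defect f g m v := by exact_mod_cast D.one_le_defect h1
  exact (le_mul_iff_one_le_left (pow_pos h4 12)).1 h3

lemma countSetMod_eq (D : FamilyData f g m r h F G n R) {N : ℝ} (hN : 0 ≤ N) {q : ℕ}
    (α : P1 q) : countSetMod f g m N α = ballSet f g m (N ^ (1 / (12 * m : ℝ))) α := by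
  ext v
  rw [countSetMod, Set.mem_ofPred_eq, D.mem_countSet_iff hN, ballSet, Set.mem_ofPred_eq]
  tauto

/-- A local condition at a point of bounded height has bounded modulus. -/
lemma exists_le_of_localCond (D : FamilyData f g m r h F G n R) (hG : IsGauge (gauge f g m) C) :
    ∃ K : ℝ, 1 ≤ K ∧ ∀ (v : ℤ × ℤ) (k : ℕ) (X : ℝ), Int.gcd v.1 v.2 = 1 →
      LocalCond f g m k v.1 v.2 → 0 ≤ X → gauge f g m (toR v) ≤ radius m X k →
      (k : ℝ) ^ n ≤ K * X ^ (r * h.natDegree * m) := by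
  obtain ⟨K, hK, hle⟩ := abs_form_le h h.natDegree
  have hC := hG.pos
  set d := r * h.natDegree with hd
  set L := max 1 (|(R : ℝ)| * (K * C ^ h.natDegree) ^ r) with hL
  have hL1 : 1 ≤ L := le_max_left _ _
  refine ⟨L ^ m, one_le_pow₀ hL1, fun v k X hv hk hX hT => ?_⟩
  rcases Nat.eq_zero_or_pos k with rfl | hk1
  · rw [Nat.cast_zero, zero_pow (by have := D.one_le_n; omega)]
    positivity
  have hg0 := gauge_nonneg f g m (toR v)
  have h1 : (k : ℝ) ^ 12 ≤ L * gauge f g m (toR v) ^ d := by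
    have h2 := D.pow_dvd_of_localCond hv hk
    have h3 : form h h.natDegree v.1 v.2 ^ r * R ≠ 0 := by
      refine mul_ne_zero (pow_ne_zero _ ?_) D.R_ne_zero
      have := D.form_h_ne_zero (toR v) (toR_ne_zero hv)
      simp only [toR, ← form_intCast] at this
      exact_mod_cast this
    have h4 := Int.le_of_dvd (abs_pos.2 h3) ((dvd_abs _ _).2 h2)
    have h5 : (k : ℝ) ^ 12 ≤ |form h h.natDegree (toR v).1 (toR v).2| ^ r * |(R : ℝ)| := by
      rw [abs_mul, abs_pow] at h4
      simp only [toR, ← form_intCast]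
      exact_mod_cast h4
    calc (k : ℝ) ^ 12 ≤ _ := h5
      _ ≤ (K * (C * gauge f g m (toR v)) ^ h.natDegree) ^ r * |(R : ℝ)| := by
        have := hG.norm_le (toR v)
        gcongr
        exact (hle _).trans (by gcongr)
      _ = |(R : ℝ)| * (K * C ^ h.natDegree) ^ r * gauge f g m (toR v) ^ d := by
        rw [hd, mul_comm r, pow_mul]; ring
      _ ≤ _ := by gcongr; exact le_max_right _ _
  -- The radius itself contains `k^(1/m)`, which returns a factor `k^d` on the right; since `12m = n
  -- + d`, cancelling it leaves `k^n`.
  have h6 : ((k : ℝ) ^ n) * (k : ℝ) ^ d ≤ (L ^ m * X ^ (d * m)) * (k : ℝ) ^ d := by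
    calc (k : ℝ) ^ n * (k : ℝ) ^ d = ((k : ℝ) ^ 12) ^ m := by
          rw [← pow_add, ← pow_mul, ← D.deg_add, add_comm]
      _ ≤ (L * radius m X k ^ d) ^ m := by
          gcongr
          exact h1.trans (by gcongr)
      _ = L ^ m * (radius m X k ^ m) ^ d := by rw [mul_pow, ← pow_mul, ← pow_mul, mul_comm d]
      _ = _ := by rw [radius_pow D.one_le_m, mul_pow, ← pow_mul, mul_comm d]; ring
  exact le_of_mul_le_mul_right h6 (by positivity)

/-- The sieve term at `k`. -/
noncomputable def sieveTerm (hG : IsGauge (gauge f g m) C) (X : ℝ) {q : ℕ} (α : P1 q) (k : ℕ) : ℝ :=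
  ∑ x ∈ k.divisorsAntidiagonal, (μ x.1 : ℝ) * #(condPts hG (radius m X x.2) α k)

end FamilyData

lemma sum_divisors_sum_moebius (F : ℕ → ℝ) {E : ℕ} (hE : 0 < E) :
    ∑ k ∈ E.divisors, ∑ x ∈ k.divisorsAntidiagonal, (μ x.1 : ℝ) * F x.2 = F E :=
  ArithmeticFunction.sum_eq_iff_sum_mul_moebius_eq.2 (fun _ _ => rfl) E hE

namespace FamilyData

variable {f g h F G : ℤ[X]} {m r n : ℕ} {R : ℤ} {C : ℝ}

/-- For fixed `v`, the indicator of `G(v) ≤ radius e` is a function of `e`. Möbius inversion writes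
its value at the defect as a sum over `k ∣ defect`, i.e. over `k` satisfying the local condition,
and exchanging the sums gives the sieve. -/
theorem ncard_ballSet_eq (D : FamilyData f g m r h F G n R) (hG : IsGauge (gauge f g m) C)
    {X : ℝ} (hX : 0 ≤ X) {q : ℕ} (α : P1 q) {Y : ℕ}
    (hY : ∀ (v : ℤ × ℤ) (k : ℕ), Int.gcd v.1 v.2 = 1 →
      LocalCond f g m k v.1 v.2 → gauge f g m (toR v) ≤ radius m X k → k ≤ Y) :
    (ballSet f g m X α).Finite ∧
      ((ballSet f g m X α).ncard : ℝ) = ∑ k ∈ Icc 1 Y, sieveTerm hG X α k := by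
  set P : Finset (ℤ × ℤ) := {w ∈ hG.pts (radius m X Y) | α.Rep w.1 w.2 ∧ Int.gcd w.1 w.2 = 1}
    with hP
  set H : ℤ × ℤ → ℕ → ℝ := fun v e => if gauge f g m (toR v) ≤ radius m X e then 1 else 0 with hH
  have hset : ballSet f g m X α =
      ({v ∈ P | gauge f g m (toR v) ≤ radius m X (defect f g m v)} : Finset (ℤ × ℤ)) := by
    ext v
    simp only [ballSet, Set.mem_ofPred_eq, hP, coe_filter, mem_filter, IsGauge.mem_pts]
    refine ⟨fun ⟨h1, h2, h3⟩ => ⟨⟨h3.trans (radius_mono m hX ?_), h2, h1⟩, h3⟩,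
      fun ⟨⟨_, h2, h1⟩, h3⟩ => ⟨h1, h2, h3⟩⟩
    exact hY v _ h1 ((D.dvd_defect_iff h1 _).1 dvd_rfl) h3
  refine ⟨hset ▸ finite_toSet _, ?_⟩
  have hpt : ∀ v ∈ P, H v (defect f g m v) = ∑ k ∈ Icc 1 Y,
      if LocalCond f g m k v.1 v.2 then
        ∑ x ∈ k.divisorsAntidiagonal, (μ x.1 : ℝ) * H v x.2 else 0 := by
    intro v hv
    have hv1 := (mem_filter.1 hv).2.2
    rw [← sum_filter, ← sum_divisors_sum_moebius (H v) (D.one_le_defect hv1)]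
    refine (sum_subset ?_ ?_).symm
    · intro k hk
      have := (mem_filter.1 hk).2
      exact Nat.mem_divisors.2 ⟨(D.dvd_defect_iff hv1 k).2 this, (Nat.pos_iff_ne_zero.1 (D.one_le_defect hv1))⟩
    -- Divisors `k` of the defect beyond `Y` contribute nothing: by the choice of `Y`, `v` lies
    -- outside the ball of radius `radius k`, hence outside all the balls for `l ≤ k`.
    · intro k hk hk'
      have hL := (D.dvd_defect_iff hv1 k).1 (Nat.dvd_of_mem_divisors hk)
      have hk1 := Nat.pos_of_mem_divisors hk
      refine sum_eq_zero fun x hx => ?_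
      rw [hH]
      beta_reduce
      rw [if_neg, mul_zero]
      intro hle
      have hx2 : x.2 ≤ k :=
        Nat.le_of_dvd hk1 (Dvd.intro_left _ (Nat.mem_divisorsAntidiagonal.1 hx).1)
      exact hk' (mem_filter.2 ⟨mem_Icc.2
        ⟨hk1, hY v k hv1 hL (hle.trans (radius_mono m hX hx2))⟩, hL⟩)
  have hcount : ∀ k ∈ Icc 1 Y, ∀ x ∈ k.divisorsAntidiagonal,
      (#(condPts hG (radius m X x.2) α k) : ℝ) =
        ∑ v ∈ P, if LocalCond f g m k v.1 v.2 then H v x.2 else 0 := by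
    intro k hk x hx
    obtain ⟨hk1, hkY⟩ := mem_Icc.1 hk
    have hx2 : x.2 ≤ Y :=
      (Nat.le_of_dvd hk1 (Dvd.intro_left _ (Nat.mem_divisorsAntidiagonal.1 hx).1)).trans hkY
    have h1 : condPts hG (radius m X x.2) α k =
        {v ∈ P | LocalCond f g m k v.1 v.2 ∧ gauge f g m (toR v) ≤ radius m X x.2} := by
      ext v
      simp only [condPts, hP, mem_filter, IsGauge.mem_pts]
      refine ⟨fun ⟨h1, h2, h3, h4⟩ => ⟨⟨h1.trans (radius_mono m hX hx2), h2, h3⟩, h4, h1⟩,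
        fun ⟨⟨_, h2, h3⟩, h4, h1⟩ => ⟨h1, h2, h3, h4⟩⟩
    rw [h1, card_filter, Nat.cast_sum]
    refine sum_congr rfl fun v _ => ?_
    simp only [hH, ite_and]
    split_ifs <;> simp
  rw [hset, Set.ncard_coe_finset, card_filter, Nat.cast_sum]
  calc _ = ∑ v ∈ P, H v (defect f g m v) := sum_congr rfl fun v _ => by simp [hH]
    _ = ∑ v ∈ P, ∑ k ∈ Icc 1 Y, if LocalCond f g m k v.1 v.2 then
        ∑ x ∈ k.divisorsAntidiagonal, (μ x.1 : ℝ) * H v x.2 else 0 := sum_congr rfl hpt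
    _ = ∑ k ∈ Icc 1 Y, ∑ v ∈ P, if LocalCond f g m k v.1 v.2 then
        ∑ x ∈ k.divisorsAntidiagonal, (μ x.1 : ℝ) * H v x.2 else 0 := sum_comm
    _ = _ := by
      refine sum_congr rfl fun k hk => ?_
      have h2 : sieveTerm hG X α k = ∑ x ∈ k.divisorsAntidiagonal, ∑ v ∈ P,
          (μ x.1 : ℝ) * if LocalCond f g m k v.1 v.2 then H v x.2 else 0 :=
        sum_congr rfl fun x hx => by rw [hcount k hk x hx, mul_sum]
      rw [h2, sum_comm]
      refine sum_congr rfl fun v _ => ?_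
      split_ifs <;> simp

/-- A prime dividing `q` and `k` would divide `A` and `B` at a point over `α`, hence at every
representative of `α`, against the gcd hypothesis. -/
lemma condPts_eq_empty (hG : IsGauge (gauge f g m) C) {q : ℕ}
    {α : P1 q} {a b : ℤ} (hα : α.Rep a b)
    (hab : Nat.gcd (Int.gcd (formA f m a b ^ 3) (formB g m a b ^ 2)) q = 1) {k : ℕ}
    (hk : ¬ q.Coprime k) (T : ℝ) : condPts hG T α k = ∅ := by
  refine eq_empty_of_forall_notMem fun v hv => ?_
  obtain ⟨_, h1, h2, h3⟩ := mem_filter.1 hv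
  obtain ⟨p, hp, hpq, hpk⟩ := Nat.Prime.not_coprime_iff_dvd.1 hk
  obtain ⟨c, hca, hcb⟩ := h1.exists_mul hα
  have hred : ∀ z w : ℤ, (z : ZMod q) = (c * w : ℤ) → (z : ZMod p) = (c * w : ℤ) := by
    intro z w hzw
    rw [ZMod.intCast_eq_intCast_iff_dvd_sub] at hzw ⊢
    exact (Int.natCast_dvd_natCast.2 hpq).trans hzw
  obtain ⟨hA, hB⟩ := h3.of_dvd hpk
  rw [formA_eq] at hA
  rw [formB_eq] at hB
  have hA' := form_dvd_of_congr f (4 * m) (hred _ _ hca) (hred _ _ hcb)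
    ((dvd_pow_self _ (by norm_num)).trans hA)
  have hB' := form_dvd_of_congr g (6 * m) (hred _ _ hca) (hred _ _ hcb)
    ((dvd_pow_self _ (by norm_num)).trans hB)
  rw [← formA_eq] at hA'
  rw [← formB_eq] at hB'
  have h4 : p ∣ Int.gcd (formA f m a b ^ 3) (formB g m a b ^ 2) := by
    rw [← Int.natCast_dvd_natCast]
    exact Int.dvd_coe_gcd_iff.2 ⟨dvd_pow hA' (by norm_num), dvd_pow hB' (by norm_num)⟩
  have := Nat.dvd_gcd h4 hpq
  rw [hab] at this
  exact hp.one_lt.ne' (Nat.dvd_one.1 this)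

end FamilyData
end EllFamily

namespace EllFamily
open Finset
open scoped Classical ArithmeticFunction.Moebius ArithmeticFunction.zeta

/-! ### Estimates for the sieve terms -/

lemma radius_sq (m : ℕ) (X : ℝ) (e : ℕ) : radius m X e ^ 2 = X ^ 2 * (e : ℝ) ^ (2 / m : ℝ) := by
  rw [radius, mul_pow, ← Real.rpow_natCast ((e : ℝ) ^ (1 / m : ℝ)), ← Real.rpow_mul (Nat.cast_nonneg e)]
  congr 2
  push_cast
  ring

lemma le_of_mem_divisorsAntidiagonal {k : ℕ} {x : ℕ × ℕ} (hx : x ∈ k.divisorsAntidiagonal) :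
    1 ≤ x.2 ∧ x.2 ≤ k := by
  have h0 := Nat.ne_zero_of_mem_divisorsAntidiagonal hx
  obtain ⟨h1, h2⟩ := Nat.mem_divisorsAntidiagonal.1 hx
  exact ⟨Nat.pos_of_ne_zero h0.2, Nat.le_of_dvd (Nat.pos_of_ne_zero h2) (Dvd.intro_left _ h1)⟩

lemma radius_le_mul {m : ℕ} (hm : 1 ≤ m) {X : ℝ} (hX : 0 ≤ X) {e k : ℕ} (he : e ≤ k) (hk : 1 ≤ k) :
    radius m X e ≤ X * k := by
  have hk1 : (1 : ℝ) ≤ k := by exact_mod_cast hk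
  refine (radius_mono m hX he).trans ?_
  unfold radius
  have h1 : (1 / m : ℝ) ≤ 1 := by
    rw [div_le_one (by exact_mod_cast hm)]; exact_mod_cast hm
  have := Real.rpow_le_rpow_of_exponent_le hk1 h1
  rw [Real.rpow_one] at this
  gcongr

lemma one_le_radius (m : ℕ) {X : ℝ} (hX : 1 ≤ X) {e : ℕ} (he : 1 ≤ e) : 1 ≤ radius m X e :=
  one_le_mul_of_one_le_of_one_le hX (Real.one_le_rpow (by exact_mod_cast he) (by positivity))

namespace FamilyData

variable {f g h F G : ℤ[X]} {m r n : ℕ} {R : ℤ} {C : ℝ}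

/-- Every radius is replaced by the largest one, `radius k`, and the number of nonzero Möbius terms
is `O(k^η)`; this is the second source of `k^η`. -/
lemma exists_abs_sieveTerm_le (D : FamilyData f g m r h F G n R) (hG : IsGauge (gauge f g m) C)
    {η : ℝ} (hη : 0 < η) : ∃ K : ℝ, 0 < K ∧ ∀ q : ℕ, 1 ≤ q → ∀ α : P1 q, ∀ k : ℕ, 1 ≤ k →
      q.Coprime k → ∀ X : ℝ, 0 ≤ X → |sieveTerm hG X α k| ≤
        K * (X ^ 2 / q * (k : ℝ) ^ (2 * η + 2 / m - 12 / r) + (k : ℝ) ^ (2 * η)) := by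
  obtain ⟨K, hK, h1⟩ := D.exists_card_condPts_le hG hη
  obtain ⟨L, hL, h2⟩ := exists_pow_card_primeFactors_le 2 hη
  refine ⟨L * K, by positivity, fun q hq α k hk hqk X hX => ?_⟩
  have hq0 : (0 : ℝ) < q := by exact_mod_cast hq
  have hk0 : (0 : ℝ) < k := by exact_mod_cast hk
  calc |sieveTerm hG X α k| ≤ ∑ x ∈ k.divisorsAntidiagonal,
        |(μ x.1 : ℝ) * #(condPts hG (radius m X x.2) α k)| := abs_sum_le_sum_abs _ _
    _ ≤ ∑ x ∈ k.divisorsAntidiagonal, |(μ x.1 : ℝ)| *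
        (K * (k : ℝ) ^ η * (radius m X k ^ 2 / (q * (k : ℝ) ^ (12 / r : ℝ)) + 1)) := by
        refine sum_le_sum fun x hx => ?_
        rw [abs_mul, Nat.abs_cast]
        refine mul_le_mul_of_nonneg_left ((h1 q hq α k hk hqk _).trans ?_) (abs_nonneg _)
        have := radius_mono m hX (le_of_mem_divisorsAntidiagonal hx).2
        have := radius_nonneg m hX x.2
        gcongr
    _ = (∑ x ∈ k.divisorsAntidiagonal, |(μ x.1 : ℝ)|) *
        (K * (k : ℝ) ^ η * (radius m X k ^ 2 / (q * (k : ℝ) ^ (12 / r : ℝ)) + 1)) := by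
        rw [sum_mul]
    _ ≤ (L * (k : ℝ) ^ η) *
        (K * (k : ℝ) ^ η * (radius m X k ^ 2 / (q * (k : ℝ) ^ (12 / r : ℝ)) + 1)) := by
        gcongr
        exact sum_abs_moebius_le.trans (by exact_mod_cast h2 k hk)
    _ = _ := by
        rw [radius_sq, show 2 * η + 2 / m - 12 / r = η + η + 2 / m - 12 / r by ring,
          show 2 * η = η + η by ring, Real.rpow_sub hk0, Real.rpow_add hk0, Real.rpow_add hk0]
        field_simp

/-- As `radius l ^ 2 = X² l^(2/m)`, the main terms add up to the Jordan totient times `ρ(k)`. -/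
lemma exists_abs_sieveTerm_sub_le (D : FamilyData f g m r h F G n R)
    (hG : IsGauge (gauge f g m) C) : ∃ K : ℝ, 0 ≤ K ∧ ∃ L : ℕ, ∀ q : ℕ, 1 ≤ q → ∀ α : P1 q,
      ∀ k : ℕ, 1 ≤ k → q.Coprime k → ∀ X : ℝ, 1 ≤ X →
        |sieveTerm hG X α k - IsGauge.density (gauge f g m) / Nat.card (P1 q) *
          densTerm f g m r q k * X ^ 2| ≤ K * (q : ℝ) ^ 3 * (k : ℝ) ^ L * (X * √X) := by
  obtain ⟨K, hK, h1⟩ := D.exists_abs_card_condPts_sub_le hG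
  -- The cube comes from the modulus; the three further factors `k` come from the radius, its square
  -- root and the number of divisors.
  refine ⟨K, hK, (12 + R.natAbs) * 3 + 3, fun q hq α k hk hqk X hX => ?_⟩
  have hk1 : (1 : ℝ) ≤ k := by exact_mod_cast hk
  have hX0 : 0 ≤ X := by linarith
  set c := IsGauge.density (gauge f g m) / Nat.card (P1 q) with hc
  have heq : sieveTerm hG X α k - c * densTerm f g m r q k * X ^ 2 =
      ∑ x ∈ k.divisorsAntidiagonal, (μ x.1 : ℝ) *
        (#(condPts hG (radius m X x.2) α k) - c * rho f g m r k * radius m X x.2 ^ 2) := by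
    simp only [mul_sub, sum_sub_distrib]
    rw [sieveTerm, densTerm, if_pos hqk, jordan_apply, sum_mul, mul_sum, sum_mul]
    congr 1
    refine sum_congr rfl fun x _ => ?_
    rw [radius_sq]
    ring
  rw [heq]
  calc _ ≤ ∑ x ∈ k.divisorsAntidiagonal, |(μ x.1 : ℝ) *
        (#(condPts hG (radius m X x.2) α k) - c * rho f g m r k * radius m X x.2 ^ 2)| :=
        abs_sum_le_sum_abs _ _
    _ ≤ ∑ x ∈ k.divisorsAntidiagonal,
        K * ((q : ℝ) * (k : ℝ) ^ (12 + R.natAbs)) ^ 3 * ((X * k) * (√X * k)) := by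
        refine sum_le_sum fun x hx => ?_
        obtain ⟨hx1, hx2⟩ := le_of_mem_divisorsAntidiagonal hx
        have hμ : |(μ x.1 : ℝ)| ≤ 1 := by exact_mod_cast ArithmeticFunction.abs_moebius_le_one
        have hT := radius_le_mul D.one_le_m hX0 hx2 hk
        have hT2 : √(radius m X x.2) ≤ √X * k := by
          rw [← Real.sqrt_sq (by linarith : (0 : ℝ) ≤ k), ← Real.sqrt_mul hX0]
          refine Real.sqrt_le_sqrt (hT.trans ?_)
          gcongr
          exact le_self_pow₀ hk1 (by norm_num)
        rw [abs_mul]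
        calc _ ≤ 1 * (K * ((q : ℝ) * (k : ℝ) ^ (12 + R.natAbs)) ^ 3 *
              (radius m X x.2 * √(radius m X x.2))) := by
              gcongr
              exact h1 q hq α k hk hqk _ (one_le_radius m hX hx1)
          _ ≤ _ := by rw [one_mul]; gcongr
    _ = #k.divisors * (K * ((q : ℝ) * (k : ℝ) ^ (12 + R.natAbs)) ^ 3 * ((X * k) * (√X * k))) := by
        rw [sum_const, nsmul_eq_mul, ← Nat.map_div_right_divisors, card_map]
    _ ≤ k * (K * ((q : ℝ) * (k : ℝ) ^ (12 + R.natAbs)) ^ 3 * ((X * k) * (√X * k))) := by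
        gcongr
        exact Nat.card_divisors_le_self k
    _ = _ := by ring

lemma sieveTerm_eq_zero {hG : IsGauge (gauge f g m) C} {q k : ℕ} {α : P1 q}
    (h : ∀ T, condPts hG T α k = ∅) (X : ℝ) : sieveTerm hG X α k = 0 :=
  sum_eq_zero fun x _ => by rw [h, card_empty, Nat.cast_zero, mul_zero]

/-- When `k` and `q` are both at most `z`, the asymptotics apply with a loss polynomial in `z`.
Otherwise the sieve term and its main term are bounded separately; both carry `k^(-1-2θ)/q`, and
whichever of `k`, `q` exceeds `z` yields `z^(-θ)`. No bound on `q` in terms of `X` is needed. -/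
lemma exists_abs_sieveTerm_sub_densTerm_le (D : FamilyData f g m r h F G n R)
    (hG : IsGauge (gauge f g m) C) {η₀ : ℝ} (hη₀ : 0 < η₀) :
    ∃ θ η K : ℝ, 0 < θ ∧ 0 < η ∧ η ≤ η₀ ∧ 0 < K ∧ ∃ L : ℕ, ∀ q : ℕ, 1 ≤ q →
      (∀ Y : ℕ, 1 ≤ Y → |∑' k, densTerm f g m r q k - ∑ k ∈ Icc 1 Y, densTerm f g m r q k| ≤
        K * (Y : ℝ) ^ (-θ)) ∧
      ∀ α : P1 q, (∀ k, ¬ q.Coprime k → ∀ T, condPts hG T α k = ∅) → ∀ k : ℕ, 1 ≤ k →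
        ∀ z : ℝ, 1 ≤ z → ∀ X : ℝ, 1 ≤ X →
        |sieveTerm hG X α k - IsGauge.density (gauge f g m) / Nat.card (P1 q) *
          densTerm f g m r q k * X ^ 2| ≤ (if (k : ℝ) ≤ z then K * z ^ (L + 3) * (X * √X) else 0) +
            K * (X ^ 2 * z ^ (-θ) * (k : ℝ) ^ (-1 - θ) + (k : ℝ) ^ (2 * η)) := by
  obtain ⟨θ, A, hθ, hA, hθe, hdens⟩ := D.exists_densTerm_le hG
  have hθ1 : θ ≤ 1 := by
    have h1 : (1 : ℝ) ≤ r := by exact_mod_cast D.one_le_r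
    have h2 : (12 : ℝ) / r ≤ 12 := div_le_self (by norm_num) h1
    have h3 : (0 : ℝ) ≤ 2 / m := by positivity
    linarith
  set η := min η₀ θ with hη
  have hη0 : 0 < η := lt_min hη₀ hθ
  obtain ⟨K₁, hK₁, hup⟩ := D.exists_abs_sieveTerm_le hG hη0
  obtain ⟨K₂, hK₂, L, has⟩ := D.exists_abs_sieveTerm_sub_le hG
  set κ := IsGauge.density (gauge f g m) with hκ
  have hκ0 : 0 < κ := hG.density_pos
  set B := A * ∑' k : ℕ, (k : ℝ) ^ (-1 - θ) with hB
  have hB0 : 0 ≤ B := mul_nonneg hA.le (tsum_nonneg fun _ => by positivity)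
  refine ⟨θ, η, K₁ + K₂ + κ * A + B, hθ, hη0, min_le_left _ _, by positivity, L, fun q hq => ⟨?_, ?_⟩⟩
  · intro Y hY
    refine (abs_tsum_sub_sum_Icc_le hθ (densTerm_zero q) (hdens q) hY).2.trans ?_
    rw [← hB]
    gcongr
    nlinarith
  intro α hα k hk z hz X hX
  have hX0 : 0 ≤ X := by linarith
  have hz0 : 0 < z := by linarith
  have hk1 : (1 : ℝ) ≤ k := by exact_mod_cast hk
  have hk0 : (0 : ℝ) < k := by linarith
  have hq1 : (1 : ℝ) ≤ q := by exact_mod_cast hq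
  have hq0 : (0 : ℝ) < q := by linarith
  set K := K₁ + K₂ + κ * A + B with hK
  have hK0 : 0 < K := by positivity
  have hrest : 0 ≤ K * (X ^ 2 * z ^ (-θ) * (k : ℝ) ^ (-1 - θ) + (k : ℝ) ^ (2 * η)) := by positivity
  by_cases hc : q.Coprime k
  swap
  · rw [sieveTerm_eq_zero (hα k hc), densTerm, if_neg hc]
    simp only [mul_zero, zero_mul, sub_zero, abs_zero]
    refine add_nonneg ?_ hrest
    split_ifs <;> positivity
  by_cases hsmall : (k : ℝ) ≤ z ∧ (q : ℝ) ≤ z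
  · rw [if_pos hsmall.1]
    refine (has q hq α k hk hc X hX).trans (le_trans ?_ (le_add_of_nonneg_right hrest))
    calc _ ≤ K₂ * z ^ 3 * z ^ L * (X * √X) := by
          have := hsmall.1
          have := hsmall.2
          gcongr
      _ = K₂ * z ^ (L + 3) * (X * √X) := by ring
      _ ≤ _ := by
          gcongr
          rw [hK]
          nlinarith [mul_pos hκ0 hA]
  -- A large `k` gives up half of its excess decay; a large `q` uses `1/q ≤ 1/z ≤ z^(-θ)`, where `θ
  -- ≤ 1` enters.
  have hgain : (k : ℝ) ^ (-1 - 2 * θ) / q ≤ z ^ (-θ) * (k : ℝ) ^ (-1 - θ) := by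
    have h1 : (k : ℝ) ^ (-θ) / q ≤ z ^ (-θ) := by
      rw [not_and_or, not_le, not_le] at hsmall
      rcases hsmall with hlt | hlt
      · exact (div_le_self (by positivity) hq1).trans
          (Real.rpow_le_rpow_of_nonpos hz0 hlt.le (by linarith))
      · have h2 : (k : ℝ) ^ (-θ) ≤ 1 := Real.rpow_le_one_of_one_le_of_nonpos hk1 (by linarith)
        calc (k : ℝ) ^ (-θ) / q ≤ 1 / z := by gcongr
          _ = z ^ (-1 : ℝ) := by rw [Real.rpow_neg_one, one_div]
          _ ≤ _ := Real.rpow_le_rpow_of_exponent_le hz (by linarith)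
    calc _ = (k : ℝ) ^ (-1 - θ) * ((k : ℝ) ^ (-θ) / q) := by
          rw [show -1 - 2 * θ = -1 - θ + -θ by ring, Real.rpow_add hk0]; ring
      _ ≤ (k : ℝ) ^ (-1 - θ) * z ^ (-θ) := by gcongr
      _ = _ := mul_comm _ _
  have hs : |sieveTerm hG X α k| ≤
      K₁ * (X ^ 2 * (z ^ (-θ) * (k : ℝ) ^ (-1 - θ)) + (k : ℝ) ^ (2 * η)) := by
    refine (hup q hq α k hk hc X hX0).trans
      (mul_le_mul_of_nonneg_left (add_le_add ?_ le_rfl) hK₁.le)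
    calc _ ≤ X ^ 2 / q * (k : ℝ) ^ (-1 - 2 * θ) := by
          refine mul_le_mul_of_nonneg_left (Real.rpow_le_rpow_of_exponent_le hk1 ?_) (by positivity)
          have : η ≤ θ := min_le_right _ _
          linarith
      _ = X ^ 2 * ((k : ℝ) ^ (-1 - 2 * θ) / q) := by ring
      _ ≤ _ := by gcongr
  have hd : |κ / Nat.card (P1 q) * densTerm f g m r q k * X ^ 2| ≤
      κ * A * (X ^ 2 * (z ^ (-θ) * (k : ℝ) ^ (-1 - θ))) := by
    have : NeZero q := ⟨by omega⟩
    have hM : (q : ℝ) ≤ Nat.card (P1 q) := by exact_mod_cast P1.le_card q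
    have hM0 : (0 : ℝ) < Nat.card (P1 q) := by linarith
    rw [abs_mul, abs_mul, abs_of_pos (by positivity : 0 < κ / Nat.card (P1 q)),
      abs_of_nonneg (sq_nonneg X)]
    calc _ ≤ κ / q * (A * (k : ℝ) ^ (-1 - 2 * θ)) * X ^ 2 := by
          gcongr
          exact hdens q k hk
      _ = κ * A * (X ^ 2 * ((k : ℝ) ^ (-1 - 2 * θ) / q)) := by ring
      _ ≤ _ := by gcongr
  have hfirst : 0 ≤ if (k : ℝ) ≤ z then K * z ^ (L + 3) * (X * √X) else 0 := by
    split_ifs <;> positivity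
  refine (abs_sub _ _).trans ((add_le_add hs hd).trans (le_trans ?_ (le_add_of_nonneg_left hfirst)))
  set a := X ^ 2 * (z ^ (-θ) * (k : ℝ) ^ (-1 - θ)) with ha
  have ha0 : 0 ≤ a := by positivity
  have hb0 : 0 ≤ (k : ℝ) ^ (2 * η) := by positivity
  have : X ^ 2 * z ^ (-θ) * (k : ℝ) ^ (-1 - θ) = a := by rw [ha]; ring
  rw [this]
  calc _ ≤ (K₁ + κ * A) * (a + (k : ℝ) ^ (2 * η)) := by
        have : 0 ≤ κ * A * (k : ℝ) ^ (2 * η) := by positivity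
        linarith
    _ ≤ _ := by
        gcongr
        linarith

end FamilyData
end EllFamily

namespace EllFamily
open Finset
open scoped Classical

/-! ### Counting points of bounded height in a class -/

namespace FamilyData

variable {f g h F G : ℤ[X]} {m r n : ℕ} {R : ℤ} {C : ℝ}

/-- With `d = deg s` and `n = 12m - d`, the bound `k^n = O(X^(dm))` has `dm < 2n` exactly when `d(2
+ m) < 24m`. So fewer than about `X²` values of `k` occur, and the terms `1` in the uniform bound
stay below the main term. -/
lemma exists_le_rpow_of_localCond (D : FamilyData f g m r h F G n R)
    (hG : IsGauge (gauge f g m) C) : ∃ β K : ℝ, 1 ≤ β ∧ β < 2 ∧ 1 ≤ K ∧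
      ∀ (v : ℤ × ℤ) (k : ℕ) (X : ℝ), Int.gcd v.1 v.2 = 1 → LocalCond f g m k v.1 v.2 → 1 ≤ X →
        gauge f g m (toR v) ≤ radius m X k → (k : ℝ) ≤ K * X ^ β := by
  obtain ⟨K, hK, hle⟩ := D.exists_le_of_localCond hG
  have hn := D.one_le_n
  have hn0 : (0 : ℝ) < n := by exact_mod_cast hn
  have h1 : (r * h.natDegree * m : ℕ) < 2 * n := by
    have h2 := D.lt_deg
    have h3 := D.deg_add
    have h4 : r * h.natDegree * (2 + m) = 2 * (r * h.natDegree) + r * h.natDegree * m := by ring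
    omega
  have h1' : ((r * h.natDegree * m : ℕ) : ℝ) < 2 * n := by exact_mod_cast h1
  set β : ℝ := max 1 ((r * h.natDegree * m : ℕ) / n) with hβ
  refine ⟨β, K, le_max_left _ _, max_lt (by norm_num) ((div_lt_iff₀ hn0).2 h1'), hK,
    fun v k X hv hk hX hT => ?_⟩
  have hX0 : 0 ≤ X := by linarith
  refine (pow_le_pow_iff_left₀ (Nat.cast_nonneg k) (by positivity) (by omega : n ≠ 0)).1 ?_
  refine (hle v k X hv hk hX0 hT).trans ?_
  rw [mul_pow]
  have h5 : X ^ (r * h.natDegree * m) ≤ (X ^ β) ^ n := by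
    rw [← Real.rpow_natCast, ← Real.rpow_natCast, ← Real.rpow_mul hX0]
    refine Real.rpow_le_rpow_of_exponent_le hX ?_
    rw [← div_le_iff₀ hn0]
    exact le_max_right _ _
  exact mul_le_mul (le_self_pow₀ hK (by omega)) h5 (by positivity) (by positivity)

lemma finite_ballSet (D : FamilyData f g m r h F G n R) (hG : IsGauge (gauge f g m) C) {X : ℝ}
    (hX : 1 ≤ X) {q : ℕ} (α : P1 q) : (ballSet f g m X α).Finite := by
  obtain ⟨β, K, -, -, -, hle⟩ := D.exists_le_rpow_of_localCond hG
  exact (D.ncard_ballSet_eq hG (by linarith) α (Y := ⌊K * X ^ β⌋₊)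
    fun v k hv hk hT => Nat.le_floor (hle v k X hv hk hX hT)).1

lemma sum_Icc_ite_le {Y : ℕ} {z E : ℝ} (hz : 0 ≤ z) (hE : 0 ≤ E) :
    ∑ k ∈ Icc (1 : ℕ) Y, (if (k : ℝ) ≤ z then E else 0) ≤ z * E := by
  rw [← sum_filter, sum_const, nsmul_eq_mul]
  gcongr
  refine le_trans ?_ (Nat.floor_le hz)
  have h1 : Finset.filter (fun k : ℕ => (k : ℝ) ≤ z) (Icc 1 Y) ⊆ Icc 1 ⌊z⌋₊ := fun k hk => by
    obtain ⟨hk1, hk2⟩ := mem_filter.1 hk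
    exact mem_Icc.2 ⟨(mem_Icc.1 hk1).1, Nat.le_floor hk2⟩
  have := card_le_card h1
  rw [Nat.card_Icc, Nat.add_sub_cancel] at this
  exact_mod_cast this

/-- The sieve is summed up to `Y`, of order `X^β`, with threshold `z = X^δ`. Four errors arise, each
saving a power of `X`: the asymptotics for small `k`, the factor `z^(-θ)`, the number of `k`, and
the tail of the density series. -/
theorem exists_abs_ncard_ballSet_sub_le (D : FamilyData f g m r h F G n R)
    (hG : IsGauge (gauge f g m) C) : ∃ ε K : ℝ, 0 < ε ∧ 0 < K ∧ ∀ q : ℕ, 1 ≤ q → ∀ α : P1 q,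
      (∀ k, ¬ q.Coprime k → ∀ T, condPts hG T α k = ∅) → ∀ X : ℝ, 1 ≤ X →
        |((ballSet f g m X α).ncard : ℝ) - IsGauge.density (gauge f g m) / Nat.card (P1 q) *
          (∑' k, densTerm f g m r q k) * X ^ 2| ≤ K * X ^ (2 - ε) := by
  obtain ⟨β, K₀, hβ1, hβ2, hK₀, hbound⟩ := D.exists_le_rpow_of_localCond hG
  -- The choice of `η₀` gives `β(1 + 2η) ≤ β + 4η ≤ 2 - (2 - β)/2`.
  obtain ⟨θ, η, K, hθ, hη, hηle, hK, L, hterm⟩ :=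
    D.exists_abs_sieveTerm_sub_densTerm_le hG (η₀ := (2 - β) / 8) (by linarith)
  set κ := IsGauge.density (gauge f g m) with hκ
  have hκ0 : 0 < κ := hG.density_pos
  -- This makes `z^(L+4) = X^(1/4)`, so the small `k` contribute `O(X^(7/4))`.
  set δ : ℝ := 1 / (4 * (L + 4 : ℕ)) with hδ
  have hδ0 : 0 < δ := by positivity
  have hδ1 : δ ≤ 1 := by
    rw [hδ, div_le_one (by positivity)]
    push_cast
    linarith [(Nat.cast_nonneg L : (0 : ℝ) ≤ L)]
  set ζ := ∑' k : ℕ, (k : ℝ) ^ (-1 - θ) with hζ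
  have hζ0 : 0 ≤ ζ := tsum_nonneg fun _ => by positivity
  set ε := min (1 / 4) (min (δ * θ) ((2 - β) / 2)) with hε
  have hε0 : 0 < ε := lt_min (by norm_num) (lt_min (by positivity) (by linarith))
  have hε1 : ε ≤ 1 / 4 := min_le_left _ _
  have hε2 : ε ≤ δ * θ := (min_le_right _ _).trans (min_le_left _ _)
  have hε3 : ε ≤ (2 - β) / 2 := (min_le_right _ _).trans (min_le_right _ _)
  refine ⟨ε, K + K * ζ + K * (2 * K₀) ^ (1 + 2 * η) + κ * K, hε0, by positivity,
    fun q hq α hα X hX => ?_⟩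
  obtain ⟨htail, hsieve⟩ := hterm q hq
  have hX0 : 0 < X := by linarith
  set z := X ^ δ with hz
  have hz1 : 1 ≤ z := Real.one_le_rpow hX hδ0.le
  set Y := ⌈K₀ * X ^ β⌉₊ with hY
  -- Here `β ≥ 1` is used: the cut-off `Y` is at least `X`, so the tail of the density series saves
  -- `X^(-θ)`.
  have hXβ : X ≤ K₀ * X ^ β := by
    calc X = 1 * X ^ (1 : ℝ) := by rw [Real.rpow_one, one_mul]
      _ ≤ K₀ * X ^ β := by gcongr
  have hYX : X ≤ Y := hXβ.trans (Nat.le_ceil _)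
  have hY1 : 1 ≤ Y := by exact_mod_cast hX.trans hYX
  have hYle : (Y : ℝ) ≤ 2 * K₀ * X ^ β := by
    have := (Nat.ceil_lt_add_one (by positivity : 0 ≤ K₀ * X ^ β)).le
    rw [← hY] at this
    linarith
  have hYpos : (0 : ℝ) < Y := by exact_mod_cast hY1
  obtain ⟨-, hcard⟩ := D.ncard_ballSet_eq hG hX0.le α (Y := Y) fun v k hv hk hT => by
    exact_mod_cast (hbound v k X hv hk hX hT).trans (Nat.le_ceil _)
  have hM : (1 : ℝ) ≤ Nat.card (P1 q) := by
    have : NeZero q := ⟨by omega⟩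
    exact_mod_cast P1.card_pos q
  set c := κ / Nat.card (P1 q) with hc
  have hcκ : c ≤ κ := div_le_self hκ0.le hM
  have hc0 : 0 ≤ c := by positivity
  have hrpow : ∀ {a : ℝ}, a ≤ 2 - ε → X ^ a ≤ X ^ (2 - ε) := fun h =>
    Real.rpow_le_rpow_of_exponent_le hX h
  have hsplit : ((ballSet f g m X α).ncard : ℝ) - c * (∑' k, densTerm f g m r q k) * X ^ 2 =
      ∑ k ∈ Icc 1 Y, (sieveTerm hG X α k - c * densTerm f g m r q k * X ^ 2) -
        c * (∑' k, densTerm f g m r q k - ∑ k ∈ Icc 1 Y, densTerm f g m r q k) * X ^ 2 := by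
    rw [hcard, sum_sub_distrib, ← sum_mul, ← mul_sum]
    ring
  have htailX : |c * (∑' k, densTerm f g m r q k - ∑ k ∈ Icc 1 Y, densTerm f g m r q k) * X ^ 2| ≤
      κ * K * X ^ (2 - ε) := by
    rw [abs_mul, abs_mul, abs_of_nonneg hc0, abs_of_nonneg (sq_nonneg X)]
    calc _ ≤ κ * (K * X ^ (-θ)) * X ^ 2 := by
          have h1 : (Y : ℝ) ^ (-θ) ≤ X ^ (-θ) :=
            Real.rpow_le_rpow_of_nonpos hX0 hYX (by linarith)
          have h2 := htail Y hY1
          gcongr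
          exact h2.trans (by gcongr)
      _ = κ * K * X ^ (-θ + 2) := by
          rw [Real.rpow_add hX0, Real.rpow_two]; ring
      _ ≤ _ := by
          refine mul_le_mul_of_nonneg_left (hrpow ?_) (by positivity)
          nlinarith
  have hfirst : z * (K * z ^ (L + 3) * (X * √X)) ≤ K * X ^ (2 - ε) := by
    have h1 : z ^ (L + 4) = X ^ (1 / 4 : ℝ) := by
      rw [hz, ← Real.rpow_natCast, ← Real.rpow_mul hX0.le, hδ]
      congr 1
      field_simp
    calc z * (K * z ^ (L + 3) * (X * √X)) = K * (z ^ (L + 4) * (X * √X)) := by ring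
      _ = K * X ^ (1 / 4 + 1 + 1 / 2 : ℝ) := by
        rw [h1, Real.rpow_add hX0, Real.rpow_add hX0, Real.rpow_one, Real.sqrt_eq_rpow]
        ring
      _ ≤ _ := mul_le_mul_of_nonneg_left (hrpow (by linarith)) hK.le
  have hsecond : X ^ 2 * z ^ (-θ) ≤ X ^ (2 - ε) := by
    calc X ^ 2 * z ^ (-θ) = X ^ (2 + δ * -θ) := by
          rw [hz, ← Real.rpow_mul hX0.le, Real.rpow_add hX0, Real.rpow_two]
      _ ≤ _ := hrpow (by linarith)
  have hthird : (Y : ℝ) * (Y : ℝ) ^ (2 * η) ≤ (2 * K₀) ^ (1 + 2 * η) * X ^ (2 - ε) := by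
    calc (Y : ℝ) * (Y : ℝ) ^ (2 * η) = (Y : ℝ) ^ (1 + 2 * η) := by
          rw [Real.rpow_add hYpos, Real.rpow_one]
      _ ≤ (2 * K₀ * X ^ β) ^ (1 + 2 * η) := by gcongr
      _ = (2 * K₀) ^ (1 + 2 * η) * X ^ (β * (1 + 2 * η)) := by
          rw [Real.mul_rpow (by positivity) (by positivity), ← Real.rpow_mul hX0.le]
      _ ≤ _ := by
          refine mul_le_mul_of_nonneg_left (hrpow ?_) (by positivity)
          nlinarith
  have hmain : |∑ k ∈ Icc 1 Y, (sieveTerm hG X α k - c * densTerm f g m r q k * X ^ 2)| ≤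
      (K + K * ζ + K * (2 * K₀) ^ (1 + 2 * η)) * X ^ (2 - ε) := by
    calc _ ≤ ∑ k ∈ Icc 1 Y, |sieveTerm hG X α k - c * densTerm f g m r q k * X ^ 2| :=
          abs_sum_le_sum_abs _ _
      _ ≤ ∑ k ∈ Icc 1 Y, ((if (k : ℝ) ≤ z then K * z ^ (L + 3) * (X * √X) else 0) +
          K * (X ^ 2 * z ^ (-θ) * (k : ℝ) ^ (-1 - θ) + (k : ℝ) ^ (2 * η))) :=
          sum_le_sum fun k hk => hsieve α hα k (mem_Icc.1 hk).1 z hz1 X hX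
      _ = ∑ k ∈ Icc 1 Y, (if (k : ℝ) ≤ z then K * z ^ (L + 3) * (X * √X) else 0) +
          K * (X ^ 2 * z ^ (-θ) * ∑ k ∈ Icc 1 Y, (k : ℝ) ^ (-1 - θ) +
            ∑ k ∈ Icc 1 Y, (k : ℝ) ^ (2 * η)) := by
          rw [sum_add_distrib, ← mul_sum, sum_add_distrib, ← mul_sum]
      _ ≤ z * (K * z ^ (L + 3) * (X * √X)) +
          K * (X ^ 2 * z ^ (-θ) * ζ + Y * (Y : ℝ) ^ (2 * η)) := by
          gcongr
          · exact sum_Icc_ite_le (by linarith) (by positivity)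
          · exact (Real.summable_nat_rpow.2 (by linarith)).sum_le_tsum _ fun _ _ => by positivity
          · calc _ ≤ ∑ k ∈ Icc 1 Y, (Y : ℝ) ^ (2 * η) := by
                  refine sum_le_sum fun k hk => ?_
                  have : (k : ℝ) ≤ Y := by exact_mod_cast (mem_Icc.1 hk).2
                  gcongr
              _ = _ := by rw [sum_const, Nat.card_Icc, Nat.add_sub_cancel, nsmul_eq_mul]
      _ ≤ K * X ^ (2 - ε) + K * (X ^ (2 - ε) * ζ + (2 * K₀) ^ (1 + 2 * η) * X ^ (2 - ε)) :=
          add_le_add hfirst (mul_le_mul_of_nonneg_left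
            (add_le_add (mul_le_mul_of_nonneg_right hsecond hζ0) hthird) hK.le)
      _ = _ := by ring
  rw [hsplit]
  refine (abs_sub _ _).trans ((add_le_add hmain htailX).trans_eq ?_)
  ring

lemma localFactor_nonneg (D : FamilyData f g m r h F G n R) (hG : IsGauge (gauge f g m) C) {p : ℕ}
    (hp : p.Prime) : 0 ≤ localFactor f g m r p :=
  inv_nonneg.1 (zero_le_one.trans (D.one_le_inv_localFactor hG hp))

lemma localFactor_le_one (D : FamilyData f g m r h F G n R) (hG : IsGauge (gauge f g m) C) {p : ℕ}
    (hp : p.Prime) : localFactor f g m r p ≤ 1 := by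
  have := inv_le_one_of_one_le₀ (D.one_le_inv_localFactor hG hp)
  rwa [inv_inv] at this

lemma one_le_tsum_densTerm (D : FamilyData f g m r h F G n R) (hG : IsGauge (gauge f g m) C)
    (q : ℕ) : 1 ≤ ∑' k, densTerm f g m r q k := by
  rw [← densTerm_one (f := f) (g := g) (m := m) (r := r) q]
  exact (D.summable_densTerm hG q).le_tsum 1 fun k _ => densTerm_nonneg q k

/-- Numerator and denominator have main terms in the exact ratio `t`, and `t ≤ 1`, so `a - t b` is
at most twice the error; it remains to divide by `b`. -/
theorem exists_abs_ratio_sub_le (D : FamilyData f g m r h F G n R)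
    (hG : IsGauge (gauge f g m) C) : ∃ ε K : ℝ, 0 < ε ∧ 0 < K ∧ ∀ q : ℕ, 1 ≤ q → ∀ α : P1 q,
      (∀ k, ¬ q.Coprime k → ∀ T, condPts hG T α k = ∅) → ∀ α₀ : P1 1, ∀ X : ℝ, 1 ≤ X →
        (ballSet f g m X α₀).Nonempty →
        |((ballSet f g m X α).ncard : ℝ) / (ballSet f g m X α₀).ncard -
          1 / Nat.card (P1 q) * ∏ p ∈ q.primeFactors, localFactor f g m r p| ≤ K * X ^ (-ε) := by
  obtain ⟨ε, K, hε, hK, hcount⟩ := D.exists_abs_ncard_ballSet_sub_le hG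
  set κ := IsGauge.density (gauge f g m) with hκ
  have hκ0 : 0 < κ := hG.density_pos
  refine ⟨ε, 4 * K / κ, hε, by positivity, fun q hq α hα α₀ X hX hne => ?_⟩
  have hX0 : 0 < X := by linarith
  have hM : (1 : ℝ) ≤ Nat.card (P1 q) := by
    have : NeZero q := ⟨by omega⟩
    exact_mod_cast P1.card_pos q
  have hM1 : Nat.card (P1 1) = 1 :=
    le_antisymm ((P1.card_le 1).trans_eq (one_pow 2)) (P1.card_pos 1)
  have h1 := hcount q hq α hα X hX
  have h2 := hcount 1 le_rfl α₀ (fun k hk => (hk (Nat.coprime_one_left k)).elim) X hX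
  rw [hM1, Nat.cast_one, div_one] at h2
  rw [← D.tsum_densTerm_mul hG hq] at h1
  set W := ∑' k, densTerm f g m r 1 k with hW
  have hW1 : 1 ≤ W := D.one_le_tsum_densTerm hG 1
  set Λ := ∏ p ∈ q.primeFactors, localFactor f g m r p with hΛ
  have hΛ0 : 0 ≤ Λ := prod_nonneg fun p hp =>
    D.localFactor_nonneg hG (Nat.prime_of_mem_primeFactors hp)
  have hΛ1 : Λ ≤ 1 := prod_le_one
    (fun p hp => D.localFactor_nonneg hG (Nat.prime_of_mem_primeFactors hp))
    fun p hp => D.localFactor_le_one hG (Nat.prime_of_mem_primeFactors hp)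
  set t := 1 / Nat.card (P1 q) * Λ with ht
  have hinv : (1 : ℝ) / Nat.card (P1 q) ≤ 1 := by rw [div_le_one (by linarith)]; exact hM
  have ht0 : 0 ≤ t := by positivity
  have ht1 : t ≤ 1 := mul_le_one₀ hinv hΛ0 hΛ1
  have hfin := D.finite_ballSet hG hX α₀
  set b : ℝ := ((ballSet f g m X α₀).ncard : ℝ) with hb
  have hb0 : 0 < b := Nat.cast_pos.2 ((Set.ncard_pos hfin).2 hne)
  set a : ℝ := ((ballSet f g m X α).ncard : ℝ) with ha
  have ha0 : 0 ≤ a := Nat.cast_nonneg _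
  have hab : a ≤ b := by
    have : ballSet f g m X α ⊆ ballSet f g m X α₀ := by
      rintro v ⟨hv1, -, hv3⟩
      refine ⟨hv1, ?_, hv3⟩
      obtain ⟨x, y, hxy⟩ := α₀.exists_rep
      exact hxy.iff.2 ⟨isCoprime_zmod_of_gcd_eq_one 1 hv1, by simp⟩
    exact Nat.cast_le.2 (Set.ncard_le_ncard this hfin)
  have hXε : X ^ (2 - ε) = X ^ 2 * X ^ (-ε) := by
    rw [sub_eq_add_neg, Real.rpow_add hX0, Real.rpow_two]
  have hXε0 : 0 < X ^ (-ε) := Real.rpow_pos_of_pos hX0 _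
  rw [hXε] at h1 h2
  -- If `b` is below half of `κ X²`, the error term must be at least as large, which bounds `X`
  -- above. Then the trivial bound `1` for a difference of two numbers in `[0, 1]` suffices.
  by_cases hbig : κ * X ^ 2 / 2 ≤ b
  · have h3 : |a - t * b| ≤ 2 * (K * (X ^ 2 * X ^ (-ε))) := by
      have h4 : a - t * b = (a - κ / Nat.card (P1 q) * (W * Λ) * X ^ 2) -
          t * (b - κ * W * X ^ 2) := by rw [ht]; ring
      rw [h4, two_mul]
      refine (abs_sub _ _).trans (add_le_add h1 ?_)
      rw [abs_mul, abs_of_nonneg ht0]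
      exact (mul_le_of_le_one_left (abs_nonneg _) ht1).trans h2
    have h5 : a / b - t = (a - t * b) / b := by field_simp
    rw [h5, abs_div, abs_of_pos hb0, div_le_iff₀ hb0]
    calc _ ≤ 2 * (K * (X ^ 2 * X ^ (-ε))) := h3
      _ = 4 * K / κ * X ^ (-ε) * (κ * X ^ 2 / 2) := by field_simp; ring
      _ ≤ _ := by gcongr
  · have h3 : |a / b - t| ≤ 1 := by
      have h4 : a / b ≤ 1 := (div_le_one hb0).2 hab
      have h5 : 0 ≤ a / b := by positivity
      exact abs_le.2 ⟨by linarith, by linarith⟩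
    refine h3.trans ?_
    have h4 : κ * X ^ 2 / 2 ≤ K * (X ^ 2 * X ^ (-ε)) := by
      have h5 := (abs_le.1 h2).1
      have h6 : κ * X ^ 2 ≤ κ * W * X ^ 2 := by
        gcongr
        exact le_mul_of_one_le_right hκ0.le hW1
      linarith
    have h5 : κ ≤ 2 * K * X ^ (-ε) := by
      have : X ^ 2 * (κ / 2) ≤ X ^ 2 * (K * X ^ (-ε)) := by linarith
      have := le_of_mul_le_mul_left this (by positivity)
      linarith
    have h6 : 0 < K * X ^ (-ε) := by positivity
    rw [div_mul_eq_mul_div, le_div_iff₀ hκ0]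
    linarith

end FamilyData
end EllFamily

/-! ### The main theorem -/

theorem mainTheorem6 (f g : ℤ[X]) (m r : ℕ) (hm : 1 ≤ m)
    (hroot : ∀ x : ℝ, ¬ (Polynomial.aeval x f = 0 ∧ Polynomial.aeval x g = 0))
    (hdeg : max ((f.natDegree : ℚ) / 2) ((g.natDegree : ℚ) / 3) = 2 * m)
    (hdisc : 4 * f ^ 3 + 27 * g ^ 2 ≠ 0)
    (hs : ∃ κ : ℝ, (m : ℝ) < κ ∧
      ((EllFamily.polyGcd (f ^ 3) (g ^ 2)).natDegree : ℝ) ≤ 24 * m / (2 + κ))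
    (hr : EllFamily.IsPowerExponent (EllFamily.polyGcd (f ^ 3) (g ^ 2)) r) :
    (∀ p : ℕ, p.Prime → Summable fun k : ℕ => EllFamily.localTerm f g m r p (k + 1)) ∧
    (∀ N : ℝ, (EllFamily.countSet f g m N).Finite) ∧
    ∃ ε : ℝ, 0 < ε ∧ ∃ C : ℝ, ∀ (q : ℕ), 1 ≤ q → ∀ (α : EllFamily.P1 q) (a₁ b₁ : ℤ),
      α.Rep a₁ b₁ →
      Nat.gcd (Int.gcd (EllFamily.formA f m a₁ b₁ ^ 3) (EllFamily.formB g m a₁ b₁ ^ 2)) q = 1 →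
      ∀ N : ℝ, (EllFamily.countSet f g m N).Nonempty →
        |((EllFamily.countSetMod f g m N α).ncard : ℝ) / ((EllFamily.countSet f g m N).ncard : ℝ) -
            1 / (Nat.card (EllFamily.P1 q) : ℝ) *
              ∏ p ∈ q.primeFactors, EllFamily.localFactor f g m r p| ≤
          C * N ^ (-ε) := by
  obtain ⟨h, F, G, n, R, D⟩ := EllFamily.exists_familyData hm hroot hdeg hs hr
  obtain ⟨C₀, hG⟩ := D.exists_isGauge
  -- A point modulo `1` imposes no condition, so the full counting set is treated as a class as
  -- well.
  obtain ⟨α₀, -⟩ := EllFamily.P1.exists_of_isCoprime (M := 1) (a := 1) (b := 0)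
    (by simpa using isCoprime_one_left)
  have hX : ∀ {N : ℝ}, 1 ≤ N → 1 ≤ N ^ (1 / (12 * m : ℝ)) := fun hN =>
    Real.one_le_rpow hN (by positivity)
  have hset : ∀ {N : ℝ}, 1 ≤ N → EllFamily.countSet f g m N =
      EllFamily.ballSet f g m (N ^ (1 / (12 * m : ℝ))) α₀ := by
    intro N hN
    rw [← D.countSetMod_eq (by linarith) α₀]
    ext v
    refine ⟨fun hv => ⟨hv, ?_⟩, fun hv => hv.1⟩
    obtain ⟨x, y, hxy⟩ := α₀.exists_rep
    exact hxy.iff.2 ⟨EllFamily.isCoprime_zmod_of_gcd_eq_one 1 hv.1, by simp⟩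
  refine ⟨fun p hp => D.summable_localTerm hG hp, fun N => ?_, ?_⟩
  · rcases Set.eq_empty_or_nonempty (EllFamily.countSet f g m N) with he | ⟨v, hv⟩
    · rw [he]
      exact Set.finite_empty
    · have hN := D.one_le_of_mem_countSet hv
      rw [hset hN]
      exact D.finite_ballSet hG (hX hN) α₀
  · obtain ⟨ε, K, hε, -, hratio⟩ := D.exists_abs_ratio_sub_le hG
    have hm0 : (0 : ℝ) < m := by exact_mod_cast hm
    -- A saving of `X^(-ε)` with `X = N^(1/(12m))` is a saving of `N^(-ε/(12m))`.
    refine ⟨1 / (12 * m : ℝ) * ε, by positivity, K, fun q hq α a₁ b₁ hα hgcd N hne => ?_⟩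
    obtain ⟨v, hv⟩ := hne
    have hN := D.one_le_of_mem_countSet hv
    have h1 := hratio q hq α
      (fun k hk T => EllFamily.FamilyData.condPts_eq_empty hG hα hgcd hk T) α₀ _ (hX hN)
      ⟨v, hset hN ▸ hv⟩
    rw [D.countSetMod_eq (by linarith) α, hset hN]
    rwa [← Real.rpow_mul (by linarith), mul_neg] at h1
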